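/- **Setting.** Let $\mathcal C$ be a monadically NIP class of finite non-empty structures over a fixed relational signature: for every expansion of the signature by unary predicates, no first-order formula $\psi(\bar x,\bar y)$ shatters arbitrarily large sets of tuples in the expansions of the structures of $\mathcal C$. It is monadically stable if, in the same expansions, no formula $\psi(\bar x,\bar y)$ defines arbitrarily long orders, i.e. tuples with $\psi(\bar a_i,\bar b_j)\iff i\le j$. Let $\phi(x,y)$ and $\alpha(\bar x,y)$ be formulas, with $x,y$ single variables, and $r=|\bar x|$. Write $N_\phi(a)=\{b: \mathbf A\models\phi(a,b)\}$ and $N_\alpha(\bar a)=\{b:\mathbf A\models\alpha(\bar a,b)\}$. Sequences of tuples are without repetitions. For $k\in\mathbb N$ let $\mathcal C_k$ be the class of all expansions of structures of $\mathcal C$ by $k$ constants $c_1,\dots,c_k$. Let $\Phi_k(x,\bar y)=\{\mathrm{eq}^\phi_\alpha(c_i,x,\bar y): 1\le i\le k\}$, where $$\mathrm{eq}^\phi_\alpha(x,x',\bar y):=\big(\alpha(\bar y,x)\leftrightarrow\alpha(\bar y,x')\big)\wedge\forall w\,\big(\alpha(\bar y,w)\to(\phi(x,w)\leftrightarrow\phi(x',w))\big).$$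 Let $\Delta_k$ be the set of all formulas $\exists x\bigwedge_{j\le i}\phi_j(x,\bar y_j)$ in the variables $(\bar y_1,\dots,\bar y_i)$, where $i\le k$ and every $\phi_j(x,\bar y)$ is a boolean combination of formulas in $\Phi_k$. A sequence $(\bar a_1,\dots,\bar a_n)$ is $\Delta_k$-indiscernible if for every $\gamma(\bar y_1,\dots,\bar y_i)\in\Delta_k$ the truth value of $\gamma(\bar a_{j_1},\dots,\bar a_{j_i})$ is the same for all $j_1<\dots<j_i$. Algorithms are programs of a unit-cost random access machine (with addition and truncated subtraction) that can ask whether a relation of the given structure $\mathbf A$ holds of a tuple (and for the value of a constant); the elements of $\mathbf A$ are numbered in an arbitrary way. $\mathcal C_k$ *admits $(f,T,\Delta_k)$-indiscernible extraction*, where $f:\mathbb N\to\mathbb N$ and $T:\mathbb N\times\mathbb N\to\mathbb N$, if some algorithm, given a structure $\mathbf A\in\mathcal C_k$ and a sequence $J$ of $f(m)$ many $r$-tuples of $\mathbf A$, computes a $\Delta_k$-indiscernible subsequence of $J$ of length $m$ in time $T(|J|,|\mathbf A|)$. **Theorem.** There are $c,k_0\in\mathbb N$, depending only on $\mathcal C,\phi,\alpha$,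 such that the following holds for all $k\ge k_0$ and all $f,T$ such that $\mathcal C_k$ admits $(f,T,\Delta_k)$-indiscernible extraction. Let $g(n):=f(n)+3$ and let $N:=g^k$ be the $k$-fold iterate of $g$. 1. For all $\mathbf A\in\mathcal C$, all $m\ge1$ and all sequences $J$ of $N(m)$ many $r$-tuples of $\mathbf A$ with pairwise disjoint $\alpha$-neighborhoods there are a subsequence $I=(\bar a_1,\dots,\bar a_m)$ of $J$ and a set $S\subseteq\mathbf A$ with $|S|\le k$ such that $(*)$ for every $a\in\mathbf A$ there are $\mathrm{ex}(a)\in\{1,\dots,m\}$ and $s_<(a),s_>(a)\in S$ with $$N_\alpha(\bar a_i)\cap N_\phi(a)=N_\alpha(\bar a_i)\cap N_\phi(s_<(a))\ \text{ for all } 1\le i<\mathrm{ex}(a),$$ $$N_\alpha(\bar a_i)\cap N_\phi(a)=N_\alpha(\bar a_i)\cap N_\phi(s_>(a))\ \text{ for all }\mathrm{ex}(a)<i\le m,$$ such that $i=\mathrm{ex}(a)$ whenever $a\in N_\alpha(\bar a_i)$, and such that $s_<(a)=s_>(a)$ if $\mathcal C$ is monadically stable. 2. Suppose moreover that $T$ is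 non-decreasing in its first argument, and that some algorithm, given $\mathbf A\in\mathcal C$ and $a,b\in\mathbf A$, checks in time $F_\phi(|\mathbf A|)$ whether $\mathbf A\models\phi(a,b)$. Then there is an algorithm that, given $\mathbf A\in\mathcal C$ and a sequence $J$ as in 1 together with its $\alpha$-neighborhoods, computes $I$ of length $m$ and $S$ with $|S|\le k$ satisfying $(*)$ in time at most $$c\cdot\big(k\cdot T(|J|,|\mathbf A|)+k^2\cdot F_\phi(|\mathbf A|)\cdot|\mathbf A|^2\big).$$ -/

import Mathlib

open FirstOrder FirstOrder.Language CategoryTheory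

universe u v w

namespace DisjointFamilies

/-! ### Classes of structures, expansions, monadic stability and monadic dependence -/

section Classes

variable {L : FirstOrder.Language.{u, v}}

/-- The class of all `L'`-structures whose reduct along `ι : L →ᴸ L'` belongs to `C`. -/
def expansions {L' : FirstOrder.Language.{u, v}} (ι : L →ᴸ L')
    (C : Set (Bundled.{w} L.Structure)) :
    Set (Bundled.{w} L'.Structure) :=
  {B | (⟨B, ι.reduct B⟩ : Bundled.{w} L.Structure) ∈ C}

/-- The language with one unary predicate for every element of `κ`, and nothing else. -/
def colorLanguage (κ : Type) : FirstOrder.Language.{u, v} where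
  Functions := fun _ => PEmpty
  Relations := fun n => match n with
    | 1 => ULift κ
    | _ => PEmpty

/-- The class of all expansions of structures in `C` by unary predicates indexed by `κ`. -/
def colorings (C : Set (Bundled.{w} L.Structure)) (κ : Type) :
    Set (Bundled.{w} (L.sum (colorLanguage.{u, v} κ)).Structure) :=
  expansions LHom.sumInl C

/-- The class of all expansions of structures in `C` by `k` constants. -/
def withConstantSymbols (C : Set (Bundled.{w} L.Structure)) (k : ℕ) :
    Set (Bundled.{w} (L[[Fin k]]).Structure) :=
  expansions (L.lhomWithConstants (Fin k)) C

/-- The partitioned formula `φ(x̄, ȳ)` has the `n`-order property on `C` for all `n`. -/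
def HasOrderProperty (C : Set (Bundled.{w} L.Structure)) {p q : ℕ}
    (φ : L.Formula (Fin p ⊕ Fin q)) : Prop :=
  ∀ n : ℕ, ∃ A ∈ C, ∃ (a : Fin n → Fin p → A) (b : Fin n → Fin q → A),
    ∀ i j, φ.Realize (Sum.elim (a i) (b j)) ↔ i ≤ j

/-- The set `X` of tuples is shattered by `φ(x̄, ȳ)`. -/
def Shatters {M : Type w} [L.Structure M] {p q : ℕ} (φ : L.Formula (Fin p ⊕ Fin q))
    (X : Set (Fin p → M)) : Prop :=
  ∀ J ⊆ X, ∃ b : Fin q → M, ∀ a ∈ X, φ.Realize (Sum.elim a b) ↔ a ∈ J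

/-- `φ(x̄, ȳ)` shatters arbitrarily large sets in structures from `C`. -/
def HasIndependenceProperty (C : Set (Bundled.{w} L.Structure)) {p q : ℕ}
    (φ : L.Formula (Fin p ⊕ Fin q)) : Prop :=
  ∀ n : ℕ, ∃ A ∈ C, ∃ X : Set (Fin p → A), (n : ℕ∞) ≤ X.encard ∧ Shatters φ X

def IsStableClass (C : Set (Bundled.{w} L.Structure)) : Prop :=
  ∀ (p q : ℕ) (φ : L.Formula (Fin p ⊕ Fin q)), ¬ HasOrderProperty C φ

def IsNIPClass (C : Set (Bundled.{w} L.Structure)) : Prop :=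
  ∀ (p q : ℕ) (φ : L.Formula (Fin p ⊕ Fin q)), ¬ HasIndependenceProperty C φ

def IsMonadicallyStable (C : Set (Bundled.{w} L.Structure)) : Prop :=
  ∀ κ : Type, IsStableClass (colorings C κ)

def IsMonadicallyNIP (C : Set (Bundled.{w} L.Structure)) : Prop :=
  ∀ κ : Type, IsNIPClass (colorings C κ)

end Classes

/-! ### Neighborhoods, indiscernible sequences and the formulas that control them -/

section Formulas

variable {L : FirstOrder.Language.{u, v}} {r : ℕ}

/-- `N_φ(a)` for `φ(x, y)` with single variables `x` (index `0`) and `y` (index `1`). -/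
def nbhd {M : Type w} [L.Structure M] (φ : L.Formula (Fin 2)) (a : M) : Set M :=
  {b | φ.Realize ![a, b]}

/-- `N_α(ā)` for `α(x̄, y)` with `x̄` of length `r` and a single variable `y`. -/
def tupleNbhd {M : Type w} [L.Structure M] (α : L.Formula (Fin r ⊕ Unit)) (a : Fin r → M) :
    Set M :=
  {b | α.Realize (Sum.elim a fun _ => b)}

/-- A formula `ψ(ȳ₁, …, ȳᵢ)` in `i` tuples of variables, each of length `r`. -/
abbrev SeqFormula (L : FirstOrder.Language.{u, v}) (r : ℕ) := Σ i : ℕ, L.Formula (Fin i × Fin r)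

/-- The sequence `a` of `r`-tuples is `Δ`-indiscernible. -/
def IsIndiscernible {M : Type w} [L.Structure M] (Δ : Set (SeqFormula L r)) {n : ℕ}
    (a : Fin n → Fin r → M) : Prop :=
  ∀ ψ ∈ Δ, ∀ i j : Fin ψ.1 ↪o Fin n,
    ψ.2.Realize (fun z => a (i z.1) z.2) ↔ ψ.2.Realize (fun z => a (j z.1) z.2)

/-- Boolean combinations of formulas in `Φ`. -/
inductive BoolComb {γ : Type} (Φ : Set (L.Formula γ)) : L.Formula γ → Prop
  | base {φ : L.Formula γ} : φ ∈ Φ → BoolComb Φ φ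
  | bot : BoolComb Φ ⊥
  | imp {φ ψ : L.Formula γ} : BoolComb Φ φ → BoolComb Φ ψ → BoolComb Φ (φ.imp ψ)

/-- The formula `γ(ȳ₁, …, ȳᵢ) = ∃ x, ⋀ⱼ φⱼ(x, ȳⱼ)`. -/
noncomputable def patternFormula {i : ℕ} (φ : Fin i → L.Formula (Unit ⊕ Fin r)) :
    L.Formula (Fin i × Fin r) :=
  Formula.iExs Unit
    (Formula.iInf fun j => (φ j).relabel (Sum.elim Sum.inr fun c => Sum.inl (j, c)))

/-- The set `Δ_k^Φ` of all formulas `γ_(φ₁, …, φᵢ)` with `i ≤ k` and each `φⱼ(x, ȳ)` a boolean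
combination of formulas in `Φ(x, ȳ)`. -/
def patternFormulas (k : ℕ) (Φ : Set (L.Formula (Unit ⊕ Fin r))) : Set (SeqFormula L r) :=
  {ψ | ∃ (i : ℕ) (φ : Fin i → L.Formula (Unit ⊕ Fin r)),
    i ≤ k ∧ (∀ j, BoolComb Φ (φ j)) ∧ ψ = ⟨i, patternFormula φ⟩}

/-- The formula `eq^φ_α(x, y, z̄)`, that is,
`(α(z̄, x) ↔ α(z̄, y)) ∧ ∀ w, (α(z̄, w) → (φ(x, w) ↔ φ(y, w)))`,
where `x`, `y` are the variables `inl 0`, `inl 1`, and `z̄` are the variables `inr _`. -/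
noncomputable def eqFormula (φ : L.Formula (Fin 2)) (α : L.Formula (Fin r ⊕ Unit)) :
    L.Formula (Fin 2 ⊕ Fin r) :=
  ((α.relabel (Sum.elim Sum.inr fun _ => Sum.inl 0)).iff
      (α.relabel (Sum.elim Sum.inr fun _ => Sum.inl 1))) ⊓
    Formula.iAlls Unit
      ((α.relabel (Sum.elim (fun c => Sum.inl (Sum.inr c)) Sum.inr)).imp
        ((φ.relabel ![Sum.inl (Sum.inl 0), Sum.inr ()]).iff
          (φ.relabel ![Sum.inl (Sum.inl 1), Sum.inr ()])))

/-- The formula `eq^φ_α(c_i, x, ȳ)` in the language with `k` additional constants. -/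
noncomputable def eqConstFormula (φ : L.Formula (Fin 2)) (α : L.Formula (Fin r ⊕ Unit)) {k : ℕ}
    (i : Fin k) : (L[[Fin k]]).Formula (Unit ⊕ Fin r) :=
  BoundedFormula.subst ((L.lhomWithConstants (Fin k)).onFormula (eqFormula φ α))
    (Sum.elim ![Constants.term (L.con i), Term.var (Sum.inl ())]
      fun c => Term.var (Sum.inr c))

/-- The set `Φ(x, ȳ) = {eq^φ_α(c_i, x, ȳ) : i ∈ [k]}`. -/
def eqConstFormulas (φ : L.Formula (Fin 2)) (α : L.Formula (Fin r ⊕ Unit)) (k : ℕ) :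
    Set ((L[[Fin k]]).Formula (Unit ⊕ Fin r)) :=
  Set.range fun i : Fin k => eqConstFormula φ α i

/-- `J` has pairwise disjoint `α`-neighborhoods. -/
def HasDisjointNbhds {M : Type w} [L.Structure M] (α : L.Formula (Fin r ⊕ Unit)) {l : ℕ}
    (J : Fin l → Fin r → M) : Prop :=
  Pairwise fun i j => Disjoint (tupleNbhd α (J i)) (tupleNbhd α (J j))

/-- Every element `a` has an exceptional index `ex` and sample elements `s, s' ∈ S` such that the
`φ`-neighborhood of `a` agrees with that of `s` (of `s'`) on every `α`-neighborhood of a tuple of `I`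
before (after) the index `ex`; only index `ex` can have `a` in its `α`-neighborhood. If `single`
holds then moreover `s = s'`. -/
def IsSampledBy {M : Type w} [L.Structure M] (φ : L.Formula (Fin 2))
    (α : L.Formula (Fin r ⊕ Unit)) (single : Prop) {m : ℕ} (I : Fin m → Fin r → M)
    (S : Set M) : Prop :=
  ∀ a : M, ∃ ex : Fin m, ∃ s ∈ S, ∃ s' ∈ S,
    (∀ i < ex, tupleNbhd α (I i) ∩ nbhd φ a = tupleNbhd α (I i) ∩ nbhd φ s) ∧
    (∀ i > ex, tupleNbhd α (I i) ∩ nbhd φ a = tupleNbhd α (I i) ∩ nbhd φ s') ∧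
    (∀ i, a ∈ tupleNbhd α (I i) → i = ex) ∧
    (single → s = s')

end Formulas

/-! ### A random access machine over finite structures, with running times

A program works on finitely many arrays of natural numbers: read-only input arrays and work arrays.
The elements of a structure with `n` elements are presented to it as the numbers `0, …, n - 1`; it
accesses the structure by asking, for single tuples, whether a relation holds and what the value of
a function is. Arithmetic is addition and truncated subtraction. -/

section Machine

/-- `m a i` is the content of cell `i` of array `a`. -/
abbrev Memory := ℕ → ℕ → ℕ

/-- Expressions over the cells of input arrays and of work arrays. -/
inductive Expr : Type
  | const (c : ℕ) : Expr
  | input (a : ℕ) (i : Expr) : Expr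
  | work (a : ℕ) (i : Expr) : Expr
  | add (e₁ e₂ : Expr) : Expr
  | sub (e₁ e₂ : Expr) : Expr

def Expr.eval (inp wk : Memory) : Expr → ℕ
  | .const c => c
  | .input a i => inp a (i.eval inp wk)
  | .work a i => wk a (i.eval inp wk)
  | .add e₁ e₂ => e₁.eval inp wk + e₂.eval inp wk
  | .sub e₁ e₂ => e₁.eval inp wk - e₂.eval inp wk

/-- The time to evaluate an expression: one step per operation. -/
def Expr.cost : Expr → ℕ
  | .const _ => 1
  | .input _ i => i.cost + 1
  | .work _ i => i.cost + 1
  | .add e₁ e₂ => e₁.cost + e₂.cost + 1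
  | .sub e₁ e₂ => e₁.cost + e₂.cost + 1

/-- Programs for structures in the language `L`. In `call p ins outs` the subprogram `p` gets the
listed arrays of the caller (`inl a`: input array `a`, `inr a`: work array `a`) as its read-only
input arrays `0, 1, …`, starts with fresh work arrays, and on return its work arrays `0, 1, …`
become the work arrays of the caller listed in `outs`. -/
inductive Prog (L : FirstOrder.Language.{u, v}) : Type (max u v)
  | skip : Prog L
  | store (a : ℕ) (i e : Expr) : Prog L
  | rel {d : ℕ} (R : L.Relations d) (args : Fin d → Expr) (a : ℕ) (i : Expr) : Prog L
  | func {d : ℕ} (f : L.Functions d) (args : Fin d → Expr) (a : ℕ) (i : Expr) : Prog L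
  | seq (p q : Prog L) : Prog L
  | ite (e : Expr) (p q : Prog L) : Prog L
  | while (e : Expr) (p : Prog L) : Prog L
  | call (p : Prog L) (ins : List (ℕ ⊕ ℕ)) (outs : List ℕ) : Prog L

def Memory.write (wk : Memory) (a i x : ℕ) : Memory :=
  Function.update wk a (Function.update (wk a) i x)

/-- The input arrays of a called subprogram. -/
def passInputs (inp wk : Memory) (ins : List (ℕ ⊕ ℕ)) : Memory := fun b =>
  match ins[b]? with
  | some (Sum.inl a) => inp a
  | some (Sum.inr a) => wk a
  | none => fun _ => 0

/-- The work arrays of the caller after a subprogram has returned with work arrays `res`. -/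
def returnOutputs (wk res : Memory) (outs : List ℕ) : Memory := fun a =>
  if a ∈ outs then res (outs.idxOf a) else wk a

variable {L : FirstOrder.Language.{u, v}} {M : Type w} [L.Structure M] {n : ℕ}

open Classical in
/-- The answer (`1` or `0`) to the question whether the elements with the given numbers satisfy
`R`; it is `0` if one of the numbers does not belong to an element. -/
noncomputable def relAnswer (enum : Fin n ≃ M) {d : ℕ} (R : L.Relations d) (x : Fin d → ℕ) : ℕ :=
  if ∃ h : ∀ j, x j < n, Structure.RelMap R fun j => enum ⟨x j, h j⟩ then 1 else 0

open Classical in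
/-- The number of the value of `f` at the elements with the given numbers; it is `0` if one of the
numbers does not belong to an element. -/
noncomputable def funcAnswer (enum : Fin n ≃ M) {d : ℕ} (f : L.Functions d) (x : Fin d → ℕ) : ℕ :=
  if h : ∀ j, x j < n then
    (enum.symm (Structure.funMap f fun j => enum ⟨x j, h j⟩) : ℕ)
  else 0

/-- `Exec enum p inp wk t wk'`: on the structure `M`, whose elements are numbered by `enum`, the
program `p` with input arrays `inp`, started with work arrays `wk`, halts after exactly `t` steps
with work arrays `wk'`. -/
inductive Exec (enum : Fin n ≃ M) : Prog L → Memory → Memory → ℕ → Memory → Prop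
  | skip (inp wk : Memory) : Exec enum .skip inp wk 1 wk
  | store (a : ℕ) (i e : Expr) (inp wk : Memory) :
      Exec enum (.store a i e) inp wk (i.cost + e.cost + 1)
        (wk.write a (i.eval inp wk) (e.eval inp wk))
  | rel {d : ℕ} (R : L.Relations d) (args : Fin d → Expr) (a : ℕ) (i : Expr) (inp wk : Memory) :
      Exec enum (.rel R args a i) inp wk ((∑ j, (args j).cost) + i.cost + 1)
        (wk.write a (i.eval inp wk) (relAnswer enum R fun j => (args j).eval inp wk))
  | func {d : ℕ} (f : L.Functions d) (args : Fin d → Expr) (a : ℕ) (i : Expr)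
      (inp wk : Memory) :
      Exec enum (.func f args a i) inp wk ((∑ j, (args j).cost) + i.cost + 1)
        (wk.write a (i.eval inp wk) (funcAnswer enum f fun j => (args j).eval inp wk))
  | seq {p q : Prog L} {inp wk wk₁ wk₂ : Memory} {t₁ t₂ : ℕ} :
      Exec enum p inp wk t₁ wk₁ → Exec enum q inp wk₁ t₂ wk₂ →
      Exec enum (.seq p q) inp wk (t₁ + t₂) wk₂
  | ite_true {e : Expr} {p q : Prog L} {inp wk wk' : Memory} {t : ℕ} :
      e.eval inp wk ≠ 0 → Exec enum p inp wk t wk' →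
      Exec enum (.ite e p q) inp wk (e.cost + t + 1) wk'
  | ite_false {e : Expr} {p q : Prog L} {inp wk wk' : Memory} {t : ℕ} :
      e.eval inp wk = 0 → Exec enum q inp wk t wk' →
      Exec enum (.ite e p q) inp wk (e.cost + t + 1) wk'
  | while_true {e : Expr} {p : Prog L} {inp wk wk₁ wk₂ : Memory} {t₁ t₂ : ℕ} :
      e.eval inp wk ≠ 0 → Exec enum p inp wk t₁ wk₁ → Exec enum (.while e p) inp wk₁ t₂ wk₂ →
      Exec enum (.while e p) inp wk (e.cost + t₁ + t₂ + 1) wk₂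
  | while_false {e : Expr} {p : Prog L} {inp wk : Memory} :
      e.eval inp wk = 0 → Exec enum (.while e p) inp wk (e.cost + 1) wk
  | call {p : Prog L} {ins : List (ℕ ⊕ ℕ)} {outs : List ℕ} {inp wk res : Memory} {t : ℕ} :
      Exec enum p (passInputs inp wk ins) (fun _ _ => 0) t res →
      Exec enum (.call p ins outs) inp wk (ins.length + outs.length + t + 1)
        (returnOutputs wk res outs)

/-- Started with empty work arrays, `p` halts within `T` steps, with work arrays satisfying `Q`. -/
def HaltsWithin (enum : Fin n ≃ M) (p : Prog L) (inp : Memory) (T : ℕ) (Q : Memory → Prop) :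
    Prop :=
  ∃ (t : ℕ) (res : Memory), Exec enum p inp (fun _ _ => 0) t res ∧ t ≤ T ∧ Q res

/-- The input consists of the size of the structure and of the sequence `J`: cell `i` of array
`c + 1` holds the number of the `c`-th component of the `i`-th tuple. -/
def EncodesSequence (enum : Fin n ≃ M) {r l : ℕ} (J : Fin l → Fin r → M) (inp : Memory) : Prop :=
  inp 0 0 = n ∧ inp 0 1 = l ∧
    ∀ (i : Fin l) (c : Fin r), inp (c + 1) i = (enum.symm (J i c) : ℕ)

/-- Array `r + 1` of the input holds the `α`-neighborhoods of the sequence `J`, assumed to be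
disjoint: the cell of an element `a` contains `i + 1` if `a` lies in the neighborhood of the `i`-th
tuple, and `0` if it lies in none. -/
def EncodesNbhds (enum : Fin n ≃ M) {r l : ℕ} (α : L.Formula (Fin r ⊕ Unit))
    (J : Fin l → Fin r → M) (inp : Memory) : Prop :=
  ∀ a : M, (∀ i : Fin l, a ∈ tupleNbhd α (J i) → inp (r + 1) (enum.symm a) = i + 1) ∧
    ((∀ i : Fin l, a ∉ tupleNbhd α (J i)) → inp (r + 1) (enum.symm a) = 0)

/-- The output describes a subsequence, by its length (cell `0` of array `0`) and the increasing
list of its positions (array `1`). -/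
def ReturnsSubsequence {m l : ℕ} (I : Fin m ↪o Fin l) (res : Memory) : Prop :=
  res 0 0 = m ∧ ∀ i : Fin m, res 1 i = I i

/-- The output describes a list of elements, by its length (cell `1` of array `0`) and the numbers
of the elements (array `2`). -/
def ReturnsElements (enum : Fin n ≃ M) {p : ℕ} (s : Fin p → M) (res : Memory) : Prop :=
  res 0 1 = p ∧ ∀ i : Fin p, res 2 i = (enum.symm (s i) : ℕ)

/-- The class `C` of finite structures admits `(f, T, Δ)`-indiscernible extraction: there is a
program that, given a sequence `J` of `f m` (distinct) tuples in a structure from `C`, extracts a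
`Δ`-indiscernible subsequence of length `m` in time `T |J| |A|`. -/
def AdmitsExtraction (C : Set (Bundled.{w} L.Structure)) {r : ℕ} (f : ℕ → ℕ) (T : ℕ → ℕ → ℕ)
    (Δ : Set (SeqFormula L r)) : Prop :=
  ∃ P : Prog L, ∀ A ∈ C, ∀ (n : ℕ) (enum : Fin n ≃ A) (m : ℕ) (J : Fin (f m) → Fin r → A),
    Function.Injective J → ∀ inp : Memory, EncodesSequence enum J inp →
      HaltsWithin enum P inp (T (f m) n) fun res =>
        ∃ I : Fin m ↪o Fin (f m), ReturnsSubsequence I res ∧ IsIndiscernible Δ (J ∘ I)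

/-- There is a program that, given elements `a`, `b` of a structure `A` from `C`, checks in time
`F |A|` whether `A ⊨ φ(a, b)`. -/
def IsCheckableInTime (C : Set (Bundled.{w} L.Structure)) (φ : L.Formula (Fin 2)) (F : ℕ → ℕ) :
    Prop :=
  ∃ P : Prog L, ∀ A ∈ C, ∀ (n : ℕ) (enum : Fin n ≃ A) (a b : A) (inp : Memory),
    inp 0 0 = n → inp 1 0 = enum.symm a → inp 1 1 = enum.symm b →
      HaltsWithin enum P inp (F n) fun res =>
        (b ∈ nbhd φ a → res 0 0 = 1) ∧ (b ∉ nbhd φ a → res 0 0 = 0)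

end Machine

end DisjointFamilies

open DisjointFamilies

/-! Fix sample elements `σ` and let the type of `x` at a tuple be the set of those `i` for which `x`
is equivalent to `σ i` over that tuple (`eqType`). Wherever the type of `x` is nonempty, a sample
agrees with `x` on the whole neighborhood. It therefore suffices to find boundedly many samples and
a subsequence along which every element has one nonempty type before some exceptional index and one
nonempty type after it.

Samples are collected greedily along a sequence that is kept indiscernible over them. If some `x`
avoids the neighborhoods of all but three tuples and differs from every sample inside each of these
neighborhoods, then `x` becomes a sample, the three tuples are dropped, and an indiscernible
subsequence is extracted again. New samples can be found only boundedly often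
(`exists_bound_distinguished`): elements that are pairwise distinguished inside many disjoint
neighborhoods contain fixed pairs that are split by private points in each of many neighborhoods,
and colouring some of these points encodes arbitrary sets, against monadic dependence.

Indiscernibility says that realisability of a short word of types does not depend on the positions
(`WordIndiscernible`). If the types of one element changed at two separate places, then for all `s`
and `t` some element would mark exactly the pair `s` in one block of positions and the pair `t` in
another (`WordIndiscernible.exists_double_change`). A colour on these elements then encodes an
arbitrary binary relation between pairs (`exists_bound_doubleChange`). Hence types are constant
before and after one index (`exists_bound_exceptional`). In a monadically stable class the two
values agree, since otherwise the jump could be moved along the sequence and would define a long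
order (`exists_bound_single`).

Suppose that no new sample exists. Then no element has empty type at two positions: otherwise some
element would have empty type at the first and the last position, hence everywhere except at one
index, and would itself be a new sample. After removing the ends of the sequence, both constant
types are nonempty. Samples avoid the neighborhoods, so an element inside a neighborhood has empty
type there, and this can only happen at its exceptional index (`isSampledBy_of_not_keeps`). Being
sampled survives further rounds (`IsSampledBy.comp`), so one extraction followed by `k - 1` rounds
works uniformly.

For the running time, the truth table of `φ` is computed once. A candidate is tested against all
samples and all tuples by one pass over the elements per sample (`Prog.measure`), so a round costs
order `k n ^ 2` plus one extraction. Constants are simulated by an array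
(`Exec.eliminateConstants`), and the work on an extracted sequence is absorbed into the extraction
time because the extractor had to write that sequence (`Exec.le_of_returnsSubsequence`). -/

namespace DisjointFamilies

/-! ### Semantics of the defining formulas, colourings, and uniform bounds from dependence and
stability -/

section Logic

variable {L : FirstOrder.Language.{u, v}} {r : ℕ}

/-- `a` and `b` satisfy `eq^φ_α(a, b, z)`. -/
def EqOver {M : Type w} [L.Structure M] (φ : L.Formula (Fin 2)) (α : L.Formula (Fin r ⊕ Unit))
    (a b : M) (z : Fin r → M) : Prop :=
  (a ∈ tupleNbhd α z ↔ b ∈ tupleNbhd α z) ∧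
    ∀ w ∈ tupleNbhd α z, (w ∈ nbhd φ a ↔ w ∈ nbhd φ b)

theorem realize_eqFormula {M : Type w} [L.Structure M] (φ : L.Formula (Fin 2))
    (α : L.Formula (Fin r ⊕ Unit)) (v : Fin 2 ⊕ Fin r → M) :
    (eqFormula φ α).Realize v ↔
      EqOver φ α (v (Sum.inl 0)) (v (Sum.inl 1)) (fun c => v (Sum.inr c)) := by
  have h1 : ∀ t : Fin 2, (v ∘ Sum.elim Sum.inr fun _ : Unit => Sum.inl t) =
      Sum.elim (fun c => v (Sum.inr c)) fun _ : Unit => v (Sum.inl t) := by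
    intro t; funext c; rcases c with c | c <;> rfl
  have h2 : ∀ i : Unit → M, (Sum.elim v i ∘ Sum.elim (fun c : Fin r => Sum.inl (Sum.inr c)) Sum.inr)
      = Sum.elim (fun c => v (Sum.inr c)) fun _ : Unit => i () := by
    intro t; funext c; rcases c with c | c <;> rfl
  have h3 : ∀ (i : Unit → M) (t : Fin 2),
      (Sum.elim v i ∘ ![Sum.inl (Sum.inl t), Sum.inr ()]) = ![v (Sum.inl t), i ()] := by
    intro i t; funext c; fin_cases c <;> rfl
  simp only [eqFormula, Formula.realize_inf, Formula.realize_iff, Formula.realize_relabel,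
    Formula.realize_iAlls, Formula.realize_imp, EqOver, tupleNbhd, nbhd, h1, h2, h3,
    Set.mem_ofPred_eq]
  exact and_congr Iff.rfl ⟨fun h w => h fun _ => w, fun h i => h (i ())⟩

/-- The structure on `M` in which the constant symbol `i` is interpreted by `σ i`. -/
@[reducible] def constantStructure {M : Type w} [L.Structure M] {k : ℕ} (σ : Fin k → M) :
    (L[[Fin k]]).Structure M :=
  let := constantsOn.structure σ
  inferInstance

theorem realize_eqConstFormula {M : Type w} [L.Structure M] (φ : L.Formula (Fin 2))
    (α : L.Formula (Fin r ⊕ Unit)) {k : ℕ} (σ : Fin k → M) (i : Fin k) (v : Unit ⊕ Fin r → M) :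
    letI := constantStructure (L := L) σ
    (eqConstFormula φ α i).Realize v ↔
      EqOver φ α (σ i) (v (Sum.inl ())) (fun c => v (Sum.inr c)) := by
  let := constantsOn.structure σ
  simp only [eqConstFormula, Formula.Realize, BoundedFormula.realize_subst]
  have := LHom.realize_onFormula (M := M) (L.lhomWithConstants (Fin k)) (eqFormula φ α)
    (v := fun a => Term.realize v (Sum.elim ![Constants.term (L.con i), Term.var (Sum.inl ())]
      (fun c => Term.var (Sum.inr c)) a : (L[[Fin k]]).Term (Unit ⊕ Fin r)))
  rw [Formula.Realize] at this
  refine Iff.trans this ((realize_eqFormula φ α _).trans ?_)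
  simp
  rfl

/-- The structure on `M` for one unary predicate, interpreted by `Z`. -/
@[reducible] def colorStructure {M : Type w} (Z : Set M) :
    (colorLanguage.{u, v} Unit).Structure M where
  funMap := fun f => PEmpty.elim f
  RelMap := fun {n} => match n with
    | 0 => fun R => PEmpty.elim R
    | 1 => fun _ x => x 0 ∈ Z
    | _ + 2 => fun R => PEmpty.elim R

/-- The expansion of `M` by one unary predicate, interpreted by `Z`. -/
@[reducible] def coloredStructure {M : Type w} [L.Structure M] (Z : Set M) :
    (L.sum (colorLanguage.{u, v} Unit)).Structure M :=
  let := colorStructure.{u, v} Z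
  inferInstance

/-- The atomic formula saying that the element `t` is coloured. -/
def colorFormula {γ : Type} (t : γ) : (L.sum (colorLanguage.{u, v} Unit)).Formula γ :=
  Relations.formula₁ (Sum.inr (ULift.up ()) : (L.sum (colorLanguage.{u, v} Unit)).Relations 1)
    (Term.var t)

theorem realize_colorFormula {M : Type w} [L.Structure M] (Z : Set M) {γ : Type} (t : γ)
    (v : γ → M) :
    letI := coloredStructure (L := L) Z
    (colorFormula (L := L) t).Realize v ↔ v t ∈ Z := by
  let := coloredStructure (L := L) Z
  simp only [colorFormula]
  rfl

theorem realize_sumInl {M : Type w} [L.Structure M] (Z : Set M) {γ : Type} (ψ : L.Formula γ)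
    (v : γ → M) :
    letI := coloredStructure (L := L) Z
    ((LHom.sumInl : L →ᴸ L.sum (colorLanguage.{u, v} Unit)).onFormula ψ).Realize v ↔
      ψ.Realize v := by
  let := colorStructure.{u, v} Z
  exact LHom.realize_onFormula (M := M) LHom.sumInl ψ

theorem colored_mem {C : Set (Bundled.{w} L.Structure)} {A : Bundled.{w} L.Structure} (hA : A ∈ C)
    (Z : Set A) :
    (⟨A, coloredStructure (L := L) Z⟩ :
      Bundled.{w} (L.sum (colorLanguage.{u, v} Unit)).Structure) ∈ colorings C Unit :=
  hA

theorem withConstants_mem {C : Set (Bundled.{w} L.Structure)} {A : Bundled.{w} L.Structure}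
    (hA : A ∈ C) {k : ℕ} (σ : Fin k → A) :
    (⟨A, constantStructure (L := L) σ⟩ : Bundled.{w} (L[[Fin k]]).Structure) ∈
      withConstantSymbols C k :=
  hA

/-- Compactness-free use of monadic dependence: one colour suffices throughout, and parameters may
be indexed by arbitrary finite types and by sets of indices instead of sets of tuples. -/
theorem exists_bound_of_NIP {C : Set (Bundled.{w} L.Structure)} (hC : IsMonadicallyNIP C)
    {P Q : Type} [Finite P] [Finite Q]
    (ψ : (L.sum (colorLanguage.{u, v} Unit)).Formula (P ⊕ Q)) :
    ∃ n : ℕ, ∀ A ∈ C, ∀ Z : Set A, ∀ (x : Fin n → P → A) (b : Set (Fin n) → Q → A),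
      letI := coloredStructure (L := L) Z
      ¬ ∀ i E, ψ.Realize (Sum.elim (x i) (b E)) ↔ i ∈ E := by
  obtain ⟨p, ⟨eP⟩⟩ := Finite.exists_equiv_fin P
  obtain ⟨q, ⟨eQ⟩⟩ := Finite.exists_equiv_fin Q
  by_contra! hcon
  refine hC Unit p q (ψ.relabel (Sum.map eP eQ)) fun n => ?_
  obtain ⟨A, hA, Z, x, b, h⟩ := hcon n
  refine ⟨_, colored_mem hA Z, Set.range fun i => x i ∘ eP.symm, ?_, ?_⟩
  -- Shattering forces the tuples to be distinct, since the parameter for `{i}` singles out index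
  -- `i`.
  · have hinj : Function.Injective fun i => x i ∘ eP.symm := by
      intro i j hij
      have : x i = x j := by
        funext c
        simpa using congrFun hij (eP c)
      have h1 := h j {i}
      rw [← this, h i {i}] at h1
      simpa using (h1.1 rfl).symm
    rw [← Set.image_univ, hinj.encard_image]
    simp
  · intro J hJ
    refine ⟨b {i | x i ∘ eP.symm ∈ J} ∘ eQ.symm, ?_⟩
    rintro _ ⟨i, rfl⟩
    rw [Formula.realize_relabel]
    have : (Sum.elim (x i ∘ eP.symm) (b {i | x i ∘ eP.symm ∈ J} ∘ eQ.symm) ∘ Sum.map eP eQ) =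
        Sum.elim (x i) (b {i | x i ∘ eP.symm ∈ J}) := by
      funext c; rcases c with c | c <;> simp
    rw [this]
    exact h i _

/-- Here no colour is needed, so the available predicate is interpreted by the empty set. -/
theorem exists_bound_of_stable {C : Set (Bundled.{w} L.Structure)} (hC : IsMonadicallyStable C)
    {P Q : Type} [Finite P] [Finite Q] (ψ : L.Formula (P ⊕ Q)) :
    ∃ n : ℕ, ∀ A ∈ C, ∀ (x : Fin n → P → A) (b : Fin n → Q → A),
      ¬ ∀ i j, ψ.Realize (Sum.elim (x i) (b j)) ↔ i ≤ j := by
  obtain ⟨p, ⟨eP⟩⟩ := Finite.exists_equiv_fin P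
  obtain ⟨q, ⟨eQ⟩⟩ := Finite.exists_equiv_fin Q
  by_contra! hcon
  refine hC Unit p q ((LHom.sumInl).onFormula (ψ.relabel (Sum.map eP eQ))) fun n => ?_
  obtain ⟨A, hA, x, b, h⟩ := hcon n
  refine ⟨_, colored_mem hA ∅, fun i => x i ∘ eP.symm, fun i => b i ∘ eQ.symm, ?_⟩
  intro i j
  rw [realize_sumInl, Formula.realize_relabel, ← h i j]
  have : (Sum.elim (x i ∘ eP.symm) (b j ∘ eQ.symm) ∘ Sum.map eP eQ) = Sum.elim (x i) (b j) := by
    funext c; rcases c with c | c <;> simp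
  rw [this]

/-! ### The three formulas that witness failures of monadic dependence and stability -/

/-- `∃ w, Z(w) ∧ α(ȳ, w) ∧ ¬ (φ(x, w) ↔ φ(x', w))`. -/
noncomputable def splitFormula (φ : L.Formula (Fin 2)) (α : L.Formula (Fin r ⊕ Unit)) :
    (L.sum (colorLanguage.{u, v} Unit)).Formula (Fin 2 ⊕ Fin r) :=
  Formula.iExs Unit
    (colorFormula (Sum.inr ()) ⊓
      (LHom.sumInl.onFormula
        ((α.relabel (Sum.elim (fun c => Sum.inl (Sum.inr c)) Sum.inr)) ⊓
          ∼((φ.relabel ![Sum.inl (Sum.inl 0), Sum.inr ()]).iff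
            (φ.relabel ![Sum.inl (Sum.inl 1), Sum.inr ()])))))

theorem realize_splitFormula {M : Type w} [L.Structure M] (φ : L.Formula (Fin 2))
    (α : L.Formula (Fin r ⊕ Unit)) (Z : Set M) (v : Fin 2 ⊕ Fin r → M) :
    letI := coloredStructure (L := L) Z
    (splitFormula φ α).Realize v ↔
      ∃ w ∈ Z, w ∈ tupleNbhd α (fun c => v (Sum.inr c)) ∧
        ¬ (w ∈ nbhd φ (v (Sum.inl 0)) ↔ w ∈ nbhd φ (v (Sum.inl 1))) := by
  let _ := coloredStructure (L := L) Z
  have h2 : ∀ i : Unit → M, (Sum.elim v i ∘ Sum.elim (fun c : Fin r => Sum.inl (Sum.inr c)) Sum.inr)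
      = Sum.elim (fun c => v (Sum.inr c)) fun _ : Unit => i () := by
    intro t; funext c; rcases c with c | c <;> rfl
  have h3 : ∀ (i : Unit → M) (t : Fin 2),
      (Sum.elim v i ∘ ![Sum.inl (Sum.inl t), Sum.inr ()]) = ![v (Sum.inl t), i ()] := by
    intro i t; funext c; fin_cases c <;> rfl
  simp only [splitFormula, Formula.realize_iExs, Formula.realize_inf, realize_colorFormula,
    realize_sumInl, Formula.realize_relabel, Formula.realize_not, Formula.realize_iff, h2, h3]
  exact ⟨fun ⟨i, h⟩ => ⟨i (), h⟩, fun ⟨w, h⟩ => ⟨fun _ => w, h⟩⟩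

/-- `∃ x, Z(x) ∧ ¬ (eq(s, x, ȳ) ↔ eq(s, x, ȳ')) ∧ ¬ (eq(s', x, z̄) ↔ eq(s', x, z̄'))`, where `s`, `s'`
are the variables `inr (inr _)`, the tuples `ȳ`, `ȳ'` are `inl _` and `z̄`, `z̄'` are
`inr (inl _)`. -/
noncomputable def doubleChangeFormula (φ : L.Formula (Fin 2)) (α : L.Formula (Fin r ⊕ Unit)) :
    (L.sum (colorLanguage.{u, v} Unit)).Formula
      ((Fin 2 × Fin r) ⊕ ((Fin 2 × Fin r) ⊕ Fin 2)) :=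
  let f (t : Fin 2) (g : Fin r → (Fin 2 × Fin r) ⊕ ((Fin 2 × Fin r) ⊕ Fin 2)) :
      L.Formula (((Fin 2 × Fin r) ⊕ ((Fin 2 × Fin r) ⊕ Fin 2)) ⊕ Unit) :=
    (eqFormula φ α).relabel
      (Sum.elim ![Sum.inl (Sum.inr (Sum.inr t)), Sum.inr ()] fun c => Sum.inl (g c))
  Formula.iExs Unit
    (colorFormula (Sum.inr ()) ⊓
      (LHom.sumInl.onFormula
        (∼((f 0 fun c => Sum.inl (0, c)).iff (f 0 fun c => Sum.inl (1, c))) ⊓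
          ∼((f 1 fun c => Sum.inr (Sum.inl (0, c))).iff
            (f 1 fun c => Sum.inr (Sum.inl (1, c)))))))

theorem realize_doubleChangeFormula {M : Type w} [L.Structure M] (φ : L.Formula (Fin 2))
    (α : L.Formula (Fin r ⊕ Unit)) (Z : Set M) (y z : Fin 2 → Fin r → M) (s : Fin 2 → M) :
    letI := coloredStructure (L := L) Z
    (doubleChangeFormula φ α).Realize
        (Sum.elim (fun c => y c.1 c.2) (Sum.elim (fun c => z c.1 c.2) s)) ↔
      ∃ x ∈ Z, ¬ (EqOver φ α (s 0) x (y 0) ↔ EqOver φ α (s 0) x (y 1)) ∧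
        ¬ (EqOver φ α (s 1) x (z 0) ↔ EqOver φ α (s 1) x (z 1)) := by
  let := coloredStructure (L := L) Z
  simp only [doubleChangeFormula, Formula.realize_iExs, Formula.realize_inf, realize_colorFormula,
    realize_sumInl, Formula.realize_relabel, Formula.realize_not, Formula.realize_iff,
    realize_eqFormula, Function.comp_def]
  exact ⟨fun ⟨i, h⟩ => ⟨i (), h⟩, fun ⟨w, h⟩ => ⟨fun _ => w, h⟩⟩

/-- The formula `eq(x₀, x₁, ȳ)`, or its negation if `pos` is false, with object variables `ȳ`. -/
noncomputable def signedEqFormula (φ : L.Formula (Fin 2)) (α : L.Formula (Fin r ⊕ Unit))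
    (pos : Bool) : L.Formula (Fin r ⊕ Fin 2) :=
  let ψ := (eqFormula φ α).relabel (Sum.elim Sum.inr Sum.inl)
  if pos then ψ else ∼ψ

theorem realize_signedEqFormula {M : Type w} [L.Structure M] (φ : L.Formula (Fin 2))
    (α : L.Formula (Fin r ⊕ Unit)) (pos : Bool) (y : Fin r → M) (s : Fin 2 → M) :
    (signedEqFormula φ α pos).Realize (Sum.elim y s) ↔
      (EqOver φ α (s 0) (s 1) y ↔ pos = true) := by
  cases pos <;>
    simp [signedEqFormula, realize_eqFormula, Formula.realize_relabel]

end Logic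

/-! ### Words realised along an indiscernible sequence -/

section Words

variable {X Λ : Type*} {M : ℕ}

/-- Whether some element has a given word of at most `K` types at an increasing sequence of
positions does not depend on the positions. -/
def WordIndiscernible (K : ℕ) (ty : X → Fin M → Λ) : Prop :=
  ∀ D ≤ K, ∀ (τ : Fin D → Λ) (p q : Fin D ↪o Fin M),
    (∃ x, ∀ d, ty x (p d) = τ d) → ∃ x, ∀ d, ty x (q d) = τ d

/-- Letters of a word may be deleted at will: the deletion only changes the positions at which the
remaining word is read. -/
theorem WordIndiscernible.exists_of_sublist {K : ℕ} {ty : X → Fin M → Λ}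
    (h : WordIndiscernible K ty) {W : List Λ} (hW : W.length ≤ K) {x : X}
    (hx : W.Sublist (List.ofFn (ty x))) (q : Fin W.length ↪o Fin M) :
    ∃ y, ∀ d : Fin W.length, ty y (q d) = W[d] := by
  obtain ⟨f, hf⟩ := List.sublist_iff_exists_fin_orderEmbedding_get_eq.1 hx
  refine h W.length hW (fun d => W[d])
    (f.trans (Fin.castOrderIso (List.length_ofFn)).toOrderEmbedding) q ⟨x, fun d => ?_⟩
  have := hf d
  simp only [List.get_eq_getElem, List.getElem_ofFn] at this
  simp only [Fin.getElem_fin, this]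
  rfl

theorem List.exists_replicate_sublist [Fintype Λ] {l : List Λ} {h : ℕ}
    (hl : h * Fintype.card Λ ≤ l.length) (hne : l ≠ []) :
    ∃ a, (List.replicate h a).Sublist l := by
  classical
  have : Nonempty Λ := by
    cases l with
    | nil => exact absurd rfl hne
    | cons a _ => exact ⟨a⟩
  by_contra! hcon
  have h1 : ∀ a ∈ (Finset.univ : Finset Λ), l.count a < h := by
    intro a _
    have := hcon a
    rw [List.replicate_sublist_iff] at this
    omega
  have h2 := Finset.sum_lt_sum_of_nonempty Finset.univ_nonempty h1
  have h3 : ∑ a : Λ, l.count a = l.length := by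
    simpa using Multiset.sum_count_eq_card (s := Finset.univ) (m := (l : Multiset Λ)) (by simp)
  simp only [Finset.sum_const, Finset.card_univ, smul_eq_mul] at h2
  rw [h3, mul_comm] at h2
  omega

/-- The letters `a ≠ b` cannot both agree with the surrounding blocks. If `g₀ ≠ a`, the change
occurs at `a`; if `g₀ = a = g₁`, it occurs at `b`; otherwise a single letter of the block `g₁` is
the change. -/
theorem List.exists_change_sublist {h : ℕ} (hh : 1 ≤ h) {a b g₀ g₁ g₂ : Λ} (hab : a ≠ b) :
    ∃ U y V : Λ, U ≠ y ∧
      (List.replicate h U ++ y :: List.replicate h V).Sublist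
        (List.replicate h g₀ ++ a :: (List.replicate h g₁ ++ b :: List.replicate h g₂)) := by
  by_cases h0 : g₀ = a
  · by_cases h1 : g₁ = a
    · refine ⟨g₁, b, g₂, h1 ▸ hab, ?_⟩
      refine List.Sublist.trans ?_ (List.sublist_append_right _ _)
      exact List.sublist_cons_self _ _
    · refine ⟨g₀, g₁, g₂, fun h => h1 (h ▸ h0), ?_⟩
      refine List.Sublist.append (List.Sublist.refl _) (List.Sublist.cons _ ?_)
      have : (g₁ :: List.replicate h g₂) = List.replicate 1 g₁ ++ List.replicate h g₂ := rfl
      rw [this]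
      exact List.Sublist.append ((List.replicate_sublist_replicate _).2 hh)
        (List.sublist_cons_self _ _)
  · refine ⟨g₀, a, g₁, h0, ?_⟩
    exact List.Sublist.append (List.Sublist.refl _)
      (List.Sublist.cons_cons _ (List.sublist_append_left _ _))

theorem List.getElem_split (l : List Λ) (i : ℕ) (hi : i < l.length) :
    l = l.take i ++ l[i] :: l.drop (i + 1) := by
  simp

theorem List.getElem_change (a b : ℕ) (U y V : Λ) (i : ℕ)
    (hi : i < (List.replicate a U ++ y :: List.replicate b V).length) :
    (List.replicate a U ++ y :: List.replicate b V)[i] =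
      if i < a then U else if i = a then y else V := by
  rw [List.getElem_append]
  split_ifs with h1 <;> simp at h1
  · simp
  · omega
  · omega
  · omega
  · rename_i h5
    simp [h5]
  · rw [List.getElem_cons, dif_neg (by simp; omega)]
    simp

/-- If some element has types `a, b, c, d` at four increasing positions, `a ≠ b` and `c ≠ d`, then
arbitrary pairs of positions are coded by the places where the type of an element changes. -/
theorem WordIndiscernible.exists_double_change [Fintype Λ] {K N : ℕ} {ty : X → Fin M → Λ}
    (h : WordIndiscernible K ty) (hK : 4 * N + 4 ≤ K) (hN : 1 ≤ N)
    (hM : 5 * (4 * N * Fintype.card Λ) + 9 ≤ M) (hM' : 4 * N ≤ M)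
    {x : X} {p₁ p₂ p₃ p₄ : Fin M} (h₁₂ : p₁ < p₂) (h₂₃ : p₂ < p₃) (h₃₄ : p₃ < p₄)
    (hab : ty x p₁ ≠ ty x p₂) (hcd : ty x p₃ ≠ ty x p₄) :
    ∃ U y U' y' : Λ, U ≠ y ∧ U' ≠ y' ∧ ∀ s < N, ∀ t < N, ∃ x : X,
      (∀ (z : ℕ) (hz : z < N),
        if z = s then ty x ⟨2 * z, by omega⟩ = U ∧ ty x ⟨2 * z + 1, by omega⟩ = y
        else ty x ⟨2 * z, by omega⟩ = ty x ⟨2 * z + 1, by omega⟩) ∧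
      (∀ (z : ℕ) (hz : z < N),
        if z = t then ty x ⟨2 * N + 2 * z, by omega⟩ = U' ∧ ty x ⟨2 * N + 2 * z + 1, by omega⟩ = y'
        else ty x ⟨2 * N + 2 * z, by omega⟩ = ty x ⟨2 * N + 2 * z + 1, by omega⟩) := by
  -- The four letters are moved apart so that the five gaps have length at least `G + 1`. By
  -- pigeonhole each gap contains some letter `4 * N` times; the additional `1` makes the gaps
  -- nonempty.
  set G := 4 * N * Fintype.card Λ with hG
  have hw : ∃ x', ty x' ⟨G + 1, by omega⟩ = ty x p₁ ∧ ty x' ⟨2 * G + 3, by omega⟩ = ty x p₂ ∧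
      ty x' ⟨3 * G + 5, by omega⟩ = ty x p₃ ∧ ty x' ⟨4 * G + 7, by omega⟩ = ty x p₄ := by
    have hm1 : StrictMono ![p₁, p₂, p₃, p₄] := by
      rw [Fin.strictMono_iff_lt_succ]
      intro i; fin_cases i <;> simpa
    have hm2 : StrictMono ![(⟨G + 1, by omega⟩ : Fin M), ⟨2 * G + 3, by omega⟩,
        ⟨3 * G + 5, by omega⟩, ⟨4 * G + 7, by omega⟩] := by
      rw [Fin.strictMono_iff_lt_succ]
      intro i; fin_cases i <;> simp [Fin.lt_def] <;> omega
    obtain ⟨x', hx'⟩ := h 4 (by omega) ![ty x p₁, ty x p₂, ty x p₃, ty x p₄]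
      (OrderEmbedding.ofStrictMono _ hm1) (OrderEmbedding.ofStrictMono _ hm2)
      ⟨x, fun d => by fin_cases d <;> rfl⟩
    exact ⟨x', hx' 0, hx' 1, hx' 2, hx' 3⟩
  obtain ⟨x', ha, hb, hc, hd⟩ := hw
  rw [← ha, ← hb] at hab
  rw [← hc, ← hd] at hcd
  set a := ty x' ⟨G + 1, by omega⟩
  set b := ty x' ⟨2 * G + 3, by omega⟩
  set c := ty x' ⟨3 * G + 5, by omega⟩
  set d := ty x' ⟨4 * G + 7, by omega⟩
  have hrep : ∀ l : List Λ, G + 1 ≤ l.length → ∃ g, (List.replicate (4 * N) g).Sublist l := by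
    intro l hl
    exact List.exists_replicate_sublist (by omega) (by rintro rfl; simp at hl)
  obtain ⟨l₀, l₁, l₂, l₃, l₄, hl, hl₀, hl₁, hl₂, hl₃, hl₄⟩ : ∃ l₀ l₁ l₂ l₃ l₄ : List Λ,
      List.ofFn (ty x') = l₀ ++ a :: (l₁ ++ b :: (l₂ ++ c :: (l₃ ++ d :: l₄))) ∧
      G + 1 ≤ l₀.length ∧ G + 1 ≤ l₁.length ∧ G + 1 ≤ l₂.length ∧ G + 1 ≤ l₃.length ∧
      G + 1 ≤ l₄.length := by
    obtain ⟨l, hldef⟩ : ∃ l, l = List.ofFn (ty x') := ⟨_, rfl⟩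
    rw [← hldef]
    have hlen : l.length = M := by simp [hldef]
    refine ⟨l.take (G + 1), (l.drop (G + 2)).take (G + 1), (l.drop (2 * G + 4)).take (G + 1),
      (l.drop (3 * G + 6)).take (G + 1), l.drop (4 * G + 8), ?_, ?_, ?_, ?_, ?_, ?_⟩
    · have e1 := List.getElem_split l (G + 1) (by omega)
      have e2 := List.getElem_split (l.drop (G + 2)) (G + 1) (by simp; omega)
      have e3 := List.getElem_split (l.drop (2 * G + 4)) (G + 1) (by simp; omega)
      have e4 := List.getElem_split (l.drop (3 * G + 6)) (G + 1) (by simp; omega)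
      have i2 : (G + 2) + (G + 1) = 2 * G + 3 := by omega
      have i3 : (2 * G + 4) + (G + 1) = 3 * G + 5 := by omega
      have i4 : (3 * G + 6) + (G + 1) = 4 * G + 7 := by omega
      have j2 : (G + 2) + (G + 1 + 1) = 2 * G + 4 := by omega
      have j3 : (2 * G + 4) + (G + 1 + 1) = 3 * G + 6 := by omega
      have j4 : (3 * G + 6) + (G + 1 + 1) = 4 * G + 8 := by omega
      simp only [List.getElem_drop, List.drop_drop, i2, i3, i4, j2, j3, j4] at e1 e2 e3 e4
      have hget : ∀ (i : ℕ) (hi : i < l.length), l[i] = ty x' ⟨i, by omega⟩ := by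
        subst hldef; simp
      simp only [hget] at e1 e2 e3 e4
      refine e1.trans ?_
      congr 2
      refine e2.trans ?_
      congr 2
      refine e3.trans ?_
      congr 2
    all_goals simp only [List.length_take, List.length_drop, hlen]; omega
  obtain ⟨g₀, hg₀⟩ := hrep l₀ hl₀
  obtain ⟨g₁, hg₁⟩ := hrep l₁ hl₁
  obtain ⟨g₂, hg₂⟩ := hrep l₂ hl₂
  obtain ⟨g₃, hg₃⟩ := hrep l₃ hl₃
  obtain ⟨g₄, hg₄⟩ := hrep l₄ hl₄
  -- Each half needs blocks of length `2 * N`. Only the middle gap serves both halves and uses all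
  -- `4 * N` copies.
  have h2 : ∀ {g : Λ} {l : List Λ}, (List.replicate (4 * N) g).Sublist l →
      (List.replicate (2 * N) g).Sublist l := fun hs =>
    ((List.replicate_sublist_replicate _).2 (by omega)).trans hs
  obtain ⟨U, y, V, hUy, hL⟩ := List.exists_change_sublist (h := 2 * N) (by omega)
    (g₀ := g₀) (g₁ := g₁) (g₂ := g₂) hab
  obtain ⟨U', y', V', hUy', hR⟩ := List.exists_change_sublist (h := 2 * N) (by omega)
    (g₀ := g₂) (g₁ := g₃) (g₂ := g₄) hcd
  refine ⟨U, y, U', y', hUy, hUy', fun s hs t ht => ?_⟩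
  -- The lengths `2 * s + 1` and `2 * t + 1` are odd so that the change from `U` to `y` happens
  -- inside the pair `s`, and that from `U'` to `y'` inside the pair `t`. A possible change from `y`
  -- to `V` falls between two pairs and stays invisible.
  set W := (List.replicate (2 * s + 1) U ++ y :: List.replicate (2 * N - 2 * s - 2) V) ++
    (List.replicate (2 * t + 1) U' ++ y' :: List.replicate (2 * N - 2 * t - 2) V') with hWdef
  have hWlen : W.length = 4 * N := by simp [hWdef]; omega
  have hsub : W.Sublist (List.ofFn (ty x')) := by
    have s1 : W.Sublist ((List.replicate (2 * N) U ++ y :: List.replicate (2 * N) V) ++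
        (List.replicate (2 * N) U' ++ y' :: List.replicate (2 * N) V')) := by
      refine List.Sublist.append (List.Sublist.append ?_ (List.Sublist.cons_cons _ ?_))
        (List.Sublist.append ?_ (List.Sublist.cons_cons _ ?_)) <;>
        exact (List.replicate_sublist_replicate _).2 (by omega)
    refine s1.trans ((hL.append hR).trans ?_)
    rw [hl]
    have e : (List.replicate (2 * N) g₀ ++ a :: (List.replicate (2 * N) g₁ ++ b ::
        List.replicate (2 * N) g₂)) ++ (List.replicate (2 * N) g₂ ++ c ::
        (List.replicate (2 * N) g₃ ++ d :: List.replicate (2 * N) g₄)) =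
        List.replicate (2 * N) g₀ ++ a :: (List.replicate (2 * N) g₁ ++ b ::
        (List.replicate (4 * N) g₂ ++ c ::
        (List.replicate (2 * N) g₃ ++ d :: List.replicate (2 * N) g₄))) := by
      have : List.replicate (4 * N) g₂ = List.replicate (2 * N) g₂ ++ List.replicate (2 * N) g₂ := by
        rw [List.replicate_append_replicate]; congr 1; omega
      rw [this]
      simp only [List.append_assoc, List.cons_append]
    rw [e]
    exact (h2 hg₀).append (((h2 hg₁).append ((hg₂.append
      (((h2 hg₃).append ((h2 hg₄).cons_cons _)).cons_cons _)).cons_cons _)).cons_cons _)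
  obtain ⟨z, hz⟩ := h.exists_of_sublist (by omega) hsub (Fin.castLEOrderEmb (by omega))
  have hz' : ∀ (i : ℕ) (hi : i < 4 * N), ty z ⟨i, by omega⟩ = W[i] := by
    intro i hi
    exact hz ⟨i, by omega⟩
  have hL' : ∀ (i : ℕ) (hi : i < 2 * N), ty z ⟨i, by omega⟩ =
      if i < 2 * s + 1 then U else if i = 2 * s + 1 then y else V := by
    intro i hi
    rw [hz' i (by omega)]
    simp only [hWdef]
    rw [List.getElem_append_left (by simp; omega), List.getElem_change]
  have hR' : ∀ (i : ℕ) (hi : i < 2 * N), ty z ⟨2 * N + i, by omega⟩ =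
      if i < 2 * t + 1 then U' else if i = 2 * t + 1 then y' else V' := by
    intro i hi
    rw [hz' (2 * N + i) (by omega)]
    simp only [hWdef]
    have hlen : (List.replicate (2 * s + 1) U ++ y :: List.replicate (2 * N - 2 * s - 2) V).length
        = 2 * N := by simp; omega
    rw [List.getElem_append_right (by omega), List.getElem_change]
    simp only [hlen, Nat.add_sub_cancel_left]
  refine ⟨z, fun i hi => ?_, fun i hi => ?_⟩
  · rw [hL' (2 * i) (by omega), hL' (2 * i + 1) (by omega)]
    split_ifs <;> first | omega | simp
  · have := hR' (2 * i + 1) (by omega)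
    simp only [← Nat.add_assoc] at this
    rw [hR' (2 * i) (by omega), this]
    split_ifs <;> first | omega | simp

/-- A sequence without two separate changes is constant before and after some position. -/
theorem exists_exceptional (hM : 0 < M) (w : Fin M → Λ)
    (h : ∀ p₁ p₂ p₃ p₄, p₁ < p₂ → p₂ < p₃ → p₃ < p₄ → w p₁ = w p₂ ∨ w p₃ = w p₄) :
    ∃ ex : Fin M, (∀ i < ex, w i = w ⟨0, hM⟩) ∧ ∀ i > ex, w i = w ⟨M - 1, by omega⟩ := by
  classical
  by_cases hc : ∃ e, w e ≠ w ⟨0, hM⟩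
  -- The first index whose value differs from the initial one is exceptional: a later deviation from
  -- the last value would be a second change, separate from the one between `0` and `e`.
  · obtain ⟨e, he, hmin⟩ := WellFounded.has_min (wellFounded_lt (α := Fin M))
      {e | w e ≠ w ⟨0, hM⟩} hc
    refine ⟨e, fun i hi => by_contra fun hne => hmin i hne hi, fun i hi => ?_⟩
    by_contra hne
    have h0 : (⟨0, hM⟩ : Fin M) < e := by
      rw [Fin.lt_def]
      by_contra hcon
      exact he (congrArg w (Fin.ext (by simp at hcon ⊢; omega)))
    have h1 : i < ⟨M - 1, by omega⟩ := by
      rw [Fin.lt_def]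
      by_contra hcon
      exact hne (congrArg w (Fin.ext (by simp at hcon ⊢; omega)))
    rcases h _ _ _ _ h0 hi h1 with h' | h'
    · exact he h'.symm
    · exact hne h'
  · push Not at hc
    exact ⟨⟨0, hM⟩, fun i _ => hc i, fun i _ => by rw [hc i, hc ⟨M - 1, _⟩]⟩

end Words

/-! ### Bounds for monadically dependent and monadically stable classes -/

section Bounds

variable {L : FirstOrder.Language.{u, v}} {r : ℕ}

/-- Prescribing a type is a boolean combination of the formulas `eq(c_i, x, ȳ)`. It is built along a
list because `BoolComb` only closes under implication and falsity. -/
theorem exists_typeFormula {M : Type w} [L.Structure M] (φ : L.Formula (Fin 2))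
    (α : L.Formula (Fin r ⊕ Unit)) {k : ℕ} (σ : Fin k → M) {ι : Type} (h : ι → Fin k)
    (τ : Set ι) (l : List ι) :
    letI := constantStructure (L := L) σ
    ∃ ψ, BoolComb (eqConstFormulas φ α k) ψ ∧ ∀ v : Unit ⊕ Fin r → M,
      ψ.Realize v ↔ ∀ i ∈ l,
        (EqOver φ α (σ (h i)) (v (Sum.inl ())) (fun c => v (Sum.inr c)) ↔ i ∈ τ) := by
  let _ := constantStructure (L := L) σ
  have hnot : ∀ ψ, BoolComb (eqConstFormulas φ α k) ψ → BoolComb (eqConstFormulas φ α k) (∼ψ) :=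
    fun ψ hψ => BoolComb.imp hψ BoolComb.bot
  induction l with
  | nil => exact ⟨∼⊥, hnot _ BoolComb.bot, by simp⟩
  | cons i l ih =>
    obtain ⟨ψ, hψ, hr⟩ := ih
    have hi : BoolComb (eqConstFormulas φ α k) (eqConstFormula φ α (h i)) :=
      BoolComb.base ⟨h i, rfl⟩
    by_cases hτ : i ∈ τ
    · refine ⟨eqConstFormula φ α (h i) ⊓ ψ, hnot _ (BoolComb.imp hi (hnot _ hψ)), fun v => ?_⟩
      rw [Formula.realize_inf, hr, realize_eqConstFormula]
      simp [hτ]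
    · refine ⟨∼(eqConstFormula φ α (h i)) ⊓ ψ, hnot _ (BoolComb.imp (hnot _ hi) (hnot _ hψ)),
        fun v => ?_⟩
      rw [Formula.realize_inf, hr, Formula.realize_not, realize_eqConstFormula]
      simp [hτ]

theorem realize_patternFormula {M : Type w} [L.Structure M] {i : ℕ}
    (φ : Fin i → L.Formula (Unit ⊕ Fin r)) (v : Fin i × Fin r → M) :
    (patternFormula φ).Realize v ↔
      ∃ x, ∀ j, (φ j).Realize (Sum.elim (fun _ => x) fun c => v (j, c)) := by
  have h : ∀ (x : Unit → M) (j : Fin i),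
      (Sum.elim v x ∘ Sum.elim Sum.inr fun c => Sum.inl (j, c)) =
        Sum.elim (fun _ : Unit => x ()) fun c : Fin r => v (j, c) := by
    intro x j; funext c; rcases c with c | c <;> rfl
  simp only [patternFormula, Formula.realize_iExs, Formula.realize_iInf, Formula.realize_relabel, h]
  exact ⟨fun ⟨i, h⟩ => ⟨i (), h⟩, fun ⟨w, h⟩ => ⟨fun _ => w, h⟩⟩

/-- The set of those `i` for which `x` is equivalent to `g i` over the `j`-th tuple. -/
def eqType {M : Type w} [L.Structure M] (φ : L.Formula (Fin 2)) (α : L.Formula (Fin r ⊕ Unit))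
    {ι : Type} (g : ι → M) {n : ℕ} (I : Fin n → Fin r → M) (x : M) (j : Fin n) : Set ι :=
  {i | EqOver φ α (g i) x (I j)}

/-- `I` is `Δ_k`-indiscernible, where the constants are interpreted by `σ`. -/
def IsEqIndiscernible {M : Type w} [L.Structure M] (φ : L.Formula (Fin 2))
    (α : L.Formula (Fin r ⊕ Unit)) {k : ℕ} (σ : Fin k → M) {n : ℕ} (I : Fin n → Fin r → M) : Prop :=
  letI := constantStructure (L := L) σ
  IsIndiscernible (patternFormulas k (eqConstFormulas φ α k)) I

/-- The existence of an element with a given word of types is exactly a pattern formula whose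
conjuncts prescribe the letters. -/
theorem IsEqIndiscernible.wordIndiscernible {M : Type w} [L.Structure M] {φ : L.Formula (Fin 2)}
    {α : L.Formula (Fin r ⊕ Unit)} {k : ℕ} {σ : Fin k → M} {n : ℕ} {I : Fin n → Fin r → M}
    (hI : IsEqIndiscernible φ α σ I)
    {ι : Type} [Finite ι] (h : ι → Fin k) :
    WordIndiscernible k (eqType φ α (σ ∘ h) I) := by
  let _ := constantStructure (L := L) σ
  let _ := Fintype.ofFinite ι
  intro D hD τ p q
  choose ψ hψ hr using fun d => exists_typeFormula φ α σ h (τ d) Finset.univ.toList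
  have hi := hI ⟨D, patternFormula ψ⟩ ⟨D, ψ, hD, hψ, rfl⟩ p q
  simp only [realize_patternFormula, hr] at hi
  have e : ∀ (s : Fin D ↪o Fin n) (x : M), (∀ d, eqType φ α (σ ∘ h) I x (s d) = τ d) ↔
      ∀ d, ∀ i ∈ (Finset.univ : Finset ι).toList,
        (EqOver φ α (σ (h i)) x (fun c => I (s d) c) ↔ i ∈ τ d) := by
    intro s x
    refine forall_congr' fun d => ?_
    rw [Set.ext_iff]
    simp [eqType]
  simp only [e]
  exact hi.1

/-- Finitely many elements that are distinguished by their `φ`-neighborhoods within `B` contain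
pairs each of which is split by its own element of `B` only. -/
theorem exists_split_pairs {M : Type w} [L.Structure M] (φ : L.Formula (Fin 2)) {q : ℕ}
    (c : Fin (2 ^ q) → M) (B : Set M)
    (h : ∀ i i', i ≠ i' → ∃ w ∈ B, ¬ (w ∈ nbhd φ (c i) ↔ w ∈ nbhd φ (c i'))) :
    ∃ (pr : Fin q → Fin (2 ^ q) × Fin (2 ^ q)) (w : Fin q → M), (∀ t, w t ∈ B) ∧
      ∀ t t', ¬ (w t ∈ nbhd φ (c (pr t').1) ↔ w t ∈ nbhd φ (c (pr t').2)) ↔ t = t' := by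
  classical
  let P : Finset M → Prop := fun W => (∀ w ∈ W, w ∈ B) ∧
    ∀ i i', i ≠ i' → ∃ w ∈ W, ¬ (w ∈ nbhd φ (c i) ↔ w ∈ nbhd φ (c i'))
  have hex : ∃ W, P W := by
    have : Nonempty M := ⟨c ⟨0, Nat.two_pow_pos q⟩⟩
    choose! f hf hf' using h
    refine ⟨(Finset.univ.filter fun p : _ × _ => p.1 ≠ p.2).image fun p => f p.1 p.2, ?_, ?_⟩
    · intro w hw
      simp only [Finset.mem_image, Finset.mem_filter, Finset.mem_univ, true_and] at hw
      obtain ⟨p, hp, rfl⟩ := hw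
      exact hf _ _ hp
    · intro i i' hii
      exact ⟨f i i', Finset.mem_image.2 ⟨(i, i'), by simpa using hii, rfl⟩, hf' _ _ hii⟩
  -- By minimality of `W`, deleting `w` leaves some pair undistinguished; that pair is split by `w`
  -- and by no other element of `W`.
  obtain ⟨W, hW, hmin⟩ := WellFounded.has_min (wellFounded_lt (α := Finset M)) {W | P W} hex
  have hpair : ∀ w ∈ W, ∃ p : Fin (2 ^ q) × Fin (2 ^ q),
      ∀ w' ∈ W, ¬ (w' ∈ nbhd φ (c p.1) ↔ w' ∈ nbhd φ (c p.2)) ↔ w' = w := by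
    intro w hw
    have hn : ¬ P (W.erase w) := fun hP => hmin _ hP (Finset.erase_ssubset hw)
    have : ∃ i i', i ≠ i' ∧ ∀ w' ∈ W.erase w, (w' ∈ nbhd φ (c i) ↔ w' ∈ nbhd φ (c i')) := by
      by_contra! hcon
      refine hn ⟨fun w' hw' => hW.1 w' (Finset.mem_of_mem_erase hw'), fun i i' hii => ?_⟩
      obtain ⟨w', hw', hne⟩ := hcon i i' hii
      exact ⟨w', hw', by tauto⟩
    obtain ⟨i, i', hii, hsame⟩ := this
    refine ⟨(i, i'), fun w' hw' => ⟨fun hne => ?_, ?_⟩⟩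
    · by_contra hww
      exact hne (hsame w' (Finset.mem_erase.2 ⟨hww, hw'⟩))
    · rintro rfl
      obtain ⟨w'', hw'', hne⟩ := hW.2 i i' hii
      by_cases hww : w'' = w'
      · exact hww ▸ hne
      · exact absurd (hsame w'' (Finset.mem_erase.2 ⟨hww, hw''⟩)) hne
  -- The `2 ^ q` elements have distinct traces on `W`, so `W` has at least `2 ^ q` subsets.
  have hcard : q ≤ W.card := by
    have hinj : Function.Injective
        fun i : Fin (2 ^ q) => W.filter fun w => w ∈ nbhd φ (c i) := by
      intro i i' hii
      by_contra hne
      obtain ⟨w, hw, hd⟩ := hW.2 i i' hne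
      have := Finset.ext_iff.1 hii w
      simp only [Finset.mem_filter, hw, true_and] at this
      exact hd this
    have h1 := Finset.card_le_card_of_injOn (s := Finset.univ) (t := W.powerset) _
      (fun i _ => Finset.mem_coe.2 (Finset.mem_powerset.2 (Finset.filter_subset _ _))) (hinj.injOn)
    simp only [Finset.card_univ, Fintype.card_fin, Finset.card_powerset] at h1
    exact (Nat.pow_le_pow_iff_right (by norm_num)).1 h1
  obtain ⟨e⟩ : Nonempty (Fin q ↪ W) := Function.Embedding.nonempty_of_card_le (by simpa using hcard)
  choose pr hpr using fun t => hpair (e t) (e t).2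
  refine ⟨pr, fun t => e t, fun t => hW.1 _ (e t).2, fun t t' => ?_⟩
  rw [hpr t' (e t) (e t).2]
  simp

/-- Each neighborhood provides `q` pairs with private splitting points. Once sufficiently many
neighborhoods provide the same pairs, colouring a chosen part of the splitting points in each of
them shatters the `q` pairs. Disjointness keeps the colours of different neighborhoods apart. -/
theorem exists_bound_distinguished {C : Set (Bundled.{w} L.Structure)} (hC : IsMonadicallyNIP C)
    (φ : L.Formula (Fin 2)) (α : L.Formula (Fin r ⊕ Unit)) :
    ∃ l n : ℕ, 1 ≤ l ∧ ∀ A ∈ C, ∀ (c : Fin l → A) (I : Fin n → Fin r → A), HasDisjointNbhds α I →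
      ¬ ∀ j i i', i ≠ i' →
        ∃ w ∈ tupleNbhd α (I j), ¬ (w ∈ nbhd φ (c i) ↔ w ∈ nbhd φ (c i')) := by
  classical
  obtain ⟨q, hq⟩ := exists_bound_of_NIP hC (splitFormula φ α)
  refine ⟨2 ^ q, Fintype.card (Fin q → Fin (2 ^ q) × Fin (2 ^ q)) * Fintype.card (Set (Fin q)),
    Nat.one_le_two_pow, fun A hA c I hdis hd => ?_⟩
  choose pr w hwB hw using fun j => exists_split_pairs φ c (tupleNbhd α (I j)) (hd j)
  have hne : Nonempty (Fin q → Fin (2 ^ q) × Fin (2 ^ q)) :=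
    ⟨fun _ => (⟨0, Nat.two_pow_pos q⟩, ⟨0, Nat.two_pow_pos q⟩)⟩
  -- Pigeonhole over all choices of pairs leaves `2 ^ q` tuples with a common choice, one for every
  -- subset of `Fin q`.
  obtain ⟨p, hp⟩ := Fintype.exists_le_card_fiber_of_mul_le_card (f := pr)
    (n := Fintype.card (Set (Fin q))) (by simp)
  obtain ⟨e⟩ : Nonempty (Set (Fin q) ↪ {j // j ∈ Finset.univ.filter fun j => pr j = p}) :=
    Function.Embedding.nonempty_of_card_le (by rwa [Fintype.card_coe])
  have he : ∀ E, pr (e E) = p := fun E => (Finset.mem_filter.1 (e E).2).2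
  refine hq A hA {a | ∃ E, ∃ t ∈ E, a = w (e E) t} (fun t => ![c (p t).1, c (p t).2])
    (fun E => I (e E)) fun t E => ?_
  rw [realize_splitFormula]
  simp only [Sum.elim_inr, Sum.elim_inl, Matrix.cons_val_zero, Matrix.cons_val_one]
  have hw' : ∀ E t t', ¬ (w (e E) t ∈ nbhd φ (c (p t').1) ↔ w (e E) t ∈ nbhd φ (c (p t').2)) ↔
      t = t' := by
    intro E t t'
    have := hw (e E) t t'
    rwa [he E] at this
  constructor
  · rintro ⟨_, ⟨E', t', ht', rfl⟩, hmem, hs⟩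
    rw [hw'] at hs
    subst hs
    have : (e E').1 = (e E).1 := by
      by_contra hne
      exact Set.disjoint_left.1 (hdis hne) (hwB _ t') hmem
    rw [← e.injective (Subtype.ext this)]
    exact ht'
  · intro ht
    exact ⟨w (e E) t, ⟨E, t, ht, rfl⟩, hwB (e E) t, (hw' E t t).2 rfl⟩

/-- An element `x i j` is determined among all of them by the two pairs at which it changes. These
elements form a definable grid, and a colour on the grid encodes any relation between rows and
columns. -/
theorem exists_bound_doubleChange {C : Set (Bundled.{w} L.Structure)} (hC : IsMonadicallyNIP C)
    (φ : L.Formula (Fin 2)) (α : L.Formula (Fin r ⊕ Unit)) :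
    ∃ N : ℕ, 1 ≤ N ∧ ∀ A ∈ C, ∀ (Y Y' : Fin N → Fin 2 → Fin r → A) (s s' : A),
      ¬ ∀ i j, ∃ x,
        (∀ z, ¬ (EqOver φ α s x (Y z 0) ↔ EqOver φ α s x (Y z 1)) ↔ z = i) ∧
        (∀ z, ¬ (EqOver φ α s' x (Y' z 0) ↔ EqOver φ α s' x (Y' z 1)) ↔ z = j) := by
  classical
  obtain ⟨q, hq⟩ := exists_bound_of_NIP hC (doubleChangeFormula φ α)
  refine ⟨2 ^ q, Nat.one_le_two_pow, fun A hA Y Y' s s' h => ?_⟩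
  choose x hx hx' using h
  -- Only `q` rows are used, against `2 ^ q` columns indexed by the subsets of the rows.
  let i : Fin q → Fin (2 ^ q) := Fin.castLE Nat.lt_two_pow_self.le
  have hi : Function.Injective i := Fin.castLE_injective _
  let e : Set (Fin q) ≃ Fin (2 ^ q) := Fintype.equivFinOfCardEq (by simp)
  refine hq A hA {a | ∃ E, ∃ t ∈ E, a = x (i t) (e E)} (fun t c => Y (i t) c.1 c.2)
    (fun E => Sum.elim (fun c => Y' (e E) c.1 c.2) ![s, s']) fun t E => ?_
  rw [realize_doubleChangeFormula]
  simp only [Matrix.cons_val_zero, Matrix.cons_val_one]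
  constructor
  · rintro ⟨_, ⟨E', t', ht', rfl⟩, h1, h2⟩
    rw [hx] at h1
    rw [hx'] at h2
    rw [hi h1, e.injective h2]
    exact ht'
  · intro ht
    exact ⟨_, ⟨E, t, ht, rfl⟩, (hx _ _ _).2 rfl, (hx' _ _ _).2 rfl⟩

/-- Two separate changes of type would yield a full grid of double changes. A change between two
types is a change of membership for one fixed sample, which gives the parameters `g i` and `g i'`.
-/
theorem exists_bound_exceptional {C : Set (Bundled.{w} L.Structure)} (hC : IsMonadicallyNIP C)
    (φ : L.Formula (Fin 2)) (α : L.Formula (Fin r ⊕ Unit)) (l : ℕ) :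
    ∃ B : ℕ, 1 ≤ B ∧ ∀ k ≥ B, ∀ n ≥ B, ∀ A ∈ C, ∀ (g : Fin l → A) (I : Fin n → Fin r → A),
      WordIndiscernible k (eqType φ α g I) → ∀ x, ∃ ex : Fin n, ∃ P R : Set (Fin l),
        (∀ i < ex, eqType φ α g I x i = P) ∧ ∀ i > ex, eqType φ α g I x i = R := by
  classical
  obtain ⟨N, hN, h⟩ := exists_bound_doubleChange hC φ α
  refine ⟨5 * (4 * N * Fintype.card (Set (Fin l))) + 9 + 4 * N, by omega,
    fun k hk n hn A hA g I hI x => ?_⟩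
  by_cases hx : ∀ p₁ p₂ p₃ p₄, p₁ < p₂ → p₂ < p₃ → p₃ < p₄ →
      eqType φ α g I x p₁ = eqType φ α g I x p₂ ∨ eqType φ α g I x p₃ = eqType φ α g I x p₄
  · obtain ⟨ex, h1, h2⟩ := exists_exceptional (by omega) _ hx
    exact ⟨ex, _, _, h1, h2⟩
  · exfalso
    push Not at hx
    obtain ⟨p₁, p₂, p₃, p₄, h₁₂, h₂₃, h₃₄, hab, hcd⟩ := hx
    obtain ⟨U, y, U', y', hU, hU', hst⟩ := hI.exists_double_change (N := N) (by omega) hN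
      (by omega) (by omega) h₁₂ h₂₃ h₃₄ hab hcd
    obtain ⟨i, hi⟩ : ∃ i, ¬ (i ∈ U ↔ i ∈ y) := by
      by_contra! hcon; exact hU (Set.ext hcon)
    obtain ⟨i', hi'⟩ : ∃ i, ¬ (i ∈ U' ↔ i ∈ y') := by
      by_contra! hcon; exact hU' (Set.ext hcon)
    refine h A hA (fun z b => I ⟨2 * z + b, by omega⟩)
      (fun z b => I ⟨2 * N + 2 * z + b, by omega⟩) (g i) (g i') fun s t => ?_
    obtain ⟨x, hx, hx'⟩ := hst s s.2 t t.2
    refine ⟨x, fun z => ?_, fun z => ?_⟩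
    · have h1 := hx z z.2
      change ¬ (i ∈ eqType φ α g I x ⟨2 * z, _⟩ ↔ i ∈ eqType φ α g I x ⟨2 * z + 1, _⟩) ↔ _
      rw [Fin.ext_iff]
      split_ifs at h1 with hz
      · rw [h1.1, h1.2]; simp [hz, hi]
      · rw [h1]; simp [hz]
    · have h1 := hx' z z.2
      change ¬ (i' ∈ eqType φ α g I x ⟨2 * N + 2 * z, _⟩ ↔
        i' ∈ eqType φ α g I x ⟨2 * N + 2 * z + 1, _⟩) ↔ _
      rw [Fin.ext_iff]
      split_ifs at h1 with hz
      · rw [h1.1, h1.2]; simp [hz, hi']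
      · rw [h1]; simp [hz]

/-- If `P ≠ R`, the pattern `P, P, R, R` can be placed at any four consecutive positions, and the
exceptional index then pins down the whole word outside that window. The elements with jumps at
varying places define an order on the tuples. -/
theorem exists_bound_single {C : Set (Bundled.{w} L.Structure)} (hC : IsMonadicallyStable C)
    (φ : L.Formula (Fin 2)) (α : L.Formula (Fin r ⊕ Unit)) (l : ℕ) :
    ∃ B : ℕ, ∀ k ≥ B, ∀ n ≥ B, ∀ A ∈ C, ∀ (g : Fin l → A) (I : Fin n → Fin r → A),
      WordIndiscernible k (eqType φ α g I) →
      (∀ x, ∃ ex : Fin n, ∃ P R : Set (Fin l),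
        (∀ i < ex, eqType φ α g I x i = P) ∧ ∀ i > ex, eqType φ α g I x i = R) →
      ∀ x p₁ p₂ p₃ p₄, p₁ < p₂ → p₂ < p₃ → p₃ < p₄ →
        eqType φ α g I x p₁ = eqType φ α g I x p₂ → eqType φ α g I x p₃ = eqType φ α g I x p₄ →
        eqType φ α g I x p₁ = eqType φ α g I x p₃ := by
  choose N hN using fun pos => exists_bound_of_stable hC (signedEqFormula φ α pos)
  refine ⟨3 * (N true + N false) + 4, fun k hk n hn A hA g I hI hex x p₁ p₂ p₃ p₄ h₁₂ h₂₃ h₃₄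
    hab hcd => ?_⟩
  by_contra hPR
  set P := eqType φ α g I x p₁ with hP
  set R := eqType φ α g I x p₃ with hR
  have hw : ∀ s, s + 3 < n → ∃ y, (∀ j : Fin n, j.1 ≤ s → eqType φ α g I y j = P) ∧
      ∀ j : Fin n, s + 3 ≤ j.1 → eqType φ α g I y j = R := by
    intro s hs
    have hm1 : StrictMono ![p₁, p₂, p₃, p₄] := by
      rw [Fin.strictMono_iff_lt_succ]
      intro i; fin_cases i <;> simpa
    have hm2 : StrictMono ![(⟨s, by omega⟩ : Fin n), ⟨s + 1, by omega⟩,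
        ⟨s + 2, by omega⟩, ⟨s + 3, by omega⟩] := by
      rw [Fin.strictMono_iff_lt_succ]
      intro i; fin_cases i <;> simp [Fin.lt_def]
    obtain ⟨y, hy⟩ := hI 4 (by omega) ![P, P, R, R]
      (OrderEmbedding.ofStrictMono _ hm1) (OrderEmbedding.ofStrictMono _ hm2)
      ⟨x, fun d => by fin_cases d <;> first | rfl | exact hab.symm | exact hcd.symm⟩
    have y0 : eqType φ α g I y ⟨s, by omega⟩ = P := hy 0
    have y1 : eqType φ α g I y ⟨s + 1, by omega⟩ = P := hy 1
    have y2 : eqType φ α g I y ⟨s + 2, by omega⟩ = R := hy 2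
    have y3 : eqType φ α g I y ⟨s + 3, by omega⟩ = R := hy 3
    obtain ⟨ex, P', R', h1, h2⟩ := hex y
    -- If `ex ≤ s`, the positions `s + 1` and `s + 2` would both lie after the exceptional index and
    -- carry equal types, although these are `P` and `R`.
    have hex1 : s < ex := by
      by_contra hcon
      have := h2 ⟨s + 1, by omega⟩ (by rw [gt_iff_lt, Fin.lt_def]; simp; omega)
      have h3 := h2 ⟨s + 2, by omega⟩ (by rw [gt_iff_lt, Fin.lt_def]; simp; omega)
      exact hPR (by rw [← y1, this, ← h3, y2])
    have hex2 : ex < s + 3 := by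
      by_contra hcon
      have := h1 ⟨s + 1, by omega⟩ (by rw [Fin.lt_def]; simp; omega)
      have h3 := h1 ⟨s + 2, by omega⟩ (by rw [Fin.lt_def]; simp; omega)
      exact hPR (by rw [← y1, this, ← h3, y2])
    refine ⟨y, fun j hj => ?_, fun j hj => ?_⟩
    · rw [h1 j (by rw [Fin.lt_def]; omega), ← y0, h1 ⟨s, _⟩ (by rw [Fin.lt_def]; exact hex1)]
    · rw [h2 j (by rw [gt_iff_lt, Fin.lt_def]; omega), ← y3,
        h2 ⟨s + 3, _⟩ (by rw [gt_iff_lt, Fin.lt_def]; exact hex2)]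
  have : Nonempty A := ⟨x⟩
  choose! y hy1 hy2 using hw
  obtain ⟨i, hi⟩ : ∃ i, ¬ (i ∈ P ↔ i ∈ R) := by
    by_contra! hcon; exact hPR (Set.ext hcon)
  -- The sign is chosen so that the signed formula holds at type `P` and fails at type `R`.
  obtain ⟨pos, hpos⟩ : ∃ pos : Bool, (i ∈ P ↔ pos = true) ∧ (i ∉ R ↔ pos = true) := by
    by_cases hiP : i ∈ P
    · exact ⟨true, by tauto⟩
    · exact ⟨false, by simp [hiP]; tauto⟩
  have hle : N pos ≤ N true + N false := by cases pos <;> omega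
  -- Only every third position is used, because the types strictly between `s` and `s + 3` are not
  -- needed to define the order.
  refine hN pos A hA (fun s => I ⟨3 * s, by omega⟩) (fun t => ![g i, y (3 * t)]) fun s t => ?_
  rw [realize_signedEqFormula]
  simp only [Matrix.cons_val_zero, Matrix.cons_val_one]
  change (i ∈ eqType φ α g I (y (3 * t)) ⟨3 * s, _⟩ ↔ _) ↔ _
  rcases Nat.lt_or_ge t s with hlt | hge
  · rw [hy2 (3 * t) (by omega) ⟨3 * s, by omega⟩ (by simp; omega)]
    have : ¬ s ≤ t := by rw [Fin.le_def]; omega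
    simp only [this, iff_false]
    tauto
  · rw [hy1 (3 * t) (by omega) ⟨3 * s, by omega⟩ (by simp; omega)]
    have : s ≤ t := by rw [Fin.le_def]; omega
    simp only [this, iff_true]
    exact hpos.1

end Bounds

/-! ### Collecting sample elements -/

section Samples

variable {L : FirstOrder.Language.{u, v}} {r : ℕ} {M : Type w} [L.Structure M]

/-- The `j`-th tuple of `I` may be kept if `x` becomes a new sample element, in addition to the
first `l` elements of `σ`. -/
def Keeps (φ : L.Formula (Fin 2)) (α : L.Formula (Fin r ⊕ Unit)) {k : ℕ} (σ : Fin k → M) (l : ℕ)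
    {n : ℕ} (I : Fin n → Fin r → M) (x : M) (j : Fin n) : Prop :=
  x ∉ tupleNbhd α (I j) ∧
    ∀ i : Fin k, i.1 < l → ∃ w ∈ tupleNbhd α (I j), ¬ (w ∈ nbhd φ x ↔ w ∈ nbhd φ (σ i))

/-- One round of the construction: either a new sample element is found, and three tuples are
dropped, or there is none, and the first and the last two tuples are dropped. -/
def IsStep (φ : L.Formula (Fin 2)) (α : L.Formula (Fin r ⊕ Unit)) {k : ℕ} (σ : Fin k → M) (l : ℕ)
    {n n' : ℕ} (I : Fin n → Fin r → M) (σ' : Fin k → M) (l' : ℕ) (e : Fin n' ↪o Fin n) : Prop :=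
  (∃ x, (∀ i, Keeps φ α σ l I x (e i)) ∧ l' = l + 1 ∧ ∀ i, σ' i = if i.1 < l then σ i else x) ∨
    (1 ≤ l ∧ σ' = σ ∧ l' = l ∧ (∀ i, (e i : ℕ) = i + 1) ∧
      ∀ x, ¬ ∃ e' : Fin n' ↪o Fin n, ∀ i, Keeps φ α σ l I x (e' i))

/-- The sample elements are pairwise inequivalent over all tuples. -/
def IsFresh (φ : L.Formula (Fin 2)) (α : L.Formula (Fin r ⊕ Unit)) {k : ℕ} (σ : Fin k → M) (l : ℕ)
    {n : ℕ} (I : Fin n → Fin r → M) : Prop :=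
  (1 ≤ l → ∀ i j, σ i ∉ tupleNbhd α (I j)) ∧
    ∀ i i' : Fin k, i < i' → i'.1 < l → ∀ j,
      ∃ w ∈ tupleNbhd α (I j), ¬ (w ∈ nbhd φ (σ i) ↔ w ∈ nbhd φ (σ i'))

theorem exists_step (φ : L.Formula (Fin 2)) (α : L.Formula (Fin r ⊕ Unit)) {k : ℕ} (σ : Fin k → M)
    {l n n' : ℕ} (hn : n = n' + 3) (I : Fin n → Fin r → M) [Nonempty M]
    (hdis : HasDisjointNbhds α I) :
    ∃ (σ' : Fin k → M) (l' : ℕ) (e : Fin n' ↪o Fin n), IsStep φ α σ l I σ' l' e := by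
  classical
  subst hn
  by_cases h : ∃ x, ∃ e : Fin n' ↪o Fin (n' + 3), ∀ i, Keeps φ α σ l I x (e i)
  · obtain ⟨x, e, he⟩ := h
    exact ⟨fun i => if i.1 < l then σ i else x, l + 1, e, Or.inl ⟨x, he, rfl, fun i => rfl⟩⟩
  -- Without samples every element qualifies, since it lies in at most one of the disjoint
  -- neighborhoods.
  · have hl : 1 ≤ l := by
      by_contra hl
      obtain rfl : l = 0 := by omega
      obtain ⟨x⟩ := ‹Nonempty M›
      have hsub : (Finset.univ.filter fun j => x ∈ tupleNbhd α (I j)).card ≤ 1 := by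
        rw [Finset.card_le_one]
        intro a ha b hb
        by_contra hab
        exact Set.disjoint_left.1 (hdis hab) (Finset.mem_filter.1 ha).2 (Finset.mem_filter.1 hb).2
      have hcard := Finset.card_filter_add_card_filter_not (s := Finset.univ)
        (fun j : Fin (n' + 3) => x ∈ tupleNbhd α (I j))
      rw [Finset.card_univ, Fintype.card_fin] at hcard
      refine h ⟨x, Finset.orderEmbOfCardLe
        (s := Finset.univ.filter fun j => x ∉ tupleNbhd α (I j)) (by omega), fun i => ?_⟩
      have := Finset.orderEmbOfCardLe_mem
        (Finset.univ.filter fun j => x ∉ tupleNbhd α (I j)) (k := n') (by omega) i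
      exact ⟨(Finset.mem_filter.1 this).2, fun i hi => absurd hi (Nat.not_lt_zero _)⟩
    have hm : StrictMono fun i : Fin n' => (⟨i + 1, by omega⟩ : Fin (n' + 3)) :=
      fun a b hab => by
      rw [Fin.lt_def] at hab ⊢
      exact Nat.succ_lt_succ hab
    exact ⟨σ, l, OrderEmbedding.ofStrictMono _ hm,
      Or.inr ⟨hl, rfl, rfl, fun i => rfl, fun x hx => h ⟨x, hx⟩⟩⟩

/-- The exceptional index may itself be dropped. The first surviving index at or after it takes over
its role, or the last index if there is none. -/
theorem exists_clamp {n n' : ℕ} (hn : 0 < n') (e : Fin n' ↪o Fin n) (ex : Fin n) :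
    ∃ ex' : Fin n', (∀ i < ex', e i < ex) ∧ ∀ i > ex', ex < e i := by
  by_cases h : ∃ i, ex ≤ e i
  · obtain ⟨i, hi, hmin⟩ := WellFounded.has_min (wellFounded_lt (α := Fin n')) {i | ex ≤ e i} h
    exact ⟨i, fun j hj => not_le.1 fun hle => hmin j hle hj,
      fun j hj => lt_of_le_of_lt hi (e.lt_iff_lt.2 hj)⟩
  · push Not at h
    refine ⟨⟨n' - 1, by omega⟩, fun i _ => h i, fun i hi => absurd hi ?_⟩
    rw [gt_iff_lt, Fin.lt_def]
    simp; omega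

theorem IsSampledBy.comp {φ : L.Formula (Fin 2)} {α : L.Formula (Fin r ⊕ Unit)} {single : Prop}
    {n n' : ℕ} {I : Fin n → Fin r → M} {S S' : Set M} (h : IsSampledBy φ α single I S)
    (hS : S ⊆ S') (hn : 0 < n') (e : Fin n' ↪o Fin n) : IsSampledBy φ α single (I ∘ e) S' := by
  intro a
  obtain ⟨ex, s, hs, s', hs', h1, h2, h3, h4⟩ := h a
  obtain ⟨ex', hl, hr⟩ := exists_clamp hn e ex
  refine ⟨ex', s, hS hs, s', hS hs', fun i hi => h1 _ (hl i hi), fun i hi => h2 _ (hr i hi),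
    fun i hi => ?_, h4⟩
  have := h3 _ hi
  rcases lt_trichotomy i ex' with hlt | heq | hgt
  · exact absurd this (hl i hlt).ne
  · exact heq
  · exact absurd this (hr i hgt).ne'

theorem HasDisjointNbhds.comp {α : L.Formula (Fin r ⊕ Unit)} {n n' : ℕ} {I : Fin n → Fin r → M}
    (h : HasDisjointNbhds α I) (e : Fin n' ↪o Fin n) : HasDisjointNbhds α (I ∘ e) :=
  fun _ _ hij => h fun heq => hij (e.injective heq)

/-- If no element can become a new sample element, then the sequence without its ends is sampled. -/
theorem isSampledBy_of_not_keeps {φ : L.Formula (Fin 2)} {α : L.Formula (Fin r ⊕ Unit)}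
    {single : Prop} {k l l₀ n n' : ℕ} (hn' : 0 < n') (hn : n = n' + 3) {σ : Fin k → M}
    {I : Fin n → Fin r → M} (hl : 1 ≤ l) (hl₀ : l ≤ l₀) (hk : l₀ ≤ k) (hk' : 4 ≤ k)
    (hdis : HasDisjointNbhds α I) (hfresh : IsFresh φ α σ l I)
    (hI : WordIndiscernible k (eqType φ α (σ ∘ Fin.castLE hk) I))
    (hex : ∀ x, ∃ ex : Fin n, ∃ P R : Set (Fin l₀),
      (∀ i < ex, eqType φ α (σ ∘ Fin.castLE hk) I x i = P) ∧
        ∀ i > ex, eqType φ α (σ ∘ Fin.castLE hk) I x i = R)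
    (hsingle : single → ∀ x p₁ p₂ p₃ p₄, p₁ < p₂ → p₂ < p₃ → p₃ < p₄ →
      eqType φ α (σ ∘ Fin.castLE hk) I x p₁ = eqType φ α (σ ∘ Fin.castLE hk) I x p₂ →
      eqType φ α (σ ∘ Fin.castLE hk) I x p₃ = eqType φ α (σ ∘ Fin.castLE hk) I x p₄ →
      eqType φ α (σ ∘ Fin.castLE hk) I x p₁ = eqType φ α (σ ∘ Fin.castLE hk) I x p₃)
    (hno : ∀ x, ¬ ∃ e' : Fin n' ↪o Fin n, ∀ i, Keeps φ α σ l I x (e' i))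
    (e : Fin n' ↪o Fin n) (he : ∀ i, (e i : ℕ) = i + 1) :
    IsSampledBy φ α single (I ∘ e) (Set.range σ) := by
  classical
  set ty := eqType φ α (σ ∘ Fin.castLE hk) I with hty
  -- The core of the argument: an element with empty type at two positions could be moved so that
  -- these are the two ends, and would then be a further sample, contrary to `hno`.
  have htwo : ∀ x p p', p < p' → ty x p = ∅ → ty x p' ≠ ∅ := by
    intro x p p' hpp h1 h2
    have hm1 : StrictMono ![p, p'] := by
      rw [Fin.strictMono_iff_lt_succ]
      intro i; fin_cases i; simpa
    have hm2 : StrictMono ![(⟨0, by omega⟩ : Fin n), ⟨n - 1, by omega⟩] := by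
      rw [Fin.strictMono_iff_lt_succ]
      intro i; fin_cases i; simp [Fin.lt_def]; omega
    obtain ⟨y, hy⟩ := hI 2 (by omega) ![∅, ∅]
      (OrderEmbedding.ofStrictMono _ hm1) (OrderEmbedding.ofStrictMono _ hm2)
      ⟨x, fun d => by fin_cases d <;> assumption⟩
    have y0 : ty y ⟨0, by omega⟩ = ∅ := hy 0
    have y1 : ty y ⟨n - 1, by omega⟩ = ∅ := hy 1
    obtain ⟨ex, P, R, hP, hR⟩ := hex y
    have hempty : ∀ j, j ≠ ex → ty y j = ∅ := by
      intro j hj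
      rcases lt_or_gt_of_ne hj with hlt | hgt
      · rw [hP j hlt, ← y0, hP ⟨0, _⟩ (lt_of_le_of_lt (by simp [Fin.le_def]) hlt)]
      · rw [hR j hgt, ← y1,
          hR ⟨n - 1, _⟩ (lt_of_lt_of_le hgt (by rw [Fin.le_def]; simp; omega))]
    have hsub : (Finset.univ.filter fun j => y ∈ tupleNbhd α (I j)).card ≤ 1 := by
      rw [Finset.card_le_one]
      intro a ha b hb
      by_contra hab
      exact Set.disjoint_left.1 (hdis hab) (Finset.mem_filter.1 ha).2 (Finset.mem_filter.1 hb).2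
    have hcard := Finset.card_filter_add_card_filter_not (s := Finset.univ)
      (fun j : Fin n => y ∈ tupleNbhd α (I j))
    rw [Finset.card_univ, Fintype.card_fin] at hcard
    -- At most two tuples are lost, the one at the exceptional index and the one with `y` in its
    -- neighborhood, so at least `n'` remain.
    set G := (Finset.univ.filter fun j => y ∉ tupleNbhd α (I j)).erase ex with hG
    have hGcard : n' ≤ G.card := by
      have : _ ≤ G.card := Finset.pred_card_le_card_erase
      omega
    refine hno y ⟨Finset.orderEmbOfCardLe G hGcard, fun i => ?_⟩
    have hi := Finset.orderEmbOfCardLe_mem G hGcard i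
    have hi := Finset.mem_erase.1 hi
    rw [Finset.mem_filter] at hi
    refine ⟨hi.2.2, fun i' hi' => ?_⟩
    have h0 := hempty _ hi.1
    rw [Set.eq_empty_iff_forall_notMem] at h0
    have h1 := h0 ⟨i', by omega⟩
    -- Neither `y` nor the sample lies in the neighborhood, so inequivalence must come from an
    -- element on which their `φ`-neighborhoods differ.
    by_contra! hcon
    exact h1 ⟨⟨fun h => absurd h (hfresh.1 hl _ _), fun h => absurd h hi.2.2⟩,
      fun w hw => (by have := hcon w hw; tauto)⟩
  intro x
  obtain ⟨ex, P, R, hP, hR⟩ := hex x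
  obtain ⟨ex', hl', hr'⟩ := exists_clamp hn' e ex
  have hsample : ∀ {j} {i : Fin l₀}, i ∈ ty x j →
      tupleNbhd α (I j) ∩ nbhd φ x = tupleNbhd α (I j) ∩ nbhd φ (σ (Fin.castLE hk i)) := by
    intro j i hi
    ext w
    simp only [Set.mem_inter_iff]
    exact and_congr_right fun hw => (hi.2 w hw).symm
  have hmem : ∀ j, x ∈ tupleNbhd α (I j) → ty x j = ∅ := by
    intro j hj
    rw [Set.eq_empty_iff_forall_notMem]
    intro i hi
    exact hfresh.1 hl _ _ (hi.1.2 hj)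
  -- This is why the ends were removed: each retained index before the exception has the position
  -- `0` as a second position of the same type, and symmetrically on the right.
  have hleft : ∀ i < ex', (⟨0, by omega⟩ : Fin n) < e i ∧ e i < ex := by
    intro i hi
    exact ⟨by rw [Fin.lt_def, he]; simp, hl' i hi⟩
  have hright : ∀ i > ex', e i < (⟨n - 1, by omega⟩ : Fin n) ∧ ex < e i := by
    intro i hi
    refine ⟨?_, hr' i hi⟩
    rw [Fin.lt_def, he]; simp; omega
  have hown : ∀ i, x ∈ tupleNbhd α ((I ∘ e) i) → i = ex' := by
    intro i hi
    have h0 := hmem _ hi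
    rcases lt_trichotomy i ex' with hlt | heq | hgt
    · obtain ⟨h1, h2⟩ := hleft i hlt
      refine absurd h0 (htwo x _ _ h1 ?_)
      rw [hP _ (h1.trans h2), ← hP _ h2]
      exact h0
    · exact heq
    · obtain ⟨h1, h2⟩ := hright i hgt
      refine absurd ?_ (htwo x _ _ h1 h0)
      rw [hR _ (h2.trans h1), ← hR _ h2]
      exact h0
  have hPne : ∀ i < ex', ∃ p, p ∈ P := by
    intro i hi
    obtain ⟨h1, h2⟩ := hleft i hi
    rw [← Set.nonempty_def, Set.nonempty_iff_ne_empty]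
    rintro rfl
    exact htwo x _ _ h1 (hP _ (h1.trans h2)) (hP _ h2)
  have hRne : ∀ i > ex', ∃ p, p ∈ R := by
    intro i hi
    obtain ⟨h1, h2⟩ := hright i hi
    rw [← Set.nonempty_def, Set.nonempty_iff_ne_empty]
    rintro rfl
    exact htwo x _ _ h1 (hR _ h2) (hR _ (h2.trans h1))
  have hPs : ∀ p ∈ P, ∀ i < ex', tupleNbhd α ((I ∘ e) i) ∩ nbhd φ x =
      tupleNbhd α ((I ∘ e) i) ∩ nbhd φ (σ (Fin.castLE hk p)) := fun p hp i hi =>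
    hsample (by rw [hP _ (hl' i hi)]; exact hp)
  have hRs : ∀ p ∈ R, ∀ i > ex', tupleNbhd α ((I ∘ e) i) ∩ nbhd φ x =
      tupleNbhd α ((I ∘ e) i) ∩ nbhd φ (σ (Fin.castLE hk p)) := fun p hp i hi =>
    hsample (by rw [hR _ (hr' i hi)]; exact hp)
  by_cases hA : ∃ i, i < ex'
  · obtain ⟨i, hi⟩ := hA
    obtain ⟨p, hp⟩ := hPne i hi
    by_cases hB : ∃ i, i > ex'
    · obtain ⟨j, hj⟩ := hB
      by_cases hs : single
      -- The removed ends provide the outer two of the four positions required by stability.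
      · have hPR : P = R := by
          obtain ⟨h1, h2⟩ := hleft i hi
          obtain ⟨h3, h4⟩ := hright j hj
          have := hsingle hs x _ _ _ _ h1 (h2.trans h4) h3
            (by rw [hP _ (h1.trans h2), hP _ h2]) (by rw [hR _ h4, hR _ (h4.trans h3)])
          rw [hP _ (h1.trans h2), hR _ h4] at this
          exact this
        exact ⟨ex', _, ⟨_, rfl⟩, _, ⟨_, rfl⟩, hPs p hp, hRs p (hPR ▸ hp), hown, fun _ => rfl⟩
      · obtain ⟨p', hp'⟩ := hRne j hj
        exact ⟨ex', _, ⟨_, rfl⟩, _, ⟨_, rfl⟩, hPs p hp, hRs p' hp', hown, fun h => absurd h hs⟩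
    · exact ⟨ex', _, ⟨_, rfl⟩, _, ⟨_, rfl⟩, hPs p hp, fun j hj => absurd ⟨j, hj⟩ hB, hown,
        fun _ => rfl⟩
  · by_cases hB : ∃ i, i > ex'
    · obtain ⟨j, hj⟩ := hB
      obtain ⟨p', hp'⟩ := hRne j hj
      exact ⟨ex', _, ⟨_, rfl⟩, _, ⟨_, rfl⟩, fun j hj => absurd ⟨j, hj⟩ hA, hRs p' hp', hown,
        fun _ => rfl⟩
    · exact ⟨ex', _, ⟨⟨0, by omega⟩, rfl⟩, _, ⟨⟨0, by omega⟩, rfl⟩, fun j hj => absurd ⟨j, hj⟩ hA,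
        fun j hj => absurd ⟨j, hj⟩ hB, hown, fun _ => rfl⟩

/-- What is known after `j` rounds. -/
structure StageInvariant (φ : L.Formula (Fin 2)) (α : L.Formula (Fin r ⊕ Unit)) (single : Prop)
    (l₀ : ℕ) {k : ℕ} (j : ℕ) (σ : Fin k → M) (l : ℕ) {n : ℕ} (I : Fin n → Fin r → M) : Prop where
  le : l ≤ j
  disjoint : HasDisjointNbhds α I
  eq_of_le : ∀ i i' : Fin k, l ≤ i.1 + 1 → l ≤ i'.1 + 1 → σ i = σ i'
  fresh_or_sampled : (l = j ∧ j < l₀ ∧ IsFresh φ α σ l I) ∨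
    (1 ≤ l ∧ IsSampledBy φ α single I (Set.range σ))

theorem IsFresh.comp {φ : L.Formula (Fin 2)} {α : L.Formula (Fin r ⊕ Unit)} {k l n n' : ℕ}
    {σ : Fin k → M} {I : Fin n → Fin r → M} (h : IsFresh φ α σ l I) (e : Fin n' ↪o Fin n) :
    IsFresh φ α σ l (I ∘ e) :=
  ⟨fun hl i _ => h.1 hl i _, fun i i' hi hi' _ => h.2 i i' hi hi' _⟩

theorem IsFresh.insert {φ : L.Formula (Fin 2)} {α : L.Formula (Fin r ⊕ Unit)} {k l n n' : ℕ}
    {σ σ' : Fin k → M} {I : Fin n → Fin r → M} {x : M} {e : Fin n' ↪o Fin n}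
    (h : IsFresh φ α σ l I) (hx : ∀ i, Keeps φ α σ l I x (e i))
    (hσ : ∀ i, σ' i = if i.1 < l then σ i else x) : IsFresh φ α σ' (l + 1) (I ∘ e) := by
  refine ⟨fun _ i j => ?_, fun i i' hi hi' j => ?_⟩
  · rw [hσ]
    split_ifs with hil
    · exact h.1 (by omega) _ _
    · exact (hx j).1
  · rw [hσ, hσ, if_pos (by rw [Fin.lt_def] at hi; omega)]
    split_ifs with hil
    · exact h.2 i i' hi hil _
    · obtain ⟨w, hw, hne⟩ := (hx j).2 i (by rw [Fin.lt_def] at hi; omega)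
      exact ⟨w, hw, by tauto⟩

end Samples

/-! ### Preservation of the invariant by one round -/

section Rounds

variable {L : FirstOrder.Language.{u, v}} {r : ℕ}

/-- A round that finds no new sample settles sampling for good, and fewer than `l₀` samples can be
fresh. Sufficient length is needed only while freshness may still hold, which explains the guard `j
< l₀`. Later rounds may add elements, which does no harm. The common value of the unused constants
is the last sample found, so that padding introduces no further elements. -/
theorem exists_bound_stage {C : Set (Bundled.{w} L.Structure)} (hC : IsMonadicallyNIP C)
    (φ : L.Formula (Fin 2)) (α : L.Formula (Fin r ⊕ Unit)) :
    ∃ l₀ B : ℕ, 1 ≤ l₀ ∧ l₀ + 4 ≤ B ∧ ∀ k ≥ B, ∀ A ∈ C, ∀ (j n n' n'' : ℕ) (σ : Fin k → A) (l : ℕ)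
      (I : Fin n → Fin r → A) (σ' : Fin k → A) (l' : ℕ) (e : Fin n' ↪o Fin n)
      (e' : Fin n'' ↪o Fin n'),
      IsEqIndiscernible φ α σ I →
      StageInvariant φ α (IsMonadicallyStable C) l₀ j σ l I → j < k → n = n' + 3 → 0 < n'' →
      (j < l₀ → B ≤ n'') → IsStep φ α σ l I σ' l' e →
      StageInvariant φ α (IsMonadicallyStable C) l₀ (j + 1) σ' l' (I ∘ e ∘ e') := by
  classical
  obtain ⟨l₀, n₁, hl₀, hn₁⟩ := exists_bound_distinguished hC φ α
  obtain ⟨B₁, hB₁, hex⟩ := exists_bound_exceptional hC φ α l₀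
  obtain ⟨B₂, hsing⟩ : ∃ B : ℕ, IsMonadicallyStable C →
      ∀ k ≥ B, ∀ n ≥ B, ∀ A ∈ C, ∀ (g : Fin l₀ → A) (I : Fin n → Fin r → A),
      WordIndiscernible k (eqType φ α g I) →
      (∀ x, ∃ ex : Fin n, ∃ P R : Set (Fin l₀),
        (∀ i < ex, eqType φ α g I x i = P) ∧ ∀ i > ex, eqType φ α g I x i = R) →
      ∀ x p₁ p₂ p₃ p₄, p₁ < p₂ → p₂ < p₃ → p₃ < p₄ →
        eqType φ α g I x p₁ = eqType φ α g I x p₂ → eqType φ α g I x p₃ = eqType φ α g I x p₄ →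
        eqType φ α g I x p₁ = eqType φ α g I x p₃ := by
    by_cases hS : IsMonadicallyStable C
    · obtain ⟨B, hB⟩ := exists_bound_single hS φ α l₀
      exact ⟨B, fun _ => hB⟩
    · exact ⟨0, fun h => absurd h hS⟩
  refine ⟨l₀, l₀ + 4 + n₁ + B₁ + B₂, hl₀, by omega, fun k hk A hA j n n' n'' σ l I σ' l' e e' hI hinv
    hjk hn hn'' hB hstep => ?_⟩
  have hle' : n'' ≤ n' := by
    simpa using Fintype.card_le_of_embedding e'.toEmbedding
  have hdis := (hinv.disjoint.comp e).comp e'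
  rcases hstep with ⟨x, hx, rfl, hσ⟩ | ⟨hl, rfl, rfl, he, hno⟩
  · refine ⟨by have := hinv.le; omega, hdis, fun i i' hi hi' => ?_, ?_⟩
    · rw [hσ, hσ, if_neg (by omega), if_neg (by omega)]
    rcases hinv.fresh_or_sampled with ⟨rfl, hlt, hf⟩ | ⟨hl, hs⟩
    · have hf' := (hf.insert hx hσ).comp e'
      refine Or.inl ⟨rfl, ?_, hf'⟩
      -- Reaching `l₀` fresh samples over at least `n₁` disjoint neighborhoods contradicts
      -- `exists_bound_distinguished`.
      by_contra hcon
      obtain rfl : l₀ = l + 1 := by omega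
      have hd := hdis.comp (Fin.castLEOrderEmb (show n₁ ≤ n'' by have := hB hlt; omega))
      refine hn₁ A hA (fun i => σ' (Fin.castLE (by omega) i)) _ hd fun j i i' hii => ?_
      rcases lt_or_gt_of_ne hii with h | h
      · exact hf'.2 _ _ (by simpa using h) i'.2 _
      · obtain ⟨w, hw, hne⟩ := hf'.2 (Fin.castLE (by omega) i') (Fin.castLE (by omega) i)
          (by simpa using h) i.2 (Fin.castLE (show n₁ ≤ n'' by have := hB hlt; omega) j)
        exact ⟨w, hw, by tauto⟩
    · refine Or.inr ⟨by omega, ?_⟩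
      refine hs.comp ?_ hn'' (e'.trans e)
      -- Overwriting the padding loses no sample: by `eq_of_le` every overwritten value is still
      -- present at index `l - 1`.
      rintro _ ⟨i, rfl⟩
      have hlj := hinv.le
      by_cases hil : i.1 < l
      · exact ⟨i, by rw [hσ, if_pos hil]⟩
      · refine ⟨⟨l - 1, by omega⟩, ?_⟩
        rw [hσ, if_pos (show l - 1 < l by omega)]
        exact hinv.eq_of_le _ _ (by simp; omega) (by omega)
  · refine ⟨by have := hinv.le; omega, hdis, hinv.eq_of_le, ?_⟩
    rcases hinv.fresh_or_sampled with ⟨rfl, hlt, hf⟩ | ⟨hl, hs⟩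
    · refine Or.inr ⟨hl, ?_⟩
      have hB' := hB hlt
      have hw := hI.wordIndiscernible (Fin.castLE (show l₀ ≤ k by omega))
      have hexx := hex k (by omega) n (by omega) A hA _ I hw
      have := isSampledBy_of_not_keeps (single := IsMonadicallyStable C) (by omega) hn hl hlt.le
        (by omega) (by omega) hinv.disjoint hf hw hexx
        (fun hS => hsing hS k (by omega) n (by omega) A hA _ I hw hexx) hno e he
      exact this.comp subset_rfl hn'' e'
    · exact Or.inr ⟨hl, hs.comp subset_rfl hn'' (e'.trans e)⟩

theorem StageInvariant.zero {M : Type w} [L.Structure M] {φ : L.Formula (Fin 2)}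
    {α : L.Formula (Fin r ⊕ Unit)} {single : Prop} {l₀ k n : ℕ} (hl₀ : 1 ≤ l₀) {I : Fin n → Fin r → M}
    (hI : HasDisjointNbhds α I) (a : M) :
    StageInvariant φ α single l₀ 0 (fun _ : Fin k => a) 0 I where
  le := le_rfl
  disjoint := hI
  eq_of_le _ _ _ _ := rfl
  fresh_or_sampled := Or.inl ⟨rfl, hl₀, fun h => absurd h (by omega),
    fun _ _ _ h => absurd h (by omega)⟩

end Rounds

/-! ### Iterated extraction -/

section Extraction

variable {L : FirstOrder.Language.{u, v}} {r : ℕ}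

theorem exists_encodesSequence {M : Type w} [L.Structure M] {n l : ℕ} (enum : Fin n ≃ M)
    (J : Fin l → Fin r → M) : ∃ inp : Memory, EncodesSequence enum J inp := by
  classical
  refine ⟨fun a i => if a = 0 then (if i = 0 then n else l) else
    if h : i < l ∧ a - 1 < r then (enum.symm (J ⟨i, h.1⟩ ⟨a - 1, h.2⟩) : ℕ) else 0, ?_, ?_, ?_⟩
  · simp
  · simp
  · intro i c
    simp

theorem AdmitsExtraction.exists_indiscernible {C : Set (Bundled.{w} L.Structure)}
    (hfin : ∀ A ∈ C, Finite A) {φ : L.Formula (Fin 2)} {α : L.Formula (Fin r ⊕ Unit)} {k : ℕ}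
    {f : ℕ → ℕ} {T : ℕ → ℕ → ℕ}
    (h : AdmitsExtraction (withConstantSymbols C k) f T
      (patternFormulas k (eqConstFormulas φ α k))) {A : Bundled.{w} L.Structure} (hA : A ∈ C)
    (σ : Fin k → A) (m : ℕ) (J : Fin (f m) → Fin r → A) (hJ : Function.Injective J) :
    ∃ I : Fin m ↪o Fin (f m), IsEqIndiscernible φ α σ (J ∘ I) := by
  obtain ⟨P, hP⟩ := h
  have := hfin A hA
  obtain ⟨n, ⟨e⟩⟩ := Finite.exists_equiv_fin A
  obtain ⟨inp, hinp⟩ := exists_encodesSequence (L := L) e.symm J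
  obtain ⟨t, res, -, -, I, -, hI⟩ :=
    hP _ (withConstants_mem hA σ) n e.symm m J hJ inp hinp
  exact ⟨I, hI⟩

/-- The inequality `x ≤ f x` is available only below the given length, so monotonicity of the
iterates is obtained by descending from `k`. The gain of `3` per iterate makes the sequences of the
early rounds longer than any bound, provided `k` is large. -/
theorem iterate_lengths {f : ℕ → ℕ} {k m : ℕ}
    (h : ∀ x, f x + 3 ≤ (fun x => f x + 3)^[k] m → x ≤ f x) :
    ∀ i ≤ k, (fun x => f x + 3)^[i] m ≤ (fun x => f x + 3)^[k] m ∧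
      3 * i + m ≤ (fun x => f x + 3)^[i] m := by
  have h1 : ∀ i ≤ k, (fun x => f x + 3)^[i] m ≤ (fun x => f x + 3)^[k] m := by
    intro i hi
    obtain ⟨d, rfl⟩ := Nat.exists_eq_add_of_le hi
    clear hi
    induction d generalizing i with
    | zero => exact le_rfl
    | succ d ih =>
      have e : i + (d + 1) = i + 1 + d := by omega
      rw [e] at h ⊢
      have ih := ih (i := i + 1) h
      rw [Function.iterate_succ_apply'] at ih
      have := h _ ih
      omega
  intro i hi
  refine ⟨h1 i hi, ?_⟩
  induction i with
  | zero => simp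
  | succ i ih =>
    have h2 := h1 _ hi
    rw [Function.iterate_succ_apply'] at h2 ⊢
    have := h _ h2
    have := ih (by omega)
    omega

/-- The extracted positions embed `Fin x` into `Fin (f x)`. A supply of distinct tuples is required
for the extractor to say anything about `f x`. -/
theorem AdmitsExtraction.le {C : Set (Bundled.{w} L.Structure)}
    (hfin : ∀ A ∈ C, Finite A) {φ : L.Formula (Fin 2)} {α : L.Formula (Fin r ⊕ Unit)} {k : ℕ}
    {f : ℕ → ℕ} {T : ℕ → ℕ → ℕ}
    (h : AdmitsExtraction (withConstantSymbols C k) f T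
      (patternFormulas k (eqConstFormulas φ α k))) {A : Bundled.{w} L.Structure} (hA : A ∈ C)
    (a : A) {N : ℕ} (J : Fin N → Fin r → A) (hJ : Function.Injective J) (x : ℕ)
    (hx : f x ≤ N) : x ≤ f x := by
  obtain ⟨I, -⟩ := h.exists_indiscernible hfin hA (fun _ => a) x (J ∘ Fin.castLE hx)
    (hJ.comp (Fin.castLE_injective _))
  simpa using Fintype.card_le_of_embedding I.toEmbedding

/-- The first of the `k` iterates pays for an initial extraction with constant samples, each further
one for a round. The final stage `k - 1` is at least `l₀`, so freshness is excluded there. -/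
theorem exists_sampled {C : Set (Bundled.{w} L.Structure)} (hfin : ∀ A ∈ C, Finite A)
    (hne : ∀ A ∈ C, Nonempty A) {φ : L.Formula (Fin 2)} {α : L.Formula (Fin r ⊕ Unit)}
    {l₀ B : ℕ} (hl₀ : 1 ≤ l₀) {k : ℕ}
    (hstage : ∀ A ∈ C, ∀ (j n n' n'' : ℕ) (σ : Fin k → A) (l : ℕ)
      (I : Fin n → Fin r → A) (σ' : Fin k → A) (l' : ℕ) (e : Fin n' ↪o Fin n)
      (e' : Fin n'' ↪o Fin n'), IsEqIndiscernible φ α σ I →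
      StageInvariant φ α (IsMonadicallyStable C) l₀ j σ l I → j < k → n = n' + 3 → 0 < n'' →
      (j < l₀ → B ≤ n'') → IsStep φ α σ l I σ' l' e →
      StageInvariant φ α (IsMonadicallyStable C) l₀ (j + 1) σ' l' (I ∘ e ∘ e'))
    (hk : B + l₀ + 1 ≤ k) {f : ℕ → ℕ} {T : ℕ → ℕ → ℕ}
    (hext : AdmitsExtraction (withConstantSymbols C k) f T
      (patternFormulas k (eqConstFormulas φ α k))) {A : Bundled.{w} L.Structure} (hA : A ∈ C)
    {m : ℕ} (hm : 1 ≤ m) (J : Fin ((fun x => f x + 3)^[k] m) → Fin r → A)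
    (hJ : Function.Injective J) (hdis : HasDisjointNbhds α J) :
    ∃ (I : Fin m ↪o Fin ((fun x => f x + 3)^[k] m)) (σ : Fin k → A),
      IsSampledBy φ α (IsMonadicallyStable C) (J ∘ I) (Set.range σ) := by
  classical
  obtain ⟨a⟩ := hne A hA
  have hlen := iterate_lengths (f := f) (k := k) (m := m)
    fun x hx => hext.le hfin hA a J hJ x (by omega)
  -- After `j` rounds the length is the iterate with exponent `i = k - 1 - j`, stated additively to
  -- avoid subtraction.
  have key : ∀ j i, j + i + 1 = k → ∃ (σ : Fin k → A) (l : ℕ)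
      (e : Fin ((fun x => f x + 3)^[i] m) ↪o Fin ((fun x => f x + 3)^[k] m)),
      IsEqIndiscernible φ α σ (J ∘ e) ∧
        StageInvariant φ α (IsMonadicallyStable C) l₀ j σ l (J ∘ e) := by
    intro j
    induction j with
    | zero =>
      intro i hi
      have hle : f ((fun x => f x + 3)^[i] m) ≤ (fun x => f x + 3)^[k] m := by
        have : k = i + 1 := by omega
        rw [this, Function.iterate_succ_apply']
        exact Nat.le_add_right _ _
      obtain ⟨I, hI⟩ := hext.exists_indiscernible hfin hA (fun _ => a) _ (J ∘ Fin.castLE hle)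
        (hJ.comp (Fin.castLE_injective _))
      exact ⟨fun _ => a, 0, I.trans (Fin.castLEOrderEmb hle), hI,
        StageInvariant.zero hl₀ (hdis.comp _) a⟩
    | succ j ih =>
      intro i hi
      obtain ⟨σ, l, e, hI, hinv⟩ := ih (i + 1) (by omega)
      have hn : (fun x => f x + 3)^[i + 1] m = f ((fun x => f x + 3)^[i] m) + 3 :=
        Function.iterate_succ_apply' _ _ _
      have : Nonempty A := ⟨a⟩
      obtain ⟨σ', l', e', hstep⟩ := exists_step φ α σ (l := l) hn (J ∘ e) hinv.disjoint
      obtain ⟨I, hI'⟩ := hext.exists_indiscernible hfin hA σ' _ (J ∘ e ∘ e')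
        (hJ.comp (e.injective.comp e'.injective))
      have hi' := (hlen i (by omega)).2
      refine ⟨σ', l', (I.trans e').trans e, hI', ?_⟩
      exact hstage A hA j _ _ _ σ l _ σ' l' e' I hI hinv (by omega) hn (by omega)
        (by omega) hstep
  obtain ⟨σ, l, e, -, hinv⟩ := key (k - 1) 0 (by omega)
  rcases hinv.fresh_or_sampled with ⟨-, h, -⟩ | ⟨-, h⟩
  · omega
  · exact ⟨e, σ, h⟩

end Extraction

/-! ### Rules for running times of programs -/

section Runs

variable {L : FirstOrder.Language.{u, v}} {M : Type w} [L.Structure M] {n : ℕ}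

/-- Started with work arrays `wk`, the program `p` halts within `T` steps, with work arrays
satisfying `Q`. -/
def Runs (enum : Fin n ≃ M) (p : Prog L) (inp wk : Memory) (T : ℕ) (Q : Memory → Prop) : Prop :=
  ∃ (t : ℕ) (wk' : Memory), Exec enum p inp wk t wk' ∧ t ≤ T ∧ Q wk'

variable {enum : Fin n ≃ M} {p q : Prog L} {inp wk : Memory} {T T' : ℕ} {Q Q' : Memory → Prop}

theorem Runs.mono (h : Runs enum p inp wk T Q) (hT : T ≤ T') (hQ : ∀ wk', Q wk' → Q' wk') :
    Runs enum p inp wk T' Q' := by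
  obtain ⟨t, wk', he, ht, hq⟩ := h
  exact ⟨t, wk', he, ht.trans hT, hQ _ hq⟩

theorem Runs.skip (hT : 1 ≤ T) (hQ : Q wk) : Runs enum (.skip : Prog L) inp wk T Q :=
  ⟨_, _, Exec.skip _ _, hT, hQ⟩

theorem Runs.store {a : ℕ} {i e : Expr} (hT : i.cost + e.cost + 1 ≤ T)
    (hQ : Q (wk.write a (i.eval inp wk) (e.eval inp wk))) :
    Runs enum (.store a i e : Prog L) inp wk T Q :=
  ⟨_, _, Exec.store _ _ _ _ _, hT, hQ⟩

theorem Runs.seq (h : Runs enum p inp wk T Q) (h' : ∀ wk', Q wk' → Runs enum q inp wk' T' Q') :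
    Runs enum (.seq p q) inp wk (T + T') Q' := by
  obtain ⟨t, wk', he, ht, hq⟩ := h
  obtain ⟨t', wk'', he', ht', hq'⟩ := h' wk' hq
  exact ⟨_, _, Exec.seq he he', Nat.add_le_add ht ht', hq'⟩

theorem Runs.ite {e : Expr} (h : e.eval inp wk ≠ 0 → Runs enum p inp wk T Q)
    (h' : e.eval inp wk = 0 → Runs enum q inp wk T Q) (hT : e.cost + T + 1 ≤ T') :
    Runs enum (.ite e p q) inp wk T' Q := by
  by_cases h0 : e.eval inp wk = 0
  · obtain ⟨t, wk', he, ht, hq⟩ := h' h0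
    exact ⟨_, _, Exec.ite_false h0 he, by omega, hq⟩
  · obtain ⟨t, wk', he, ht, hq⟩ := h h0
    exact ⟨_, _, Exec.ite_true h0 he, by omega, hq⟩

/-- The invariant is indexed by the number of completed passes, which fixes both the exit condition
and the time. -/
theorem Runs.while {e : Expr} (Inv : ℕ → Memory → Prop) (N Tb : ℕ) (h0 : Inv 0 wk)
    (hN : ∀ wk, Inv N wk → e.eval inp wk = 0)
    (hlt : ∀ j < N, ∀ wk, Inv j wk → e.eval inp wk ≠ 0 ∧ Runs enum p inp wk Tb (Inv (j + 1))) :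
    Runs enum (.while e p) inp wk (N * (Tb + e.cost + 1) + e.cost + 1) (Inv N) := by
  have key : ∀ d j, j + d = N → ∀ wk, Inv j wk →
      Runs enum (.while e p) inp wk (d * (Tb + e.cost + 1) + e.cost + 1) (Inv N) := by
    intro d
    induction d with
    | zero =>
      intro j hj wk hi
      obtain rfl : j = N := by omega
      exact ⟨_, _, Exec.while_false (hN _ hi), by omega, hi⟩
    | succ d ih =>
      intro j hj wk hi
      obtain ⟨hne, t, wk', he, ht, hq⟩ := hlt j (by omega) wk hi
      obtain ⟨t', wk'', he', ht', hq'⟩ := ih (j + 1) (by omega) wk' hq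
      refine ⟨_, _, Exec.while_true hne he he', ?_, hq'⟩
      rw [Nat.succ_mul]
      omega
  exact key N 0 (by omega) wk h0

theorem Runs.call {ins : List (ℕ ⊕ ℕ)} {outs : List ℕ}
    (h : HaltsWithin enum p (passInputs inp wk ins) T Q)
    (hQ : ∀ res, Q res → Q' (returnOutputs wk res outs))
    (hT : ins.length + outs.length + T + 1 ≤ T') : Runs enum (.call p ins outs) inp wk T' Q' := by
  obtain ⟨t, res, he, ht, hq⟩ := h
  exact ⟨_, _, Exec.call he, by omega, hQ _ hq⟩

@[simp] theorem Memory.write_self (wk : Memory) (a i x : ℕ) :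
    wk.write a i x a = Function.update (wk a) i x := by
  simp [Memory.write]

@[simp] theorem Memory.write_of_ne (wk : Memory) {a b : ℕ} (i x : ℕ) (h : b ≠ a) :
    wk.write a i x b = wk b := by
  simp [Memory.write, h]

/-- The value of the variable that is kept in cell `0` of work array `a`. -/
def Expr.var (a : ℕ) : Expr := .work a (.const 0)

/-- An expression that is nonzero iff `e₁` and `e₂` are different. -/
def Expr.ne (e₁ e₂ : Expr) : Expr := .add (.sub e₁ e₂) (.sub e₂ e₁)

@[simp] theorem Expr.eval_var (a : ℕ) : (Expr.var a).eval inp wk = wk a 0 := rfl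

@[simp] theorem Expr.cost_var (a : ℕ) : (Expr.var a).cost = 2 := rfl

theorem Expr.eval_ne (e₁ e₂ : Expr) :
    (Expr.ne e₁ e₂).eval inp wk = 0 ↔ e₁.eval inp wk = e₂.eval inp wk := by
  simp only [Expr.ne, Expr.eval]
  omega

@[simp] theorem Expr.cost_ne (e₁ e₂ : Expr) :
    (Expr.ne e₁ e₂).cost = 2 * e₁.cost + 2 * e₂.cost + 3 := by
  simp only [Expr.ne, Expr.cost]
  omega

/-- Run `p` for all values of the variable `a` below the bound. -/
def Prog.for (a : ℕ) (bound : Expr) (p : Prog L) : Prog L :=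
  .seq (.store a (.const 0) (.const 0))
    (.while (.sub bound (.var a))
      (.seq p (.store a (.const 0) (.add (.var a) (.const 1)))))

/-- The frame condition `hframe` says that the invariant ignores the counter cell, so it survives
both the initialisation and the increments. -/
theorem Runs.for {a : ℕ} {bound : Expr} (Inv : ℕ → Memory → Prop) (N Tb : ℕ) (h0 : Inv 0 wk)
    (hframe : ∀ j wk x, Inv j wk → Inv j (wk.write a 0 x))
    (hbound : ∀ j wk, Inv j wk → bound.eval inp wk = N)
    (hbody : ∀ j < N, ∀ wk, Inv j wk → wk a 0 = j →
      Runs enum p inp wk Tb fun wk' => wk' a 0 = j ∧ Inv (j + 1) wk')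
    (hT : N * (Tb + bound.cost + 10) + bound.cost + 7 ≤ T) :
    Runs enum (Prog.for a bound p) inp wk T (Inv N) := by
  have h1 : Runs enum (.store a (.const 0) (.const 0) : Prog L) inp wk 3
      fun wk' => wk' a 0 = 0 ∧ Inv 0 wk' :=
    Runs.store (by simp [Expr.cost]) ⟨by simp [Expr.eval], hframe _ _ _ h0⟩
  refine (h1.seq fun wk' hwk' => (Runs.while (fun j wk => wk a 0 = j ∧ Inv j wk) N (Tb + 6) hwk'
    ?_ ?_).mono le_rfl fun wk' h => h.2).mono ?_ fun _ h => h
  · rintro wk ⟨hj, hi⟩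
    simp [Expr.eval, hbound N wk hi, hj]
  · rintro j hj wk ⟨hwj, hi⟩
    refine ⟨by simp [Expr.eval, hbound j wk hi, hwj]; omega, ?_⟩
    refine (hbody j hj wk hi hwj).seq fun wk' h' => Runs.store (by simp [Expr.cost]) ?_
    refine ⟨by simp [Expr.eval, h'.1], ?_⟩
    exact hframe _ _ _ h'.2
  · simp only [Expr.cost, Expr.cost_var]
    have : Tb + 6 + (bound.cost + 2 + 1) + 1 = Tb + bound.cost + 10 := by omega
    rw [this]
    omega

theorem Exec.one_le {t : ℕ} {wk' : Memory} (h : Exec enum p inp wk t wk') : 1 ≤ t := by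
  induction h <;> omega

/-- Every step of a program makes at most one cell nonzero. -/
theorem Exec.exists_support {t : ℕ} {wk' : Memory} (h : Exec enum p inp wk t wk') :
    ∀ s : Finset (ℕ × ℕ), (∀ a i, wk a i ≠ 0 → (a, i) ∈ s) →
      ∃ s' : Finset (ℕ × ℕ), (∀ a i, wk' a i ≠ 0 → (a, i) ∈ s') ∧ s'.card ≤ s.card + t := by
  classical
  have hwrite : ∀ (wk : Memory) (s : Finset (ℕ × ℕ)) (a i x : ℕ),
      (∀ a i, wk a i ≠ 0 → (a, i) ∈ s) → ∃ s' : Finset (ℕ × ℕ),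
        (∀ a' i', wk.write a i x a' i' ≠ 0 → (a', i') ∈ s') ∧ s'.card ≤ s.card + 1 := by
    intro wk s a i x hs
    refine ⟨insert (a, i) s, fun a' i' h => ?_, Finset.card_insert_le _ _⟩
    by_cases ha : a' = a
    · subst ha
      by_cases hi : i' = i
      · subst hi; exact Finset.mem_insert_self _ _
      · rw [Memory.write_self, Function.update_of_ne hi] at h
        exact Finset.mem_insert_of_mem (hs _ _ h)
    · rw [Memory.write_of_ne _ _ _ ha] at h
      exact Finset.mem_insert_of_mem (hs _ _ h)
  induction h with
  | skip => exact fun s hs => ⟨s, hs, by omega⟩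
  | store a i e inp wk =>
    intro s hs
    obtain ⟨s', h1, h2⟩ := hwrite wk s a (i.eval inp wk) (e.eval inp wk) hs
    exact ⟨s', h1, by omega⟩
  | rel R args a i inp wk =>
    intro s hs
    obtain ⟨s', h1, h2⟩ := hwrite wk s a (i.eval inp wk) _ hs
    exact ⟨s', h1, by omega⟩
  | func f args a i inp wk =>
    intro s hs
    obtain ⟨s', h1, h2⟩ := hwrite wk s a (i.eval inp wk) _ hs
    exact ⟨s', h1, by omega⟩
  | seq _ _ ih1 ih2 =>
    intro s hs
    obtain ⟨s1, h1, c1⟩ := ih1 s hs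
    obtain ⟨s2, h2, c2⟩ := ih2 s1 h1
    exact ⟨s2, h2, by omega⟩
  | ite_true _ _ ih =>
    intro s hs
    obtain ⟨s1, h1, c1⟩ := ih s hs
    exact ⟨s1, h1, by omega⟩
  | ite_false _ _ ih =>
    intro s hs
    obtain ⟨s1, h1, c1⟩ := ih s hs
    exact ⟨s1, h1, by omega⟩
  | while_true _ _ _ ih1 ih2 =>
    intro s hs
    obtain ⟨s1, h1, c1⟩ := ih1 s hs
    obtain ⟨s2, h2, c2⟩ := ih2 s1 h1
    exact ⟨s2, h2, by omega⟩
  | while_false => exact fun s hs => ⟨s, hs, by omega⟩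
  | @call p ins outs inp wk res t _ ih =>
    intro s hs
    obtain ⟨s1, h1, c1⟩ := ih ∅ (by simp)
    -- A cell of a returned array is charged to a nonzero cell of the subprogram, via the first
    -- position of the array in `outs`.
    refine ⟨s ∪ s1.image fun b => ((outs[b.1]?).getD 0, b.2), fun a i h => ?_, ?_⟩
    · rw [Finset.mem_union]
      by_cases ha : a ∈ outs
      · right
        simp only [returnOutputs, ha, if_true] at h
        refine Finset.mem_image.2 ⟨_, h1 _ _ h, ?_⟩
        simp [List.getElem?_idxOf ha]
      · left
        simp only [returnOutputs, ha, if_false] at h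
        exact hs _ _ h
    · have h2 := Finset.card_union_le s (s1.image fun b => ((outs[b.1]?).getD 0, b.2))
      have h3 := Finset.card_image_le (s := s1) (f := fun b => ((outs[b.1]?).getD 0, b.2))
      simp only [Finset.card_empty] at c1
      omega

/-- A program that returns a subsequence of length `m` needs at least `m - 1` steps. -/
theorem Exec.le_of_returnsSubsequence {t m l : ℕ} {res : Memory}
    (h : Exec enum p inp (fun _ _ => 0) t res) {I : Fin m ↪o Fin l}
    (hI : ReturnsSubsequence I res) : m ≤ t + 1 := by
  classical
  obtain ⟨s, hs, hc⟩ := h.exists_support ∅ (by simp)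
  -- Strictly increasing positions satisfy `i ≤ I i`, so all output cells except possibly the first
  -- are nonzero and had to be written.
  have hmono : ∀ i : Fin m, i.1 ≤ I i := by
    rintro ⟨i, hi⟩
    induction i with
    | zero => exact Nat.zero_le _
    | succ i ih =>
      have h1 := ih (by omega)
      have h2 : I ⟨i, by omega⟩ < I ⟨i + 1, hi⟩ := I.lt_iff_lt.2 (by simp [Fin.lt_def])
      rw [Fin.lt_def] at h2
      simp only at h1 ⊢
      omega
  have hsub : (Finset.Ico 1 m).image (fun i => (1, i)) ⊆ s := by
    intro b hb
    obtain ⟨i, hi, rfl⟩ := Finset.mem_image.1 hb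
    rw [Finset.mem_Ico] at hi
    refine hs _ _ ?_
    rw [hI.2 ⟨i, hi.2⟩]
    have := hmono ⟨i, hi.2⟩
    simp only at this
    omega
  have := Finset.card_le_card hsub
  rw [Finset.card_image_of_injective _ (fun a b h => by simpa using h), Nat.card_Ico] at this
  simp only [Finset.card_empty] at hc
  omega

end Runs

/-! ### Eliminating constant symbols -/

section Constants

variable {L : FirstOrder.Language.{u, v}} {M : Type w} [L.Structure M] {n k : ℕ}

/-- Memory with an additional array `0`. -/
def consInput (c : ℕ → ℕ) (inp : Memory) : Memory
  | 0 => c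
  | a + 1 => inp a

/-- The expression in which the indices of the input arrays are increased by one. -/
def Expr.shift : Expr → Expr
  | .const c => .const c
  | .input a i => .input (a + 1) i.shift
  | .work a i => .work a i.shift
  | .add e₁ e₂ => .add e₁.shift e₂.shift
  | .sub e₁ e₂ => .sub e₁.shift e₂.shift

theorem Expr.eval_shift (c : ℕ → ℕ) (inp wk : Memory) (e : Expr) :
    e.shift.eval (consInput c inp) wk = e.eval inp wk := by
  induction e with
  | const c => rfl
  | input a i ih => simp only [Expr.shift, Expr.eval, ih]; rfl
  | work a i ih => simp only [Expr.shift, Expr.eval, ih]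
  | add e₁ e₂ ih₁ ih₂ => simp only [Expr.shift, Expr.eval, ih₁, ih₂]
  | sub e₁ e₂ ih₁ ih₂ => simp only [Expr.shift, Expr.eval, ih₁, ih₂]

theorem Expr.cost_shift (e : Expr) : e.shift.cost = e.cost := by
  induction e <;> simp_all [Expr.shift, Expr.cost]

/-- The index of a constant symbol. -/
def constantIndex : {d : ℕ} → (L[[Fin k]]).Functions d → ℕ
  | 0, Sum.inr c => Fin.val (n := k) c
  | _, _ => 0

/-- The program for structures without constants that finds the values of the constants in its
input array `0`. -/
def Prog.eliminateConstants : Prog (L[[Fin k]]) → Prog L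
  | .skip => .skip
  | .store a i e => .store a i.shift e.shift
  | .rel (d := _) R args a i =>
    match R with
    | Sum.inl R => .rel R (fun j => (args j).shift) a i.shift
    | Sum.inr _ => .skip
  | .func (d := _) f _ a i => .store a i.shift (.input 0 (.const (constantIndex f)))
  | .seq p q => .seq p.eliminateConstants q.eliminateConstants
  | .ite e p q => .ite e.shift p.eliminateConstants q.eliminateConstants
  | .while e p => .while e.shift p.eliminateConstants
  | .call p ins outs =>
    .call p.eliminateConstants (Sum.inl 0 :: ins.map (Sum.map (· + 1) id)) outs

/-- Called subprograms receive the array of constants as well, so the simulation is compatible with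
recursion into calls. -/
theorem passInputs_cons (c : ℕ → ℕ) (inp wk : Memory) (ins : List (ℕ ⊕ ℕ)) :
    passInputs (consInput c inp) wk (Sum.inl 0 :: ins.map (Sum.map (· + 1) id)) =
      consInput c (passInputs inp wk ins) := by
  funext b
  cases b with
  | zero => rfl
  | succ b =>
    simp only [passInputs, consInput, List.getElem?_cons_succ, List.getElem?_map]
    rcases h : ins[b]? with _ | a | a <;> rfl

/-- In a relational language the only function symbols are the constants, whose values become array
reads. Such a read and the extra argument of each call cost a bounded overhead, covered by the
factor `3`. -/
theorem Exec.eliminateConstants [L.IsRelational] {enum : Fin n ≃ M} {σ : Fin k → M}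
    {c : ℕ → ℕ} (hc : ∀ i : Fin k, c i = enum.symm (σ i)) {p : Prog (L[[Fin k]])}
    {inp wk : Memory} {t : ℕ} {wk' : Memory}
    (h : letI := constantStructure (L := L) σ
      Exec enum p inp wk t wk') :
    ∃ t', Exec enum p.eliminateConstants (consInput c inp) wk t' wk' ∧ t' ≤ 3 * t := by
  let _ := constantStructure (L := L) σ
  induction h with
  | skip => exact ⟨1, Exec.skip _ _, by omega⟩
  | store a i e inp wk =>
    have := Exec.store (enum := enum) (L := L) a i.shift e.shift (consInput c inp) wk
    rw [Expr.eval_shift, Expr.eval_shift] at this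
    exact ⟨_, this, by rw [Expr.cost_shift, Expr.cost_shift]; omega⟩
  | @rel d R args a i inp wk =>
    rcases R with R | R
    · have := Exec.rel (enum := enum) (L := L) R (fun j => (args j).shift) a i.shift
        (consInput c inp) wk
      simp only [Expr.eval_shift] at this
      exact ⟨_, this, by simp only [Expr.cost_shift]; omega⟩
    · exact isEmptyElim R
  | @func d f args a i inp wk =>
    rcases f with f | f
    · exact isEmptyElim f
    · cases d with
      | succ d =>
        exact isEmptyElim f
      | zero =>
        have := Exec.store (enum := enum) (L := L) a i.shift
          (.input 0 (.const (constantIndex (L := L) (k := k) (Sum.inr f)))) (consInput c inp) wk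
        rw [Expr.eval_shift] at this
        have hv : Expr.eval (consInput c inp) wk
            (.input 0 (.const (constantIndex (L := L) (k := k) (Sum.inr f)))) =
            funcAnswer (L := L[[Fin k]]) enum (Sum.inr f)
              fun j => (args j).eval inp wk := by
          simp only [funcAnswer]
          rw [dif_pos (fun j : Fin 0 => j.elim0)]
          exact hc f
        rw [hv] at this
        exact ⟨_, this, by simp only [Expr.cost_shift, Expr.cost]; omega⟩
  | seq _ _ ih1 ih2 =>
    obtain ⟨t1, e1, h1⟩ := ih1
    obtain ⟨t2, e2, h2⟩ := ih2
    exact ⟨_, Exec.seq e1 e2, by omega⟩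
  | ite_true hne _ ih =>
    obtain ⟨t1, e1, h1⟩ := ih
    exact ⟨_, Exec.ite_true (by rwa [Expr.eval_shift]) e1, by rw [Expr.cost_shift]; omega⟩
  | ite_false hne _ ih =>
    obtain ⟨t1, e1, h1⟩ := ih
    exact ⟨_, Exec.ite_false (by rwa [Expr.eval_shift]) e1, by rw [Expr.cost_shift]; omega⟩
  | while_true hne _ _ ih1 ih2 =>
    obtain ⟨t1, e1, h1⟩ := ih1
    obtain ⟨t2, e2, h2⟩ := ih2
    exact ⟨_, Exec.while_true (by rwa [Expr.eval_shift]) e1 e2, by rw [Expr.cost_shift]; omega⟩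
  | while_false hne =>
    exact ⟨_, Exec.while_false (by rwa [Expr.eval_shift]), by rw [Expr.cost_shift]; omega⟩
  | @call p ins outs inp wk res t _ ih =>
    obtain ⟨t1, e1, h1⟩ := ih
    rw [← passInputs_cons c inp wk ins] at e1
    exact ⟨_, Exec.call e1, by simp; omega⟩

end Constants

/-! ### Subprograms -/

section Subprograms

variable {L : FirstOrder.Language.{u, v}} {M : Type w} [L.Structure M] {n : ℕ}

/-- The program that composes the input arrays `1` and `2`, up to the length in cell `1` of the
input array `0`. -/
def Prog.gather : Prog L :=
  .for 1 (.input 0 (.const 1)) (.store 0 (.var 1) (.input 1 (.input 2 (.var 1))))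

theorem haltsWithin_gather (enum : Fin n ≃ M) {inp : Memory} {T : ℕ} (hT : 19 * inp 0 1 + 9 ≤ T) :
    HaltsWithin enum (Prog.gather : Prog L) inp T
      fun res => ∀ i < inp 0 1, res 0 i = inp 1 (inp 2 i) := by
  refine Runs.for (fun j wk => ∀ i < j, wk 0 i = inp 1 (inp 2 i)) (inp 0 1) 7 (by simp)
    (fun j wk x h => by simpa using h) (fun j wk _ => rfl) (fun j hj wk h hwj => ?_) ?_
  · refine Runs.store (by simp [Expr.cost]) ⟨by simpa using hwj, fun i hi => ?_⟩
    simp only [Expr.eval, Expr.eval_var, hwj, Memory.write_self]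
    by_cases hij : i = j
    · subst hij; simp
    · rw [Function.update_of_ne hij]
      exact h i (by omega)
  · simp only [Expr.cost]
    omega

/-- `tab (off x + w)` says whether `φ` holds of the elements with numbers `x` and `w`. -/
def IsTableOf (enum : Fin n ≃ M) (φ : L.Formula (Fin 2)) (tab off : ℕ → ℕ) : Prop :=
  ∀ x w : Fin n, (enum w ∈ nbhd φ (enum x) → tab (off x + w) = 1) ∧
    (enum w ∉ nbhd φ (enum x) → tab (off x + w) = 0)

/-- The program that computes the truth table of a formula decided by `p`. -/
def Prog.tabulate (p : Prog L) : Prog L :=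
  .for 2 (.input 0 (.const 0))
    (.seq (.store 1 (.var 2) (.var 5))
      (.for 3 (.input 0 (.const 0))
        (.seq (.store 4 (.const 0) (.var 2))
          (.seq (.store 4 (.const 1) (.var 3))
            (.seq (.call p [Sum.inl 0, Sum.inr 4] [6])
              (.seq (.store 0 (.var 5) (.var 6))
                (.store 5 (.const 0) (.add (.var 5) (.const 1)))))))))

theorem Nat.mul_add_unique {n x x' w w' : ℕ} (hw : w < n) (hw' : w' < n)
    (h : x' * n + w' = x * n + w) : x' = x ∧ w' = w := by
  rcases lt_trichotomy x' x with hx | hx | hx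
  · have := Nat.mul_le_mul_right n (Nat.succ_le_of_lt hx)
    rw [Nat.succ_mul] at this
    omega
  · subst hx
    exact ⟨rfl, by omega⟩
  · have := Nat.mul_le_mul_right n (Nat.succ_le_of_lt hx)
    rw [Nat.succ_mul] at this
    omega

/-- The machine cannot multiply, so a running counter in array `5` supplies the cell `x * n + w`,
and its value at the start of each row is recorded as the offset of that row. -/
theorem haltsWithin_tabulate (enum : Fin n ≃ M) {φ : L.Formula (Fin 2)} {p : Prog L} {F : ℕ}
    (hp : ∀ (a b : M) (inp : Memory), inp 0 0 = n → inp 1 0 = enum.symm a →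
      inp 1 1 = enum.symm b → HaltsWithin enum p inp F fun res =>
        (b ∈ nbhd φ a → res 0 0 = 1) ∧ (b ∉ nbhd φ a → res 0 0 = 0))
    {inp : Memory} (hn : inp 0 0 = n) {T : ℕ} (hT : n * (n * (F + 36) + 30) + 9 ≤ T) :
    HaltsWithin enum p.tabulate inp T fun res => IsTableOf enum φ (res 0) (res 1) := by
  let Spec : ℕ → ℕ → ℕ → Prop := fun x w y => ∀ (hx : x < n) (hw : w < n),
    (enum ⟨w, hw⟩ ∈ nbhd φ (enum ⟨x, hx⟩) → y = 1) ∧ (enum ⟨w, hw⟩ ∉ nbhd φ (enum ⟨x, hx⟩) → y = 0)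
  have main : Runs enum p.tabulate inp (fun _ _ => 0) T fun wk => wk 5 0 = n * n ∧
      (∀ x < n, wk 1 x = x * n) ∧
      ∀ x w, w < n → x * n + w < n * n → Spec x w (wk 0 (x * n + w)) := by
    refine Runs.for (fun j wk => wk 5 0 = j * n ∧ (∀ x < j, wk 1 x = x * n) ∧
      ∀ x w, w < n → x * n + w < j * n → Spec x w (wk 0 (x * n + w))) n
      (n * (F + 36) + 18) (by simp) (fun j wk x h => by simpa using h)
      (fun j wk _ => by simpa [Expr.eval] using hn) (fun x hx wk h hwx => ?_) ?_
    · obtain ⟨h5, h1, h0⟩ := h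
      have hstore : Runs enum (.store 1 (.var 2) (.var 5) : Prog L) inp wk 5
          fun wk' => wk' 2 0 = x ∧ wk' 5 0 = x * n ∧ (∀ x' ≤ x, wk' 1 x' = x' * n) ∧
            ∀ x' w', w' < n → x' * n + w' < x * n → Spec x' w' (wk' 0 (x' * n + w')) := by
        refine Runs.store (by simp) ⟨by simpa using hwx, by simpa using h5, fun x' hx' => ?_,
          by simpa using h0⟩
        simp only [Expr.eval_var, hwx, h5, Memory.write_self]
        by_cases hxx : x' = x
        · subst hxx; simp
        · rw [Function.update_of_ne hxx]
          exact h1 x' (by omega)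
      refine (hstore.seq (T' := n * (F + 36) + 9) fun wk hwk => ?_).mono (by omega) fun _ h => h
      refine (Runs.for (fun w wk => wk 2 0 = x ∧ wk 5 0 = x * n + w ∧
        (∀ x' ≤ x, wk 1 x' = x' * n) ∧
        ∀ x' w', w' < n → x' * n + w' < x * n + w → Spec x' w' (wk 0 (x' * n + w'))) n (F + 24)
        (by simpa using hwk) (fun j wk x h => by simpa using h)
        (fun j wk _ => by simpa [Expr.eval] using hn) (fun w hw wk h hww => ?_) ?_).mono le_rfl ?_
      · obtain ⟨h2, h5, h1, h0⟩ := h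
        have s1 : Runs enum (.store 4 (.const 0) (.var 2) : Prog L) inp wk 4
            fun wk' => wk' 4 0 = x ∧ wk' 3 0 = w ∧ wk' 2 0 = x ∧ wk' 5 0 = x * n + w ∧
              (∀ x' ≤ x, wk' 1 x' = x' * n) ∧
              ∀ x' w', w' < n → x' * n + w' < x * n + w → Spec x' w' (wk' 0 (x' * n + w')) :=
          Runs.store (by simp [Expr.cost]) (by simpa [Expr.eval, h2, h5, hww] using ⟨h1, h0⟩)
        refine (s1.seq (T' := F + 20) fun wk hwk => ?_).mono (by omega) fun _ h => h
        obtain ⟨h4, h3, h2, h5, h1, h0⟩ := hwk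
        have s2 : Runs enum (.store 4 (.const 1) (.var 3) : Prog L) inp wk 4
            fun wk' => wk' 4 0 = x ∧ wk' 4 1 = w ∧ wk' 3 0 = w ∧ wk' 2 0 = x ∧
              wk' 5 0 = x * n + w ∧ (∀ x' ≤ x, wk' 1 x' = x' * n) ∧
              ∀ x' w', w' < n → x' * n + w' < x * n + w → Spec x' w' (wk' 0 (x' * n + w')) :=
          Runs.store (by simp [Expr.cost])
            (by simpa [Expr.eval, h2, h3, h4, h5] using ⟨h1, h0⟩)
        refine (s2.seq (T' := F + 16) fun wk hwk => ?_).mono (by omega) fun _ h => h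
        obtain ⟨h4, h41, h3, h2, h5, h1, h0⟩ := hwk
        have s3 : Runs enum (.call p [Sum.inl 0, Sum.inr 4] [6] : Prog L) inp wk (F + 5)
            fun wk' => Spec x w (wk' 6 0) ∧ wk' 3 0 = w ∧ wk' 2 0 = x ∧
              wk' 5 0 = x * n + w ∧ (∀ x' ≤ x, wk' 1 x' = x' * n) ∧
              ∀ x' w', w' < n → x' * n + w' < x * n + w → Spec x' w' (wk' 0 (x' * n + w')) := by
          refine Runs.call (hp (enum ⟨x, hx⟩) (enum ⟨w, hw⟩) _ hn (h4.trans (by simp))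
            (h41.trans (by simp))) (fun res hres => ?_) (by simp; omega)
          exact ⟨fun _ _ => hres, h3, h2, h5, h1, h0⟩
        refine (s3.seq (T' := 11) fun wk hwk => ?_).mono (by omega) fun _ h => h
        obtain ⟨h6, h3, h2, h5, h1, h0⟩ := hwk
        have s4 : Runs enum (.store 0 (.var 5) (.var 6) : Prog L) inp wk 5
            fun wk' => wk' 3 0 = w ∧ wk' 2 0 = x ∧
              wk' 5 0 = x * n + w ∧ (∀ x' ≤ x, wk' 1 x' = x' * n) ∧
              ∀ x' w', w' < n → x' * n + w' < x * n + (w + 1) →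
                Spec x' w' (wk' 0 (x' * n + w')) := by
          refine Runs.store (by simp) ⟨by simpa using h3, by simpa using h2, by simpa using h5,
            by simpa using h1, fun x' w' hw' hlt => ?_⟩
          simp only [Expr.eval_var, h5, Memory.write_self]
          by_cases he : x' * n + w' = x * n + w
          · obtain ⟨rfl, rfl⟩ := Nat.mul_add_unique hw hw' he
            simpa using h6
          · rw [Function.update_of_ne he]
            exact h0 x' w' hw' (by omega)
        refine (s4.seq (T' := 6) fun wk hwk => ?_).mono (by omega) fun _ h => h
        obtain ⟨h3, h2, h5, h1, h0⟩ := hwk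
        refine Runs.store (by simp [Expr.cost]) ?_
        simp only [Expr.eval, Expr.eval_var, h5]
        exact ⟨by simpa using h3, by simpa using h2, by simp; omega, by simpa using h1,
          by simpa using h0⟩
      · simp only [Expr.cost]
        have : F + 24 + (1 + 1) + 10 = F + 36 := by omega
        rw [this]
      · rintro wk ⟨h2, h5, h1, h0⟩
        rw [Nat.succ_mul]
        exact ⟨h2, h5, fun x' hx' => h1 x' (by omega), h0⟩
    · simp only [Expr.cost]
      have : n * (F + 36) + 18 + (1 + 1) + 10 = n * (F + 36) + 30 := by omega
      rw [this]
      omega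
  refine main.mono le_rfl ?_
  rintro wk ⟨-, h1, h0⟩ x w
  rw [h1 x x.2]
  refine h0 x w w.2 ?_ x.2 w.2
  have := Nat.mul_le_mul_right n (Nat.succ_le_of_lt x.2)
  rw [Nat.succ_mul] at this
  have := w.2
  omega

end Subprograms

/-! ### Counting the tuples that a candidate would keep -/

section Measure

variable {L : FirstOrder.Language.{u, v}} {M : Type w} [L.Structure M] {n : ℕ}

/-- For the element `x` in input array `5`: the `i`-th sample element differs from `x` on an element
with owner `p`. -/
def Separates (inp : Memory) (i p : ℕ) : Prop :=
  ∃ w < inp 0 0, inp 1 w = p ∧ inp 2 (inp 3 (inp 5 0) + w) ≠ inp 2 (inp 3 (inp 4 i) + w)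

/-- The program that computes, for every owner `p`, the length of the initial segment of sample
elements that are separated from `x` (array `0`), and the number of owners of elements for which
all sample elements are separated from `x`, not counting the owner of `x` (array `1`). The input
consists of the number of elements and of sample elements, the array of owners, the table of the
formula and its row offsets, the sample elements, and `x`. -/
def Prog.measure : Prog L :=
  .seq
    (.for 2 (.input 0 (.const 1))
      (.for 3 (.input 0 (.const 0))
        (.ite (.ne (.work 0 (.input 1 (.var 3))) (.var 2)) .skip
          (.ite (.ne (.input 2 (.add (.input 3 (.input 5 (.const 0))) (.var 3)))
              (.input 2 (.add (.input 3 (.input 4 (.var 2))) (.var 3))))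
            (.store 0 (.input 1 (.var 3)) (.add (.var 2) (.const 1))) .skip))))
    (.for 3 (.input 0 (.const 0))
      (.ite (.input 1 (.var 3))
        (.ite (.ne (.input 1 (.var 3)) (.input 1 (.input 5 (.const 0))))
          (.ite (.ne (.work 0 (.input 1 (.var 3))) (.input 0 (.const 1))) .skip
            (.ite (.work 4 (.input 1 (.var 3))) .skip
              (.seq (.store 4 (.input 1 (.var 3)) (.const 1))
                (.store 1 (.const 0) (.add (.var 1) (.const 1)))))) .skip) .skip))

open Classical in
/-- The owners counted by `Prog.measure`. -/
noncomputable def countedOwners (inp : Memory) (N : ℕ) : Finset ℕ :=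
  ((Finset.range N).image (inp 1)).filter fun p =>
    p ≠ 0 ∧ p ≠ inp 1 (inp 5 0) ∧ ∀ i < inp 0 1, Separates inp i p

/-- Every owner stores a level that is raised from `i` to `i + 1` only when a witness against sample
`i` appears. One pass over the elements per sample therefore treats all owners simultaneously. -/
theorem runs_measure_levels (enum : Fin n ≃ M) (inp : Memory) :
    Runs enum (.for 2 (.input 0 (.const 1))
      (.for 3 (.input 0 (.const 0))
        (.ite (.ne (.work 0 (.input 1 (.var 3))) (.var 2)) .skip
          (.ite (.ne (.input 2 (.add (.input 3 (.input 5 (.const 0))) (.var 3)))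
              (.input 2 (.add (.input 3 (.input 4 (.var 2))) (.var 3))))
            (.store 0 (.input 1 (.var 3)) (.add (.var 2) (.const 1))) .skip))) : Prog L)
      inp (fun _ _ => 0) (inp 0 1 * (70 * inp 0 0 + 21) + 9) fun wk =>
        (wk 1 = fun _ => 0) ∧ (wk 4 = fun _ => 0) ∧
          ∀ p, wk 0 p ≤ inp 0 1 ∧ (wk 0 p = inp 0 1 ↔ ∀ i < inp 0 1, Separates inp i p) := by
  refine Runs.for (fun i wk => (wk 1 = fun _ => 0) ∧ (wk 4 = fun _ => 0) ∧
    ∀ p, wk 0 p ≤ i ∧ (wk 0 p = i ↔ ∀ i' < i, Separates inp i' p)) (inp 0 1) (70 * inp 0 0 + 9)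
    ⟨rfl, rfl, fun p => by simp⟩ (fun j wk x h => by simpa using h) (fun j wk _ => rfl)
    (fun i hi wk h hwi => ?_) (by simp [Expr.cost, Nat.add_assoc])
  obtain ⟨h1, h4, h0⟩ := h
  -- During pass `i` a level of at least `i` records success against all earlier samples, and level
  -- `i + 1` records in addition a witness among the elements scanned so far.
  refine (Runs.for (fun w wk => wk 2 0 = i ∧ (wk 1 = fun _ => 0) ∧ (wk 4 = fun _ => 0) ∧
    ∀ p, wk 0 p ≤ i + 1 ∧ (i ≤ wk 0 p ↔ ∀ i' < i, Separates inp i' p) ∧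
      (wk 0 p = i + 1 ↔ (∀ i' < i, Separates inp i' p) ∧ ∃ w' < w, inp 1 w' = p ∧
        inp 2 (inp 3 (inp 5 0) + w') ≠ inp 2 (inp 3 (inp 4 i) + w'))) (inp 0 0) 58
    ⟨hwi, h1, h4, fun p => ?_⟩ (fun j wk x h => by simpa using h) (fun j wk _ => rfl)
    (fun w hw wk h hww => ?_) (by simp [Expr.cost]; omega)).mono le_rfl ?_
  · obtain ⟨hp, hp'⟩ := h0 p
    refine ⟨by omega, ?_, ?_⟩
    · rw [← hp']; omega
    · simp; omega
  · obtain ⟨h2, h1, h4, h0⟩ := h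
    obtain ⟨hle, hge, heq⟩ := h0 (inp 1 w)
    refine Runs.ite (T := 42) (fun hne => Runs.skip (by omega) ⟨hww, h2, h1, h4, fun p => ?_⟩)
      (fun he => Runs.ite (T := 8) (fun hne => ?_) (fun he' => ?_) (by simp [Expr.cost]))
      (by simp [Expr.cost])
    · rw [Ne, Expr.eval_ne] at hne
      simp only [Expr.eval, Expr.eval_var, hww, h2] at hne
      refine ⟨(h0 p).1, (h0 p).2.1, (h0 p).2.2.trans (and_congr_right fun hall => ?_)⟩
      refine ⟨fun ⟨w', hw', h⟩ => ⟨w', by omega, h⟩, fun ⟨w', hw', hown, hd⟩ => ?_⟩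
      rcases Nat.lt_succ_iff_lt_or_eq.1 hw' with hlt | rfl
      · exact ⟨w', hlt, hown, hd⟩
      · subst hown
        have := hge.2 hall
        exact (heq.1 (by omega)).2
    · rw [Expr.eval_ne] at he
      rw [Ne, Expr.eval_ne] at hne
      simp only [Expr.eval, Expr.eval_var, hww, h2] at hne he
      have hall := hge.1 he.ge
      refine Runs.store (by simp [Expr.cost]) ⟨by simpa using hww, by simpa using h2,
        by simpa using h1, by simpa using h4, fun p => ?_⟩
      simp only [Expr.eval, Expr.eval_var, hww, h2, Memory.write_self]
      by_cases hp : p = inp 1 w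
      · subst hp
        simp only [Function.update_self, le_refl, Nat.le_add_right, true_iff, true_and]
        exact ⟨hall, hall, w, by omega, rfl, hne⟩
      · rw [Function.update_of_ne hp]
        refine ⟨(h0 p).1, (h0 p).2.1, (h0 p).2.2.trans (and_congr_right fun _ => ?_)⟩
        refine ⟨fun ⟨w', hw', h⟩ => ⟨w', by omega, h⟩, fun ⟨w', hw', hown, hd⟩ => ?_⟩
        rcases Nat.lt_succ_iff_lt_or_eq.1 hw' with hlt | rfl
        · exact ⟨w', hlt, hown, hd⟩
        · exact absurd hown.symm hp
    · rw [Expr.eval_ne] at he'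
      simp only [Expr.eval, Expr.eval_var, hww, h2] at he'
      refine Runs.skip (by omega) ⟨hww, h2, h1, h4, fun p => ?_⟩
      refine ⟨(h0 p).1, (h0 p).2.1, (h0 p).2.2.trans (and_congr_right fun _ => ?_)⟩
      refine ⟨fun ⟨w', hw', h⟩ => ⟨w', by omega, h⟩, fun ⟨w', hw', hown, hd⟩ => ?_⟩
      rcases Nat.lt_succ_iff_lt_or_eq.1 hw' with hlt | rfl
      · exact ⟨w', hlt, hown, hd⟩
      · exact absurd he' hd
  · rintro wk ⟨h2, h1, h4, h0⟩
    refine ⟨h2, h1, h4, fun p => ⟨(h0 p).1, (h0 p).2.2.trans ?_⟩⟩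
    rw [Nat.forall_lt_succ_right]
    rfl

/-- Full levels mark the owners that are separated from `x` by all samples. Array `4` flags the
owners already counted, so each contributes once however many elements it owns. -/
theorem haltsWithin_measure (enum : Fin n ≃ M) {inp : Memory} {T : ℕ}
    (hT : inp 0 1 * (70 * inp 0 0 + 21) + 64 * inp 0 0 + 18 ≤ T) :
    HaltsWithin enum (Prog.measure : Prog L) inp T fun res =>
      (∀ p, res 0 p = inp 0 1 ↔ ∀ i < inp 0 1, Separates inp i p) ∧
        res 1 0 = (countedOwners inp (inp 0 0)).card := by
  classical
  refine ((runs_measure_levels enum inp).seq (T' := 64 * inp 0 0 + 9) fun wk h => ?_).mono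
    (by omega) fun _ h => h
  obtain ⟨h1, h4, h0⟩ := h
  have hmem : ∀ N p, p ∈ countedOwners inp (N + 1) ↔ p ∈ countedOwners inp N ∨
      p = inp 1 N ∧ p ≠ 0 ∧ p ≠ inp 1 (inp 5 0) ∧ ∀ i < inp 0 1, Separates inp i p := by
    intro N p
    simp only [countedOwners, Finset.mem_filter, Finset.range_add_one, Finset.image_insert,
      Finset.mem_insert]
    tauto
  have hsame : ∀ N, (¬ (inp 1 N ≠ 0 ∧ inp 1 N ≠ inp 1 (inp 5 0) ∧
      ∀ i < inp 0 1, Separates inp i (inp 1 N)) ∨ inp 1 N ∈ countedOwners inp N) →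
      countedOwners inp (N + 1) = countedOwners inp N := by
    intro N h
    ext p
    rw [hmem]
    refine ⟨fun h' => h'.elim id ?_, Or.inl⟩
    rintro ⟨rfl, h'⟩
    exact h.elim (fun hn => absurd h' hn) id
  refine (Runs.for (fun w wk => (∀ p, wk 0 p = inp 0 1 ↔ ∀ i < inp 0 1, Separates inp i p) ∧
    wk 1 0 = (countedOwners inp w).card ∧ ∀ p, wk 4 p ≠ 0 ↔ p ∈ countedOwners inp w)
    (inp 0 0) 52 ⟨fun p => (h0 p).2, by simp [h1, countedOwners], by simp [h4, countedOwners]⟩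
    (fun j wk x h => by simpa using h) (fun j wk _ => rfl) (fun w hw wk h hww => ?_)
    (by simp [Expr.cost]; omega)).mono le_rfl fun _ h => ⟨h.1, h.2.1⟩
  obtain ⟨h0, h1, h4⟩ := h
  refine Runs.ite (T := 48) (fun c1 => Runs.ite (T := 32) (fun c2 => Runs.ite (T := 16)
    (fun c3 => ?_) (fun c3 => Runs.ite (T := 11) (fun c4 => ?_) (fun c4 => ?_)
      (by simp [Expr.cost])) (by simp [Expr.cost])) (fun c2 => ?_) (by simp [Expr.cost]))
    (fun c1 => ?_) (by simp [Expr.cost])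
  · rw [Ne, Expr.eval_ne] at c3
    simp only [Expr.eval, Expr.eval_var, hww] at c3
    refine Runs.skip (by omega) ⟨hww, h0, ?_⟩
    rw [hsame w (Or.inl fun h => c3 ((h0 _).2 h.2.2))]
    exact ⟨h1, h4⟩
  · simp only [Expr.eval, Expr.eval_var, hww] at c4
    refine Runs.skip (by omega) ⟨hww, h0, ?_⟩
    rw [hsame w (Or.inr ((h4 _).1 c4))]
    exact ⟨h1, h4⟩
  · rw [Ne, Expr.eval_ne] at c2
    rw [Expr.eval_ne] at c3
    simp only [Expr.eval, Expr.eval_var, hww] at c1 c2 c3 c4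
    have hnot : inp 1 w ∉ countedOwners inp w := fun h => (h4 _).2 h c4
    have heq : countedOwners inp (w + 1) = insert (inp 1 w) (countedOwners inp w) := by
      ext p
      rw [hmem, Finset.mem_insert]
      constructor
      · rintro (h | h)
        · exact Or.inr h
        · exact Or.inl h.1
      · rintro (rfl | h)
        · exact Or.inr ⟨rfl, c1, c2, (h0 _).1 c3⟩
        · exact Or.inl h
    have s1 : Runs enum (.store 4 (.input 1 (.var 3)) (.const 1) : Prog L) inp wk 5 fun wk' =>
        wk' 3 0 = w ∧ (∀ p, wk' 0 p = inp 0 1 ↔ ∀ i < inp 0 1, Separates inp i p) ∧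
          wk' 1 0 = (countedOwners inp w).card ∧
            ∀ p, wk' 4 p ≠ 0 ↔ p ∈ countedOwners inp (w + 1) := by
      refine Runs.store (by simp [Expr.cost]) ⟨by simpa using hww, by simpa using h0,
        by simpa using h1, fun p => ?_⟩
      simp only [Expr.eval, Expr.eval_var, hww, Memory.write_self, heq, Finset.mem_insert]
      by_cases hp : p = inp 1 w
      · subst hp; simp
      · rw [Function.update_of_ne hp, h4]
        simp [hp]
    refine (s1.seq (T' := 6) fun wk hwk => ?_).mono (by omega) fun _ h => h
    obtain ⟨h3, h0, h1, h4⟩ := hwk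
    refine Runs.store (by simp [Expr.cost]) ⟨by simpa using h3, by simpa using h0, ?_,
      by simpa using h4⟩
    rw [heq, Finset.card_insert_of_notMem hnot]
    simp [Expr.eval, h1]
  · rw [Expr.eval_ne] at c2
    simp only [Expr.eval, Expr.eval_var, hww] at c2
    refine Runs.skip (by omega) ⟨hww, h0, ?_⟩
    rw [hsame w (Or.inl fun h => h.2.1 c2)]
    exact ⟨h1, h4⟩
  · simp only [Expr.eval, Expr.eval_var, hww] at c1
    refine Runs.skip (by omega) ⟨hww, h0, ?_⟩
    rw [hsame w (Or.inl fun h => h.1 c1)]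
    exact ⟨h1, h4⟩

end Measure

/-! ### Searching for a new sample and listing the tuples that are kept -/

section Select

variable {L : FirstOrder.Language.{u, v}} {M : Type w} [L.Structure M] {n : ℕ}

/-- The program that tries to find a new sample element. The input consists of the numbers of
elements, of sample elements and of tuples, the array of owners, the table of the formula and its
row offsets, the sample elements, and the list of tuples. It returns the list of the tuples that are
kept, and the new sample element (increased by one, or `0` if there is none). -/
def Prog.select : Prog L :=
  let measure : Prog L :=
    .call .measure [Sum.inl 0, Sum.inr 3, Sum.inl 2, Sum.inl 3, Sum.inl 4, Sum.inr 4] [5, 6]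
  .seq
    (.for 7 (.input 0 (.const 2))
      (.store 2 (.add (.input 5 (.var 7)) (.const 1)) (.add (.var 7) (.const 1))))
    (.seq
      (.for 7 (.input 0 (.const 0)) (.store 3 (.var 7) (.work 2 (.input 1 (.var 7)))))
      (.seq
        (.store 1 (.const 0) (.sub (.const 1) (.input 0 (.const 1))))
        (.seq
          (.for 4 (.input 0 (.const 0))
            (.seq measure
              (.ite (.sub (.input 0 (.const 2)) (.add (.var 6) (.const 3))) .skip
                (.store 1 (.const 0) (.add (.var 4) (.const 1))))))
          (.ite (.var 1)
            (.seq (.store 4 (.const 0) (.sub (.var 1) (.const 1)))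
              (.seq measure
                (.for 7 (.input 0 (.const 2))
                  (.ite (.sub (.sub (.input 0 (.const 2)) (.const 3)) (.var 8))
                    (.ite (.ne (.work 5 (.add (.var 7) (.const 1))) (.input 0 (.const 1))) .skip
                      (.ite (.ne (.work 3 (.var 4)) (.add (.var 7) (.const 1)))
                        (.seq (.store 0 (.var 8) (.input 5 (.var 7)))
                          (.store 8 (.const 0) (.add (.var 8) (.const 1)))) .skip)) .skip))))
            (.for 7 (.sub (.input 0 (.const 2)) (.const 3))
              (.store 0 (.var 7) (.input 5 (.add (.var 7) (.const 1)))))))))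

/-- The `i`-th tuple of the list may be kept if `x` becomes a new sample element. -/
def KeepsIndex (inp : Memory) (x i : ℕ) : Prop :=
  inp 1 x ≠ inp 5 i + 1 ∧ ∀ i' < inp 0 1, ∃ w < inp 0 0, inp 1 w = inp 5 i + 1 ∧
    inp 2 (inp 3 x + w) ≠ inp 2 (inp 3 (inp 4 i') + w)

open Classical in
/-- The positions below `N` that may be kept. -/
noncomputable def keptIndices (inp : Memory) (x N : ℕ) : Finset ℕ :=
  (Finset.range N).filter (KeepsIndex inp x)

/-- `own w` is the position (increased by one) of the owner of `w` in the list of tuples. -/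
def IsCurrentOwner (inp : Memory) (own : ℕ → ℕ) : Prop :=
  ∀ w < inp 0 0, (∀ i < inp 0 2, own w = i + 1 ↔ inp 1 w = inp 5 i + 1) ∧ own w ≤ inp 0 2

theorem keepsIndex_iff {inp minp : Memory} (h0 : minp 0 = inp 0) (h1 : IsCurrentOwner inp (minp 1))
    (h2 : minp 2 = inp 2) (h3 : minp 3 = inp 3) (h4 : minp 4 = inp 4) (hx : minp 5 0 < inp 0 0)
    {i : ℕ} (hi : i < inp 0 2) :
    KeepsIndex inp (minp 5 0) i ↔
      minp 1 (minp 5 0) ≠ i + 1 ∧ ∀ i' < inp 0 1, Separates minp i' (i + 1) := by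
  simp only [KeepsIndex, Separates, h0, h2, h3, h4]
  rw [Ne, Ne, (h1 _ hx).1 i hi]
  refine and_congr_right fun _ => forall₂_congr fun i' _ => exists_congr fun w =>
    and_congr_right fun hw => ?_
  rw [(h1 w hw).1 i hi]

/-- Counting runs over elements, so tuples with empty neighborhood are missed. With at least one
sample a kept tuple contains a splitting element, and the count is exact. -/
theorem card_countedOwners {inp minp : Memory} (h0 : minp 0 = inp 0)
    (h1 : IsCurrentOwner inp (minp 1)) (h2 : minp 2 = inp 2) (h3 : minp 3 = inp 3)
    (h4 : minp 4 = inp 4) (hx : minp 5 0 < inp 0 0) :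
    (countedOwners minp (inp 0 0)).card ≤ (keptIndices inp (minp 5 0) (inp 0 2)).card ∧
      (1 ≤ inp 0 1 → (countedOwners minp (inp 0 0)).card =
        (keptIndices inp (minp 5 0) (inp 0 2)).card) := by
  classical
  have hk := fun {i} (hi : i < inp 0 2) => keepsIndex_iff h0 h1 h2 h3 h4 hx hi
  have hsub : countedOwners minp (inp 0 0) ⊆
      (keptIndices inp (minp 5 0) (inp 0 2)).image (· + 1) := by
    intro p hp
    simp only [countedOwners, Finset.mem_filter, Finset.mem_image, Finset.mem_range] at hp
    obtain ⟨⟨w, hw, rfl⟩, hne, hx', hs⟩ := hp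
    have hle := (h1 w hw).2
    obtain ⟨i, hi⟩ := Nat.exists_eq_succ_of_ne_zero hne
    rw [hi] at hle hx' hs ⊢
    rw [h0] at hs
    refine Finset.mem_image.2 ⟨i, Finset.mem_filter.2 ⟨Finset.mem_range.2 (by omega), ?_⟩, rfl⟩
    exact (hk (by omega)).2 ⟨fun h => hx' h.symm, hs⟩
  have himg : ((keptIndices inp (minp 5 0) (inp 0 2)).image (· + 1)).card =
      (keptIndices inp (minp 5 0) (inp 0 2)).card :=
    Finset.card_image_of_injective _ fun a b h => by simpa using h
  refine ⟨(Finset.card_le_card hsub).trans himg.le, fun hl => ?_⟩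
  rw [← himg]
  congr 1
  refine hsub.antisymm fun p hp => ?_
  obtain ⟨i, hi, rfl⟩ := Finset.mem_image.1 hp
  obtain ⟨hi, hki⟩ := Finset.mem_filter.1 hi
  rw [Finset.mem_range] at hi
  obtain ⟨hne, hs⟩ := (hk hi).1 hki
  obtain ⟨w, hw, hown, -⟩ := hs 0 (by omega)
  rw [h0] at hw
  refine Finset.mem_filter.2 ⟨Finset.mem_image.2 ⟨w, Finset.mem_range.2 hw, hown⟩, by simp,
    fun h => hne h.symm, by rwa [h0]⟩

/-- Inverting the list of positions turns owners in the original sequence into owners in the current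
one. Elements owned by discarded tuples read an untouched cell and get owner `0`. -/
theorem runs_select_owners (enum : Fin n ≃ M) {inp : Memory}
    (hinj : ∀ i < inp 0 2, ∀ j < inp 0 2, inp 5 i = inp 5 j → i = j) :
    Runs enum (.seq (.for 7 (.input 0 (.const 2))
      (.store 2 (.add (.input 5 (.var 7)) (.const 1)) (.add (.var 7) (.const 1))))
      (.for 7 (.input 0 (.const 0)) (.store 3 (.var 7) (.work 2 (.input 1 (.var 7))))) : Prog L)
      inp (fun _ _ => 0) (22 * inp 0 2 + 19 * inp 0 0 + 18) fun wk =>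
        IsCurrentOwner inp (wk 3) ∧ wk 8 0 = 0 := by
  have s1 : Runs enum (.for 7 (.input 0 (.const 2))
      (.store 2 (.add (.input 5 (.var 7)) (.const 1)) (.add (.var 7) (.const 1))) : Prog L)
      inp (fun _ _ => 0) (22 * inp 0 2 + 9) fun wk => wk 8 0 = 0 ∧ ∀ o, wk 2 o ≤ inp 0 2 ∧
        ∀ i < inp 0 2, wk 2 o = i + 1 ↔ o = inp 5 i + 1 := by
    refine (Runs.for (fun j wk => wk 8 0 = 0 ∧ ∀ o, (wk 2 o = 0 ∧ ∀ i < j, o ≠ inp 5 i + 1) ∨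
      ∃ i < j, o = inp 5 i + 1 ∧ wk 2 o = i + 1) (inp 0 2) 10 ⟨rfl, by simp⟩
      (fun j wk x h => by simpa using h) (fun j wk _ => rfl) (fun j hj wk h hwj => ?_)
      (by simp [Expr.cost]; omega)).mono le_rfl ?_
    · refine Runs.store (by simp [Expr.cost]) ⟨by simpa using hwj, by simpa using h.1,
        fun o => ?_⟩
      simp only [Expr.eval, Expr.eval_var, hwj, Memory.write_self]
      by_cases ho : o = inp 5 j + 1
      · subst ho
        exact Or.inr ⟨j, by omega, rfl, by simp⟩
      · rw [Function.update_of_ne ho]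
        rcases h.2 o with ⟨h1, h2⟩ | ⟨i, hi, h1, h2⟩
        · refine Or.inl ⟨h1, fun i hi => ?_⟩
          rcases Nat.lt_succ_iff_lt_or_eq.1 hi with hlt | rfl
          · exact h2 i hlt
          · exact ho
        · exact Or.inr ⟨i, by omega, h1, h2⟩
    · rintro wk ⟨h8, h⟩
      refine ⟨h8, fun o => ?_⟩
      rcases h o with ⟨h1, h2⟩ | ⟨i, hi, h1, h2⟩
      · refine ⟨by omega, fun i hi => ⟨fun h => by omega, fun h => absurd h (h2 i hi)⟩⟩
      · refine ⟨by omega, fun i' hi' => ⟨fun h => ?_, fun h => ?_⟩⟩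
        · obtain rfl : i = i' := by omega
          exact h1
        · rw [h2, hinj i hi i' hi' (by omega)]
  refine (s1.seq (T' := 19 * inp 0 0 + 9) fun wk h => ?_).mono (by omega) fun _ h => h
  obtain ⟨h8, h2⟩ := h
  refine (Runs.for (fun j wk => wk 8 0 = 0 ∧ (∀ o, wk 2 o ≤ inp 0 2 ∧
    ∀ i < inp 0 2, wk 2 o = i + 1 ↔ o = inp 5 i + 1) ∧ ∀ w < j, wk 3 w = wk 2 (inp 1 w))
    (inp 0 0) 7 ⟨h8, h2, by simp⟩ (fun j wk x h => by simpa using h) (fun j wk _ => rfl)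
    (fun j hj wk h hwj => ?_) (by simp [Expr.cost]; omega)).mono le_rfl ?_
  · obtain ⟨h8, h2, h3⟩ := h
    refine Runs.store (by simp [Expr.cost]) ⟨by simpa using hwj, by simpa using h8,
      by simpa using h2, fun w hw => ?_⟩
    simp only [Expr.eval, Expr.eval_var, hwj, Memory.write_self]
    by_cases hwj' : w = j
    · subst hwj'; simp
    · rw [Function.update_of_ne hwj']
      simpa using h3 w (by omega)
  · rintro wk ⟨h8, h2, h3⟩
    refine ⟨fun w hw => ?_, h8⟩
    rw [h3 w hw]
    exact ⟨(h2 _).2, (h2 _).1⟩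

/-- The time bound for one measurement. -/
def measureTime (n l : ℕ) : ℕ := l * (70 * n + 21) + 64 * n + 18

theorem runs_call_measure (enum : Fin n ≃ M) {inp wk : Memory} {own : ℕ → ℕ}
    (hown : IsCurrentOwner inp own) (h3 : wk 3 = own) (hx : wk 4 0 < inp 0 0) :
    Runs enum (.call .measure [Sum.inl 0, Sum.inr 3, Sum.inl 2, Sum.inl 3, Sum.inl 4, Sum.inr 4]
      [5, 6] : Prog L) inp wk (measureTime (inp 0 0) (inp 0 1) + 9) fun wk' =>
        (∀ a, a ≠ 5 → a ≠ 6 → wk' a = wk a) ∧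
        (∀ i < inp 0 2, KeepsIndex inp (wk 4 0) i ↔ wk' 5 (i + 1) = inp 0 1 ∧
          own (wk 4 0) ≠ i + 1) ∧
        wk' 6 0 ≤ (keptIndices inp (wk 4 0) (inp 0 2)).card ∧
        (1 ≤ inp 0 1 → wk' 6 0 = (keptIndices inp (wk 4 0) (inp 0 2)).card) := by
  set minp := passInputs inp wk
    [Sum.inl 0, Sum.inr 3, Sum.inl 2, Sum.inl 3, Sum.inl 4, Sum.inr 4] with hminp
  have e0 : minp 0 = inp 0 := rfl
  have e1 : minp 1 = own := h3
  have e2 : minp 2 = inp 2 := rfl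
  have e3 : minp 3 = inp 3 := rfl
  have e4 : minp 4 = inp 4 := rfl
  have e5 : minp 5 0 = wk 4 0 := rfl
  have hk := fun {i} (hi : i < inp 0 2) => keepsIndex_iff e0 (by rwa [e1]) e2 e3 e4 hx hi
  have hc := card_countedOwners e0 (by rwa [e1]) e2 e3 e4 hx
  rw [e5] at hk hc
  refine Runs.call (haltsWithin_measure enum (T := measureTime (inp 0 0) (inp 0 1)) le_rfl)
    (fun res hres => ?_) (by simp; omega)
  obtain ⟨r0, r1⟩ := hres
  rw [← hminp, e0] at r0 r1
  refine ⟨fun a h5 h6 => ?_, fun i hi => ?_, ?_, fun hl => ?_⟩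
  · simp [returnOutputs, h5, h6]
  · change _ ↔ res 0 (i + 1) = inp 0 1 ∧ _
    rw [hk hi, r0, e1, and_comm]
  · change res 1 0 ≤ _
    rw [r1]
    exact hc.1
  · change res 1 0 = _
    rw [r1]
    exact hc.2 hl

/-- The result is stored increased by one, so `0` means failure. Its initial value `1 - l` names the
element `0` exactly when there are no samples, because the count may then be too small. -/
theorem runs_select_search (enum : Fin n ≃ M) {inp wk : Memory} (hn : 0 < inp 0 0)
    (hm : 3 ≤ inp 0 2)
    (hinj : ∀ i < inp 0 2, ∀ j < inp 0 2, inp 5 i = inp 5 j → i = j)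
    (hown : IsCurrentOwner inp (wk 3)) (h8 : wk 8 0 = 0) :
    Runs enum (.seq (.store 1 (.const 0) (.sub (.const 1) (.input 0 (.const 1))))
      (.for 4 (.input 0 (.const 0))
        (.seq (.call .measure
            [Sum.inl 0, Sum.inr 3, Sum.inl 2, Sum.inl 3, Sum.inl 4, Sum.inr 4] [5, 6])
          (.ite (.sub (.input 0 (.const 2)) (.add (.var 6) (.const 3))) .skip
            (.store 1 (.const 0) (.add (.var 4) (.const 1)))))) : Prog L)
      inp wk (inp 0 0 * (measureTime (inp 0 0) (inp 0 1) + 35) + 15) fun wk' =>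
        IsCurrentOwner inp (wk' 3) ∧ wk' 8 0 = 0 ∧
        (wk' 1 0 = 0 → 1 ≤ inp 0 1 ∧
          ∀ x < inp 0 0, (keptIndices inp x (inp 0 2)).card < inp 0 2 - 3) ∧
        (wk' 1 0 ≠ 0 → ∃ x < inp 0 0, wk' 1 0 = x + 1 ∧
          inp 0 2 - 3 ≤ (keptIndices inp x (inp 0 2)).card) := by
  classical
  -- With no samples the only obstruction is membership, and the element `0` has at most one owner.
  have hzero : inp 0 1 = 0 → inp 0 2 - 3 ≤ (keptIndices inp 0 (inp 0 2)).card := by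
    intro hl
    have hle : ((Finset.range (inp 0 2)).filter fun i => inp 1 0 = inp 5 i + 1).card ≤ 1 := by
      rw [Finset.card_le_one]
      intro a ha b hb
      rw [Finset.mem_filter, Finset.mem_range] at ha hb
      exact hinj a ha.1 b hb.1 (by omega)
    have hadd := Finset.card_filter_add_card_filter_not (s := Finset.range (inp 0 2))
      (fun i => inp 1 0 = inp 5 i + 1)
    have hsub : (Finset.range (inp 0 2)).filter (fun i => ¬ inp 1 0 = inp 5 i + 1) ⊆
        keptIndices inp 0 (inp 0 2) := by
      intro i hi
      rw [Finset.mem_filter] at hi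
      exact Finset.mem_filter.2 ⟨hi.1, hi.2, fun i' hi' => absurd hi' (by omega)⟩
    have := Finset.card_le_card hsub
    rw [Finset.card_range] at hadd
    omega
  have s1 : Runs enum (.store 1 (.const 0) (.sub (.const 1) (.input 0 (.const 1))) : Prog L) inp wk
      6 fun wk' => wk' 3 = wk 3 ∧ wk' 8 0 = 0 ∧ wk' 1 0 = 1 - inp 0 1 :=
    Runs.store (by simp [Expr.cost]) (by simp [Expr.eval, h8])
  refine (s1.seq (T' := inp 0 0 * (measureTime (inp 0 0) (inp 0 1) + 35) + 9) fun wk1 h => ?_).mono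
    (by omega) fun _ h => h
  obtain ⟨h3, h8, h1⟩ := h
  refine (Runs.for (fun j wk' => wk' 3 = wk 3 ∧ wk' 8 0 = 0 ∧
    (wk' 1 0 = 0 → 1 ≤ inp 0 1 ∧
      ∀ x < j, (keptIndices inp x (inp 0 2)).card < inp 0 2 - 3) ∧
    (wk' 1 0 ≠ 0 → ∃ x < inp 0 0, wk' 1 0 = x + 1 ∧
      inp 0 2 - 3 ≤ (keptIndices inp x (inp 0 2)).card)) (inp 0 0)
    (measureTime (inp 0 0) (inp 0 1) + 23)
    ⟨h3, h8, fun h => ⟨by omega, by simp⟩, fun h => ⟨0, hn, by omega, hzero (by omega)⟩⟩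
    (fun j wk x h => by simpa using h) (fun j wk _ => rfl) (fun x hx wk2 h hwx => ?_)
    (by simp [Expr.cost])).mono le_rfl fun wk' h => ⟨by rw [h.1]; exact hown, h.2⟩
  obtain ⟨h3, h8, hz, hs⟩ := h
  refine ((runs_call_measure enum hown h3 (by omega)).seq (T' := 14) fun wk3 h => ?_).mono
    (by omega) fun _ h => h
  obtain ⟨hframe, -, hle, heq⟩ := h
  rw [hwx] at hle heq
  have f1 := hframe 1 (by simp) (by simp)
  have f3 := hframe 3 (by simp) (by simp)
  have f4 := hframe 4 (by simp) (by simp)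
  have f8 := hframe 8 (by simp) (by simp)
  refine Runs.ite (T := 6) (fun hne => Runs.skip (by omega) ?_)
    (fun he => Runs.store (by simp [Expr.cost]) ?_) (by simp [Expr.cost])
  · simp only [Expr.eval, Expr.eval_var] at hne
    refine ⟨by rw [f4, hwx], by rw [f3, h3], by rw [f8, h8], ?_, by rw [f1]; exact hs⟩
    rw [f1]
    intro h0
    obtain ⟨hl, hall⟩ := hz h0
    refine ⟨hl, fun x' hx' => ?_⟩
    rcases Nat.lt_succ_iff_lt_or_eq.1 hx' with hlt | rfl
    · exact hall x' hlt
    · rw [← heq hl]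
      omega
  · simp only [Expr.eval, Expr.eval_var] at he
    simp only [Expr.eval, Expr.eval_var, f4, hwx]
    refine ⟨by simp [f4, hwx], by simp [f3, h3], by simp [f8, h8], by simp, fun _ => ⟨x, hx, ?_⟩⟩
    simp
    omega

/-- The levels computed for the chosen element were overwritten by later candidates, so they are
measured anew. The scan then collects kept positions in increasing order until exactly three fewer
than the available number have been found. -/
theorem runs_select_found (enum : Fin n ≃ M) {inp wk : Memory} {x : ℕ} (hx : x < inp 0 0)
    (hown : IsCurrentOwner inp (wk 3)) (h8 : wk 8 0 = 0) (h1 : wk 1 0 = x + 1)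
    (hcard : inp 0 2 - 3 ≤ (keptIndices inp x (inp 0 2)).card) :
    Runs enum (.seq (.store 4 (.const 0) (.sub (.var 1) (.const 1)))
      (.seq (.call .measure
          [Sum.inl 0, Sum.inr 3, Sum.inl 2, Sum.inl 3, Sum.inl 4, Sum.inr 4] [5, 6])
        (.for 7 (.input 0 (.const 2))
          (.ite (.sub (.sub (.input 0 (.const 2)) (.const 3)) (.var 8))
            (.ite (.ne (.work 5 (.add (.var 7) (.const 1))) (.input 0 (.const 1))) .skip
              (.ite (.ne (.work 3 (.var 4)) (.add (.var 7) (.const 1)))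
                (.seq (.store 0 (.var 8) (.input 5 (.var 7)))
                  (.store 8 (.const 0) (.add (.var 8) (.const 1)))) .skip)) .skip))) : Prog L)
      inp wk (measureTime (inp 0 0) (inp 0 1) + 68 * inp 0 2 + 24) fun wk' =>
        wk' 1 0 = x + 1 ∧ ∃ g : ℕ → ℕ,
          (∀ j < inp 0 2 - 3, g j < inp 0 2 ∧ KeepsIndex inp x (g j) ∧ wk' 0 j = inp 5 (g j)) ∧
          ∀ j j', j < j' → j' < inp 0 2 - 3 → g j < g j' := by
  classical
  have s1 : Runs enum (.store 4 (.const 0) (.sub (.var 1) (.const 1)) : Prog L) inp wk 6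
      fun wk' => wk' 3 = wk 3 ∧ wk' 8 0 = 0 ∧ wk' 1 0 = x + 1 ∧ wk' 4 0 = x :=
    Runs.store (by simp [Expr.cost]) (by simp [Expr.eval, h8, h1])
  refine (s1.seq (T' := measureTime (inp 0 0) (inp 0 1) + 9 + (68 * inp 0 2 + 9))
    fun wk1 h => ?_).mono (by omega) fun _ h => h
  obtain ⟨g3, g8, g1, g4⟩ := h
  refine (runs_call_measure enum hown g3 (by omega)).seq fun wk2 h => ?_
  obtain ⟨hframe, hkeep, -, -⟩ := h
  rw [g4] at hkeep
  have f1 := hframe 1 (by simp) (by simp)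
  have f3 := hframe 3 (by simp) (by simp)
  have f4 := hframe 4 (by simp) (by simp)
  have f8 := hframe 8 (by simp) (by simp)
  have hsucc : ∀ i, keptIndices inp x (i + 1) =
      if KeepsIndex inp x i then insert i (keptIndices inp x i) else keptIndices inp x i := by
    intro i
    simp only [keptIndices, Finset.range_add_one, Finset.filter_insert]
  have hnot : ∀ i, i ∉ keptIndices inp x i := by
    intro i h
    simp [keptIndices] at h
  refine (Runs.for (fun i wk' => wk' 1 0 = x + 1 ∧ wk' 3 = wk 3 ∧ wk' 4 0 = x ∧ wk' 5 = wk2 5 ∧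
    wk' 8 0 = min (inp 0 2 - 3) (keptIndices inp x i).card ∧ ∃ g : ℕ → ℕ,
      (∀ j < wk' 8 0, g j < i ∧ KeepsIndex inp x (g j) ∧ wk' 0 j = inp 5 (g j)) ∧
      ∀ j j', j < j' → j' < wk' 8 0 → g j < g j') (inp 0 2) 56
    ⟨by rw [f1, g1], by rw [f3, g3], by rw [f4, g4], rfl, by rw [f8, g8]; simp [keptIndices],
      id, by rw [f8, g8]; simp⟩
    (fun j wk x h => by simpa using h) (fun j wk _ => rfl) (fun i hi wk3 h hwi => ?_)
    (by simp [Expr.cost]; omega)).mono le_rfl ?_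
  · obtain ⟨k1, k3, k4, k5, k8, g, hg, hmono⟩ := h
    have hold : wk3 8 0 = min (inp 0 2 - 3) (keptIndices inp x (i + 1)).card →
        Runs enum (.skip : Prog L) inp wk3 1 fun wk' => wk' 7 0 = i ∧ wk' 1 0 = x + 1 ∧
          wk' 3 = wk 3 ∧ wk' 4 0 = x ∧ wk' 5 = wk2 5 ∧
          wk' 8 0 = min (inp 0 2 - 3) (keptIndices inp x (i + 1)).card ∧ ∃ g : ℕ → ℕ,
            (∀ j < wk' 8 0, g j < i + 1 ∧ KeepsIndex inp x (g j) ∧ wk' 0 j = inp 5 (g j)) ∧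
            ∀ j j', j < j' → j' < wk' 8 0 → g j < g j' := fun h8 =>
      Runs.skip le_rfl ⟨hwi, k1, k3, k4, k5, h8, g,
        fun j hj => ⟨by have := (hg j hj).1; omega, (hg j hj).2⟩, hmono⟩
    refine Runs.ite (T := 48) (fun c1 => Runs.ite (T := 30) (fun c2 => ?_)
      (fun c2 => Runs.ite (T := 12) (fun c3 => ?_) (fun c3 => ?_) (by simp [Expr.cost]))
      (by simp [Expr.cost])) (fun c1 => ?_) (by simp [Expr.cost])
    · rw [Ne, Expr.eval_ne] at c2
      simp only [Expr.eval, Expr.eval_var, hwi, k5] at c2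
      refine (hold ?_).mono (by omega) fun _ h => h
      rw [hsucc, if_neg (fun h => c2 ((hkeep i hi).1 h).1), k8]
    · rw [Ne, Expr.eval_ne] at c3
      rw [Expr.eval_ne] at c2
      simp only [Expr.eval, Expr.eval_var, hwi, k5, k4, k3] at c1 c2 c3
      have hki : KeepsIndex inp x i := (hkeep i hi).2 ⟨c2, c3⟩
      have s2 : Runs enum (.store 0 (.var 8) (.input 5 (.var 7)) : Prog L) inp wk3 6 fun wk' =>
          wk' 7 0 = i ∧ wk' 1 0 = x + 1 ∧ wk' 3 = wk 3 ∧ wk' 4 0 = x ∧ wk' 5 = wk2 5 ∧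
          wk' 8 0 = wk3 8 0 ∧ wk' 0 = Function.update (wk3 0) (wk3 8 0) (inp 5 i) :=
        Runs.store (by simp [Expr.cost]) (by simp [Expr.eval, hwi, k1, k3, k4, k5])
      refine (s2.seq (T' := 6) fun wk4 h => ?_).mono (by omega) fun _ h => h
      obtain ⟨m7, m1, m3, m4, m5, m8, m0⟩ := h
      refine Runs.store (by simp [Expr.cost]) ?_
      have e8 : (wk4.write 8 0 (wk3 8 0 + 1)) 8 0 = wk3 8 0 + 1 := by simp
      simp only [Expr.eval, Expr.eval_var, m8, e8]
      refine ⟨by simpa using m7, by simpa using m1, by simpa using m3, by simpa using m4,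
        by simpa using m5, ?_, fun j => if j = wk3 8 0 then i else g j, fun j hj => ?_,
        fun j j' hjj hj' => ?_⟩
      · rw [hsucc, if_pos hki, Finset.card_insert_of_notMem (hnot i)]
        omega
      · rw [Memory.write_of_ne _ _ _ (by simp), m0]
        simp only
        by_cases hj8 : j = wk3 8 0
        · subst hj8
          simp [hki]
        · rw [if_neg hj8, Function.update_of_ne hj8]
          have := hg j (by omega)
          exact ⟨by omega, this.2⟩
      · simp only
        rw [if_neg (by omega)]
        split_ifs with h
        · exact (hg j (by omega)).1
        · exact hmono j j' hjj (by omega)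
    · rw [Expr.eval_ne] at c3
      simp only [Expr.eval, Expr.eval_var, hwi, k4, k3] at c3
      refine (hold ?_).mono (by omega) fun _ h => h
      rw [hsucc, if_neg (fun h => ((hkeep i hi).1 h).2 c3), k8]
    · simp only [Expr.eval, Expr.eval_var] at c1
      refine (hold ?_).mono (by omega) fun _ h => h
      have hle : (keptIndices inp x i).card ≤ (keptIndices inp x (i + 1)).card := by
        refine Finset.card_le_card (Finset.filter_subset_filter _ ?_)
        exact Finset.range_mono (Nat.le_succ i)
      omega
  · rintro wk' ⟨k1, k3, k4, k5, k8, g, hg, hmono⟩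
    rw [Nat.min_eq_left hcard] at k8
    rw [k8] at hg hmono
    exact ⟨k1, g, hg, hmono⟩

/-- The time bound for `Prog.select`. -/
def selectTime (n l m : ℕ) : ℕ :=
  90 * m + 54 * n + (n + 1) * measureTime n l + 60

theorem haltsWithin_select (enum : Fin n ≃ M) {inp : Memory} (hn : 0 < inp 0 0) (hm : 3 ≤ inp 0 2)
    (hinj : ∀ i < inp 0 2, ∀ j < inp 0 2, inp 5 i = inp 5 j → i = j) :
    HaltsWithin enum (Prog.select : Prog L) inp (selectTime (inp 0 0) (inp 0 1) (inp 0 2))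
      fun res =>
        (∃ x < inp 0 0, res 1 0 = x + 1 ∧ ∃ g : ℕ → ℕ,
          (∀ j < inp 0 2 - 3, g j < inp 0 2 ∧ KeepsIndex inp x (g j) ∧ res 0 j = inp 5 (g j)) ∧
          ∀ j j', j < j' → j' < inp 0 2 - 3 → g j < g j') ∨
        (1 ≤ inp 0 1 ∧ res 1 0 = 0 ∧ (∀ j < inp 0 2 - 3, res 0 j = inp 5 (j + 1)) ∧
          ∀ x < inp 0 0, (keptIndices inp x (inp 0 2)).card < inp 0 2 - 3) := by
  -- The phases were analysed with a different bracketing of sequential composition; regrouping does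
  -- not affect the time.
  have hassoc : ∀ {p q s : Prog L} {wk : Memory} {T : ℕ} {Q : Memory → Prop},
      Runs enum (.seq (.seq p q) s) inp wk T Q → Runs enum (.seq p (.seq q s)) inp wk T Q := by
    rintro p q s wk T Q ⟨t, wk', h, ht, hq⟩
    cases h with
    | seq h1 h2 =>
      cases h1 with
      | seq h3 h4 => exact ⟨_, _, Exec.seq h3 (Exec.seq h4 h2), by omega, hq⟩
  refine hassoc (((runs_select_owners enum hinj).seq
    (T' := inp 0 0 * (measureTime (inp 0 0) (inp 0 1) + 35) + 15 +
      (measureTime (inp 0 0) (inp 0 1) + 68 * inp 0 2 + 27)) fun wk h => hassoc ?_).mono ?_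
    fun _ h => h)
  · obtain ⟨hown, h8⟩ := h
    refine (runs_select_search enum hn hm hinj hown h8).seq fun wk1 h => ?_
    obtain ⟨hown, h8, hz, hs⟩ := h
    refine Runs.ite (T := measureTime (inp 0 0) (inp 0 1) + 68 * inp 0 2 + 24) (fun hne => ?_)
      (fun he => ?_) (by simp; omega)
    · obtain ⟨x, hx, h1, hc⟩ := hs hne
      refine (runs_select_found enum hx hown h8 h1 hc).mono le_rfl fun wk' h => ?_
      exact Or.inl ⟨x, hx, h⟩
    · obtain ⟨hl, hall⟩ := hz he
      refine (Runs.for (fun j wk => wk 1 0 = 0 ∧ ∀ i < j, wk 0 i = inp 5 (i + 1)) (inp 0 2 - 3) 8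
        ⟨he, by simp⟩ (fun j wk x h => by simpa using h) (fun j wk _ => rfl)
        (fun j hj wk h hwj => ?_) (by simp [Expr.cost]; omega)).mono le_rfl fun wk' h =>
          Or.inr ⟨hl, h.1, h.2, hall⟩
      refine Runs.store (by simp [Expr.cost]) ⟨by simpa using hwj, by simpa using h.1,
        fun i hi => ?_⟩
      simp only [Expr.eval, Expr.eval_var, hwj, Memory.write_self]
      by_cases hij : i = j
      · subst hij; simp
      · rw [Function.update_of_ne hij]
        exact h.2 i (by omega)
  · simp only [selectTime]
    rw [Nat.mul_add, Nat.add_mul]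
    omega

end Select

/-! ### From numerical arrays back to a step of the construction -/

section Step

variable {L : FirstOrder.Language.{u, v}} {M : Type w} [L.Structure M] {n r : ℕ}

/-- The converse direction holds because different owners have different codes and the code of
having no owner is `0`. -/
theorem EncodesNbhds.eq_iff {enum : Fin n ≃ M} {α : L.Formula (Fin r ⊕ Unit)} {N : ℕ}
    {J : Fin N → Fin r → M} {inp : Memory} (h : EncodesNbhds enum α J inp) (a : M) (i : Fin N) :
    inp (r + 1) (enum.symm a) = i + 1 ↔ a ∈ tupleNbhd α (J i) := by
  refine ⟨fun he => ?_, (h a).1 i⟩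
  by_contra hi
  by_cases hex : ∃ i', a ∈ tupleNbhd α (J i')
  · obtain ⟨i', hi'⟩ := hex
    have := (h a).1 i' hi'
    obtain rfl : i = i' := Fin.ext (by omega)
    exact hi hi'
  · have := (h a).2 fun i' hi' => hex ⟨i', hi'⟩
    omega

theorem IsTableOf.ne_iff {enum : Fin n ≃ M} {φ : L.Formula (Fin 2)} {tab off : ℕ → ℕ}
    (h : IsTableOf enum φ tab off) (x y w : M) :
    tab (off (enum.symm x) + enum.symm w) ≠ tab (off (enum.symm y) + enum.symm w) ↔
      ¬ (w ∈ nbhd φ x ↔ w ∈ nbhd φ y) := by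
  have hx := h (enum.symm x) (enum.symm w)
  have hy := h (enum.symm y) (enum.symm w)
  simp only [Equiv.apply_symm_apply] at hx hy
  by_cases h1 : w ∈ nbhd φ x <;> by_cases h2 : w ∈ nbhd φ y
  · simp [hx.1 h1, hy.1 h2, h1, h2]
  · simp [hx.1 h1, hy.2 h2, h1, h2]
  · simp [hx.2 h1, hy.1 h2, h1, h2]
  · simp [hx.2 h1, hy.2 h2, h1, h2]

theorem keepsIndex_iff_keeps {enum : Fin n ≃ M} {φ : L.Formula (Fin 2)}
    {α : L.Formula (Fin r ⊕ Unit)} {k l m N : ℕ} (hl : l ≤ k) {σ : Fin k → M}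
    {J : Fin N → Fin r → M} {e : Fin m ↪o Fin N} {inp : Memory} (h0 : inp 0 0 = n)
    (h1 : inp 0 1 = l)
    (hown : ∀ a (i : Fin N), inp 1 (enum.symm a) = i + 1 ↔ a ∈ tupleNbhd α (J i))
    (htab : IsTableOf enum φ (inp 2) (inp 3)) (hcst : ∀ i : Fin k, inp 4 i = enum.symm (σ i))
    (hpos : ∀ i : Fin m, inp 5 i = e i) (x : M) (i : Fin m) :
    KeepsIndex inp (enum.symm x) i ↔ Keeps φ α σ l (J ∘ e) x i := by
  simp only [KeepsIndex, Keeps, hpos, h0, h1, Ne, hown, Function.comp_apply]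
  refine and_congr_right fun _ => ⟨fun h i' hi' => ?_, fun h i' hi' => ?_⟩
  · obtain ⟨w, hw, how, hne⟩ := h i' hi'
    have hw' : w = (enum.symm (enum ⟨w, hw⟩) : ℕ) := by simp
    rw [hw', hown] at how
    rw [hw', hcst i'] at hne
    exact ⟨_, how, (htab.ne_iff _ _ _).1 hne⟩
  · obtain ⟨w, hw, hne⟩ := h ⟨i', by omega⟩ hi'
    refine ⟨enum.symm w, (enum.symm w).2, (hown _ _).2 hw, ?_⟩
    rw [hcst ⟨i', by omega⟩]
    exact (htab.ne_iff _ _ _).2 hne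

/-- Success of the search is a new sample with its kept tuples. Failure bounds the number of kept
tuples for every element, which rules out any embedding of length `m'`. -/
theorem exists_isStep_of_select {enum : Fin n ≃ M} {φ : L.Formula (Fin 2)}
    {α : L.Formula (Fin r ⊕ Unit)} {k l m m' N : ℕ} (hl : l ≤ k) {σ : Fin k → M}
    {J : Fin N → Fin r → M} {e : Fin m ↪o Fin N} (hm : m = m' + 3) {inp res : Memory}
    (h0 : inp 0 0 = n) (h1 : inp 0 1 = l) (h2 : inp 0 2 = m)
    (hown : ∀ a (i : Fin N), inp 1 (enum.symm a) = i + 1 ↔ a ∈ tupleNbhd α (J i))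
    (htab : IsTableOf enum φ (inp 2) (inp 3)) (hcst : ∀ i : Fin k, inp 4 i = enum.symm (σ i))
    (hpos : ∀ i : Fin m, inp 5 i = e i)
    (hres : (∃ x < inp 0 0, res 1 0 = x + 1 ∧ ∃ g : ℕ → ℕ,
        (∀ j < inp 0 2 - 3, g j < inp 0 2 ∧ KeepsIndex inp x (g j) ∧ res 0 j = inp 5 (g j)) ∧
        ∀ j j', j < j' → j' < inp 0 2 - 3 → g j < g j') ∨
      (1 ≤ inp 0 1 ∧ res 1 0 = 0 ∧ (∀ j < inp 0 2 - 3, res 0 j = inp 5 (j + 1)) ∧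
        ∀ x < inp 0 0, (keptIndices inp x (inp 0 2)).card < inp 0 2 - 3)) :
    ∃ (σ' : Fin k → M) (l' : ℕ) (e' : Fin m' ↪o Fin m), IsStep φ α σ l (J ∘ e) σ' l' e' ∧
      (∀ i : Fin m', res 0 i = e (e' i)) ∧ ((res 1 0 = 0 ∧ l' = l ∧ σ' = σ) ∨
        ∃ x, res 1 0 = enum.symm x + 1 ∧ l' = l + 1 ∧ σ' = fun i => if i.1 < l then σ i else x) := by
  classical
  have hk := keepsIndex_iff_keeps hl h0 h1 hown htab hcst hpos
  subst hm
  have h3 : inp 0 2 - 3 = m' := by omega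
  rw [h3, h0, h1, h2] at hres
  rcases hres with ⟨x, hx, hr1, g, hg, hmono⟩ | ⟨hl1, hr1, hr0, hcard⟩
  · have hx' : x = (enum.symm (enum ⟨x, hx⟩) : ℕ) := by simp
    refine ⟨_, _, OrderEmbedding.ofStrictMono (fun j : Fin m' => ⟨g j, (hg j j.2).1⟩)
      fun j j' hjj => hmono j j' hjj j'.2, Or.inl ⟨enum ⟨x, hx⟩, fun i => ?_, rfl, fun i => rfl⟩,
      fun i => ?_, Or.inr ⟨enum ⟨x, hx⟩, by rw [← hx', hr1], rfl, rfl⟩⟩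
    · rw [← hk, ← hx']
      exact (hg i i.2).2.1
    · rw [(hg i i.2).2.2, ← hpos]
      rfl
  · refine ⟨_, _, OrderEmbedding.ofStrictMono (fun j : Fin m' => ⟨j + 1, by omega⟩)
      fun j j' hjj => Nat.succ_lt_succ hjj,
      Or.inr ⟨hl1, rfl, rfl, fun i => rfl, fun x => ?_⟩, fun i => ?_, Or.inl ⟨hr1, rfl, rfl⟩⟩
    · rintro ⟨e', he'⟩
      refine absurd (hcard _ (enum.symm x).2) (not_lt.2 ?_)
      have hsub : Finset.univ.image (fun i => (e' i : ℕ)) ⊆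
          keptIndices inp (enum.symm x) (m' + 3) := by
        intro y hy
        obtain ⟨i, -, rfl⟩ := Finset.mem_image.1 hy
        exact Finset.mem_filter.2 ⟨Finset.mem_range.2 (e' i).2, (hk x _).2 (he' i)⟩
      have hc := Finset.card_le_card hsub
      rw [Finset.card_image_of_injective _ fun a b h => e'.injective (Fin.ext h)] at hc
      simpa using hc
    · rw [hr0 i i.2, ← hpos]
      rfl

/-- The program that adds the element in the input array `2` (increased by one, `0` if there is
none) to the list of sample elements in the input array `1`. -/
def Prog.update (k : ℕ) : Prog L :=
  .seq (.store 1 (.const 0)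
      (.add (.input 0 (.const 1)) (.sub (.const 1) (.sub (.const 1) (.input 2 (.const 0))))))
    (.for 2 (.const k)
      (.ite (.add (.sub (.const 1) (.input 2 (.const 0))) (.sub (.input 0 (.const 1)) (.var 2)))
        (.store 0 (.var 2) (.input 1 (.var 2)))
        (.store 0 (.var 2) (.sub (.input 2 (.const 0)) (.const 1)))))

/-- Truncated subtraction provides the case distinctions: `1 - (1 - v)` is the indicator of `v ≠ 0`.
A new sample fills all cells from the current count onwards, which realises the padding of the
constants. -/
theorem haltsWithin_update (enum : Fin n ≃ M) {inp : Memory} {k T : ℕ} (hT : 30 * k + 20 ≤ T) :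
    HaltsWithin enum (Prog.update k : Prog L) inp T fun res =>
      res 1 0 = (if inp 2 0 = 0 then inp 0 1 else inp 0 1 + 1) ∧
        ∀ i < k, res 0 i = if inp 2 0 = 0 ∨ i < inp 0 1 then inp 1 i else inp 2 0 - 1 := by
  have s1 : Runs enum (.store 1 (.const 0)
      (.add (.input 0 (.const 1)) (.sub (.const 1) (.sub (.const 1) (.input 2 (.const 0))))) : Prog L)
      inp (fun _ _ => 0) 11 fun wk =>
        wk 1 0 = if inp 2 0 = 0 then inp 0 1 else inp 0 1 + 1 := by
    refine Runs.store (by simp [Expr.cost]) ?_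
    simp only [Expr.eval, Memory.write_self, Function.update_self]
    split_ifs <;> omega
  refine (s1.seq (T' := 30 * k + 8) fun wk h => ?_).mono (by omega) fun _ h => h
  refine Runs.for (fun j wk => wk 1 0 = (if inp 2 0 = 0 then inp 0 1 else inp 0 1 + 1) ∧
      ∀ i < j, wk 0 i = if inp 2 0 = 0 ∨ i < inp 0 1 then inp 1 i else inp 2 0 - 1) k 19
    ⟨h, by simp⟩ (fun j wk x h => by simpa using h) (fun j wk _ => rfl) (fun j hj wk h hwj => ?_)
    (by simp [Expr.cost]; omega)
  obtain ⟨h1, h2⟩ := h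
  refine Runs.ite (T := 7) (fun c => ?_) (fun c => ?_) (by simp [Expr.cost])
  all_goals
    simp only [Expr.eval, Expr.eval_var, hwj] at c
    refine Runs.store (by simp [Expr.cost]) ⟨by simpa using hwj, by simpa using h1, fun i hi => ?_⟩
    simp only [Expr.eval, Expr.eval_var, hwj, Memory.write_self]
    by_cases hij : i = j
    · subst hij
      rw [Function.update_self]
      split_ifs with h
      · first | rfl | omega
      · first | rfl | omega
    · rw [Function.update_of_ne hij]
      exact h2 i (by omega)

end Step

/-! ### The program for iterated extraction -/

section Extractor

variable {L : FirstOrder.Language.{u, v}} {r : ℕ}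

/-- The program `P` witnesses `AdmitsExtraction C f T Δ`. -/
def IsExtractor (C : Set (Bundled.{w} L.Structure)) (f : ℕ → ℕ) (T : ℕ → ℕ → ℕ)
    (Δ : Set (SeqFormula L r)) (P : Prog L) : Prop :=
  ∀ A ∈ C, ∀ (n : ℕ) (enum : Fin n ≃ A) (m : ℕ) (J : Fin (f m) → Fin r → A),
    Function.Injective J → ∀ inp : Memory, EncodesSequence enum J inp →
      HaltsWithin enum P inp (T (f m) n) fun res =>
        ∃ I : Fin m ↪o Fin (f m), ReturnsSubsequence I res ∧ IsIndiscernible Δ (J ∘ I)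

variable {C : Set (Bundled.{w} L.Structure)} {φ : L.Formula (Fin 2)}
  {α : L.Formula (Fin r ⊕ Unit)} {k : ℕ} {f : ℕ → ℕ} {T : ℕ → ℕ → ℕ} {P : Prog (L[[Fin k]])}

/-- These lower bounds on `T` let bookkeeping that is linear in the length of the output be charged
to the extraction. -/
theorem IsExtractor.le_time (hP : IsExtractor (withConstantSymbols C k) f T
      (patternFormulas k (eqConstFormulas φ α k)) P) {A : Bundled.{w} L.Structure} (hA : A ∈ C)
    {n : ℕ} (enum : Fin n ≃ A) (a : A) {m : ℕ} {J : Fin (f m) → Fin r → A}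
    (hJ : Function.Injective J) : 1 ≤ T (f m) n ∧ m ≤ T (f m) n + 1 := by
  obtain ⟨inp, hinp⟩ := exists_encodesSequence (L := L) enum J
  obtain ⟨t, res, he, ht, I, hI, -⟩ :=
    hP _ (withConstants_mem hA fun _ => a) n enum m J hJ inp hinp
  have := he.one_le
  have := he.le_of_returnsSubsequence hI
  omega

theorem IsExtractor.runs_call [L.IsRelational] (hP : IsExtractor (withConstantSymbols C k) f T
      (patternFormulas k (eqConstFormulas φ α k)) P) {A : Bundled.{w} L.Structure} (hA : A ∈ C)
    {n : ℕ} (enum : Fin n ≃ A) {m : ℕ} {J : Fin (f m) → Fin r → A}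
    (hJ : Function.Injective J) {σ : Fin k → A} {inp wk : Memory} {ins : List (ℕ ⊕ ℕ)}
    (hc : ∀ i : Fin k, wk 2 i = enum.symm (σ i))
    (hins : EncodesSequence enum J (passInputs inp wk ins)) {a b : ℕ} (hab : b ≠ a) :
    Runs enum (.call P.eliminateConstants (Sum.inr 2 :: ins) [a, b]) inp wk
      (3 * T (f m) n + ins.length + 4) fun wk' => (∀ d, d ≠ a → d ≠ b → wk' d = wk d) ∧
        ∃ I : Fin m ↪o Fin (f m), wk' a 0 = m ∧ (∀ i : Fin m, wk' b i = I i) ∧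
          IsEqIndiscernible φ α σ (J ∘ I) := by
  obtain ⟨t, res, he, ht, I, hI, hind⟩ := hP _ (withConstants_mem hA σ) n enum m J hJ _ hins
  obtain ⟨t', he', ht'⟩ := Exec.eliminateConstants hc he
  have hpass : passInputs inp wk (Sum.inr 2 :: ins) = consInput (wk 2) (passInputs inp wk ins) := by
    funext d
    cases d <;> rfl
  rw [← hpass] at he'
  refine ⟨_, _, Exec.call he', by simp; omega, fun d hda hdb => ?_, I, ?_, fun i => ?_, hind⟩
  · simp [returnOutputs, hda, hdb]
  · simpa [returnOutputs] using hI.1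
  · simpa [returnOutputs, hab, List.idxOf_cons, hab.symm] using hI.2 i

theorem encodesSequence_passInputs {M : Type w} {n : ℕ} {enum : Fin n ≃ M} {l : ℕ}
    {J : Fin l → Fin r → M} {inp wk : Memory} {g : ℕ → ℕ ⊕ ℕ} (h0 : wk 8 0 = n) (h1 : wk 8 1 = l)
    (hg : ∀ (c : Fin r) (i : Fin l),
      Sum.elim inp wk (g c) i = (enum.symm (J i c) : ℕ)) :
    EncodesSequence enum J
      (passInputs inp wk (Sum.inr 8 :: (List.range r).map g)) := by
  refine ⟨h0, h1, fun i c => ?_⟩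
  rw [← hg]
  simp only [passInputs, List.getElem?_cons_succ, List.getElem?_map, List.getElem?_range c.2]
  rcases h : g c with a | a <;> simp [h]

end Extractor

/-! ### Programs for a single round -/

section Rounds

variable {L : FirstOrder.Language.{u, v}} {r : ℕ}

/-- The program that collects the first `r` components of the tuples in the list `6`. -/
def Prog.columns : ℕ → Prog L
  | 0 => .skip
  | c + 1 => .seq (.columns c) (.call .gather [Sum.inr 8, Sum.inl (c + 1), Sum.inr 6] [13 + c])

theorem runs_columns {M : Type w} [L.Structure M] {n : ℕ} (enum : Fin n ≃ M) {inp wk : Memory}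
    (r : ℕ) : Runs enum (Prog.columns r : Prog L) inp wk (r * (19 * wk 8 1 + 14) + 1) fun wk' =>
      (∀ d < 13, wk' d = wk d) ∧ ∀ c < r, ∀ i < wk 8 1, wk' (13 + c) i = inp (c + 1) (wk 6 i) := by
  induction r with
  | zero => exact Runs.skip (by omega) ⟨fun d _ => rfl, by simp⟩
  | succ r ih =>
    refine (ih.seq (T' := 19 * wk 8 1 + 14) fun wk1 h => ?_).mono
      (by rw [Nat.succ_mul r]; omega) fun _ h => h
    obtain ⟨h1, h2⟩ := h
    refine Runs.call (haltsWithin_gather enum (T := 19 * wk 8 1 + 9) ?_) (fun res hres => ?_)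
      (by simp; omega)
    · simp [passInputs, h1]
    · refine ⟨fun d hd => ?_, fun c hc i hi => ?_⟩
      · rw [← h1 d hd]
        simp [returnOutputs, show d ≠ 13 + r by omega]
      · by_cases hcr : c = r
        · subst hcr
          have := hres i (by simpa [passInputs, h1] using hi)
          simpa [returnOutputs, passInputs, h1] using this
        · simpa [returnOutputs, hcr] using h2 c (by omega) i hi

/-- The first half of a round: find a new sample element and select the tuples that are kept. -/
def Prog.refine (r k : ℕ) : Prog L :=
  .seq (.call .select
      [Sum.inr 5, Sum.inl (r + 1), Sum.inr 3, Sum.inr 4, Sum.inr 2, Sum.inr 1] [6, 7])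
    (.seq (.call (.update k) [Sum.inr 5, Sum.inr 2, Sum.inr 7] [2, 11])
      (.seq (.store 5 (.const 1) (.var 11))
        (.seq (.store 8 (.const 1) (.sub (.work 5 (.const 2)) (.const 3)))
          (.columns r))))

/-- The second half of a round: extract an indiscernible subsequence. -/
def Prog.extract (r : ℕ) {k : ℕ} (P : Prog (L[[Fin k]])) : Prog L :=
  .seq (.call P.eliminateConstants
      (Sum.inr 2 :: Sum.inr 8 :: (List.range r).map fun c => Sum.inr (13 + c)) [9, 10])
    (.seq (.store 5 (.const 2) (.var 9))
      (.seq (.store 12 (.const 1) (.var 9))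
        (.call .gather [Sum.inr 12, Sum.inr 6, Sum.inr 10] [1])))

/-- The work arrays describe the subsequence `J ∘ e`, the sample elements `σ`, the number `l` of
them that are used, and the truth table of `φ`. -/
structure DescribesRound {M : Type w} [L.Structure M] {n k N m : ℕ} (enum : Fin n ≃ M)
    (φ : L.Formula (Fin 2)) (σ : Fin k → M) (l : ℕ) (e : Fin m ↪o Fin N) (wk : Memory) (a : ℕ) :
    Prop where
  table : IsTableOf enum φ (wk 3) (wk 4)
  size : wk 5 0 = n
  size' : wk 8 0 = n
  used : wk 5 1 = l
  samples : ∀ i : Fin k, wk 2 i = enum.symm (σ i)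
  positions : ∀ i : Fin m, wk a i = e i

/-- The time bound for the first half of a round. -/
def refineTime (r n k m : ℕ) : ℕ := selectTime n k m + 30 * k + r * (19 * m + 14) + 60

theorem selectTime_mono {n l l' m : ℕ} (h : l ≤ l') : selectTime n l m ≤ selectTime n l' m := by
  simp only [selectTime, measureTime]
  gcongr

/-- Besides performing the step, this half prepares the input of the extractor: array `8` holds the
sizes, and the arrays from `13` on hold the components of the kept tuples. -/
theorem runs_refine {M : Type w} [L.Structure M] {n : ℕ} (enum : Fin n ≃ M) (hn : 0 < n)
    {φ : L.Formula (Fin 2)} {α : L.Formula (Fin r ⊕ Unit)} {k l m m' N : ℕ} (hl : l ≤ k)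
    {σ : Fin k → M} {J : Fin N → Fin r → M} {e : Fin m ↪o Fin N}
    (hm : m = m' + 3) {inp wk : Memory} (hJ : EncodesSequence enum J inp)
    (hown : EncodesNbhds enum α J inp) (h : DescribesRound enum φ σ l e wk 1) (hwm : wk 5 2 = m) :
    Runs enum (Prog.refine r k : Prog L) inp wk (refineTime r n k m) fun wk' =>
      wk' 8 1 = m' ∧
      ∃ (σ' : Fin k → M) (l' : ℕ) (e' : Fin m' ↪o Fin m), IsStep φ α σ l (J ∘ e) σ' l' e' ∧
        DescribesRound enum φ σ' l' (e'.trans e) wk' 6 ∧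
        ∀ (c : Fin r) (i : Fin m'), wk' (13 + c) i = enum.symm (J (e (e' i)) c) := by
  have hpos : ∀ i : Fin m, wk 1 i = e i := h.positions
  have s1 : Runs enum (.call .select
      [Sum.inr 5, Sum.inl (r + 1), Sum.inr 3, Sum.inr 4, Sum.inr 2, Sum.inr 1] [6, 7] : Prog L)
      inp wk (selectTime n k m + 9) fun wk' => (∀ d, d ≠ 6 → d ≠ 7 → wk' d = wk d) ∧
        ∃ (σ' : Fin k → M) (l' : ℕ) (e' : Fin m' ↪o Fin m), IsStep φ α σ l (J ∘ e) σ' l' e' ∧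
          (∀ i : Fin m', wk' 6 i = e (e' i)) ∧ ((wk' 7 0 = 0 ∧ l' = l ∧ σ' = σ) ∨
            ∃ x, wk' 7 0 = enum.symm x + 1 ∧ l' = l + 1 ∧
              σ' = fun i => if i.1 < l then σ i else x) := by
    set sinp := passInputs inp wk
      [Sum.inr 5, Sum.inl (r + 1), Sum.inr 3, Sum.inr 4, Sum.inr 2, Sum.inr 1] with hsinp
    have e0 : sinp 0 = wk 5 := rfl
    refine Runs.call (haltsWithin_select enum (by change 0 < wk 5 0; rw [h.size]; exact hn)
      (by change 3 ≤ wk 5 2; omega) (fun i hi j hj hij => ?_)) (fun res hres => ?_) ?_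
    · change i < wk 5 2 at hi
      change j < wk 5 2 at hj
      rw [hwm] at hi hj
      change wk 1 i = wk 1 j at hij
      rw [hpos ⟨i, hi⟩, hpos ⟨j, hj⟩] at hij
      have := e.injective (Fin.ext hij)
      simpa using this
    · refine ⟨fun d h6 h7 => by simp [returnOutputs, h6, h7], ?_⟩
      exact exists_isStep_of_select (inp := sinp) hl hm h.size h.used hwm
        (fun a i => hown.eq_iff a i) h.table h.samples h.positions hres
    · rw [← hsinp, e0, h.size, h.used, hwm]
      have := selectTime_mono (n := n) (m := m) hl
      simp only [List.length_cons, List.length_nil]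
      omega
  refine (s1.seq (T' := 30 * k + r * (19 * m + 14) + 51) fun wk1 h1 => ?_).mono
    (by simp only [refineTime]; omega) fun _ h => h
  obtain ⟨hframe, σ', l', e', hstep, h6, hcase⟩ := h1
  have s2 : Runs enum (.call (.update k) [Sum.inr 5, Sum.inr 2, Sum.inr 7] [2, 11] : Prog L)
      inp wk1 (30 * k + 26) fun wk' => (∀ d, d ≠ 2 → d ≠ 11 → wk' d = wk1 d) ∧ wk' 11 0 = l' ∧
        ∀ i : Fin k, wk' 2 i = enum.symm (σ' i) := by
    refine Runs.call (haltsWithin_update enum (k := k) le_rfl) (fun res hres => ?_)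
      (by simp; omega)
    have r0 : returnOutputs wk1 res [2, 11] 2 = res 0 := rfl
    have r1 : returnOutputs wk1 res [2, 11] 11 = res 1 := rfl
    refine ⟨fun d h2 h11 => by simp [returnOutputs, h2, h11], ?_, fun i => ?_⟩
    · rw [r1, hres.1]
      simp only [passInputs, List.getElem?_cons_zero, List.getElem?_cons_succ]
      rw [hframe 5 (by simp) (by simp), h.used]
      rcases hcase with ⟨hz, rfl, -⟩ | ⟨x, hz, rfl, -⟩ <;> simp [hz]
    · rw [r0, hres.2 i i.2]
      simp only [passInputs, List.getElem?_cons_zero, List.getElem?_cons_succ]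
      simp only [hframe 5 (by simp) (by simp), hframe 2 (by simp) (by simp), h.used, h.samples]
      rcases hcase with ⟨hz, -, rfl⟩ | ⟨x, hz, -, rfl⟩
      · simp [hz]
      · simp only [hz]
        split_ifs <;> simp_all
  refine (s2.seq (T' := r * (19 * m + 14) + 25) fun wk2 h2 => ?_).mono (by omega) fun _ h => h
  obtain ⟨hframe2, h11, h2⟩ := h2
  have g : ∀ d, d ≠ 2 → d ≠ 11 → d ≠ 6 → d ≠ 7 → wk2 d = wk d := fun d a b c d' => by
    rw [hframe2 d a b, hframe d c d']
  have s3 : Runs enum (.seq (.store 5 (.const 1) (.var 11))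
      (.store 8 (.const 1) (.sub (.work 5 (.const 2)) (.const 3))) : Prog L) inp wk2 12
      fun wk' => wk' 8 1 = m' ∧ DescribesRound enum φ σ' l' (e'.trans e) wk' 6 := by
    refine Runs.seq (T := 4) (T' := 8) (Q := fun wk' => wk' = wk2.write 5 1 l')
      (Runs.store (by simp [Expr.cost]) (by simp [Expr.eval, h11])) fun wk3 h3 => ?_
    subst h3
    refine Runs.store (by simp [Expr.cost]) ?_
    have h52 : wk2 5 2 = m := by rw [g 5 (by simp) (by simp) (by simp) (by simp), hwm]
    have h50 : wk2 5 0 = n := by rw [g 5 (by simp) (by simp) (by simp) (by simp), h.size]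
    have h80 : wk2 8 0 = n := by rw [g 8 (by simp) (by simp) (by simp) (by simp), h.size']
    have h3 : wk2 3 = wk 3 := g 3 (by simp) (by simp) (by simp) (by simp)
    have h4 : wk2 4 = wk 4 := g 4 (by simp) (by simp) (by simp) (by simp)
    have h6' : wk2 6 = wk1 6 := hframe2 6 (by simp) (by simp)
    refine ⟨?_, ⟨?_, ?_, ?_, ?_, ?_, ?_⟩⟩
    · simp [Expr.eval, h52, hm]
    · simpa [h3, h4] using h.table
    · simpa using h50
    · simpa [Expr.eval] using h80
    · simp
    · simpa using h2
    · simpa [h6'] using h6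
  have s4 := (s3.seq (T' := r * (19 * m + 14) + 1) (q := Prog.columns r)
    (Q' := fun wk' => wk' 8 1 = m' ∧ DescribesRound enum φ σ' l' (e'.trans e) wk' 6 ∧
      ∀ (c : Fin r) (i : Fin m'), wk' (13 + c) i = enum.symm (J (e (e' i)) c)) fun wk3 h3 => ?_)
  · obtain ⟨t, wk', hx, ht, hq⟩ := s4
    cases hx with
    | seq hx1 hx2 =>
      cases hx1 with
      | seq hx3 hx4 =>
        exact ⟨_, _, Exec.seq hx3 (Exec.seq hx4 hx2), by omega, hq.1, σ', l', e', hstep, hq.2⟩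
  · obtain ⟨h81, hd⟩ := h3
    refine (runs_columns enum r).mono ?_ fun wk' h' => ?_
    · gcongr
      omega
    · obtain ⟨hf, hcol⟩ := h'
      refine ⟨by rw [hf 8 (by simp), h81], ⟨?_, ?_, ?_, ?_, ?_, ?_⟩, fun c i => ?_⟩
      · rw [hf 3 (by simp), hf 4 (by simp)]; exact hd.table
      · rw [hf 5 (by simp)]; exact hd.size
      · rw [hf 8 (by simp)]; exact hd.size'
      · rw [hf 5 (by simp)]; exact hd.used
      · rw [hf 2 (by simp)]; exact hd.samples
      · rw [hf 6 (by simp)]; exact hd.positions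
      · rw [hcol c c.2 i (by rw [h81]; exact i.2), hd.positions]
        exact hJ.2.2 _ c

/-- The extractor answers with positions relative to the kept list; composing with array `6` turns
them into positions in the original sequence. -/
theorem IsExtractor.runs_extract [L.IsRelational] {C : Set (Bundled.{w} L.Structure)}
    {φ : L.Formula (Fin 2)} {α : L.Formula (Fin r ⊕ Unit)} {k : ℕ} {f : ℕ → ℕ} {T : ℕ → ℕ → ℕ}
    {P : Prog (L[[Fin k]])} (hP : IsExtractor (withConstantSymbols C k) f T
      (patternFormulas k (eqConstFormulas φ α k)) P) {A : Bundled.{w} L.Structure} (hA : A ∈ C)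
    {n : ℕ} (enum : Fin n ≃ A) {m l N : ℕ} {J : Fin N → Fin r → A}
    (hJ : Function.Injective J) {σ : Fin k → A} {e : Fin (f m) ↪o Fin N} {inp wk : Memory}
    (h : DescribesRound enum φ σ l e wk 6) (hwm : wk 8 1 = f m)
    (hcol : ∀ (c : Fin r) (i : Fin (f m)), wk (13 + c) i = enum.symm (J (e i) c)) :
    Runs enum (Prog.extract r P) inp wk (3 * T (f m) n + 19 * m + r + 27) fun wk' =>
      wk' 5 2 = m ∧ ∃ I : Fin m ↪o Fin (f m), IsEqIndiscernible φ α σ (J ∘ e ∘ I) ∧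
        DescribesRound enum φ σ l (I.trans e) wk' 1 := by
  have hins : EncodesSequence enum (J ∘ e) (passInputs inp wk
      (Sum.inr 8 :: (List.range r).map fun c => Sum.inr (13 + c))) :=
    encodesSequence_passInputs (g := fun c => Sum.inr (13 + c)) h.size' hwm fun c i => hcol c i
  refine ((hP.runs_call hA enum (hJ.comp e.injective) h.samples hins (a := 9) (b := 10)
    (by simp)).seq (T' := 19 * m + 22) fun wk1 h1 => ?_).mono (by simp; omega) fun _ h => h
  obtain ⟨hframe, I, h9, h10, hind⟩ := h1
  refine (Runs.seq (T := 4) (Q := fun wk' => wk' = wk1.write 5 2 m)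
    (Runs.store (by simp [Expr.cost]) (by simp [Expr.eval, h9])) (T' := 19 * m + 18)
    fun wk2 h2 => ?_).mono (by omega) fun _ h => h
  subst h2
  refine (Runs.seq (T := 4) (Q := fun wk' => wk' = (wk1.write 5 2 m).write 12 1 m)
    (Runs.store (by simp [Expr.cost]) (by simp [Expr.eval, h9])) (T' := 19 * m + 14)
    fun wk3 h3 => ?_).mono (by omega) fun _ h => h
  subst h3
  refine Runs.call (haltsWithin_gather enum (T := 19 * m + 9) (by simp [passInputs]))
    (fun res hres => ?_) (by simp; omega)
  simp only [passInputs, List.getElem?_cons_zero, List.getElem?_cons_succ] at hres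
  refine ⟨by simp [returnOutputs], I, hind, ⟨?_, ?_, ?_, ?_, ?_, fun i => ?_⟩⟩
  · simpa [returnOutputs, hframe] using h.table
  · simpa [returnOutputs, hframe] using h.size
  · simpa [returnOutputs, hframe] using h.size'
  · simpa [returnOutputs, hframe] using h.used
  · simpa [returnOutputs, hframe] using h.samples
  · have := hres i (by simp)
    simp only [Memory.write_of_ne _ _ _ (show (6 : ℕ) ≠ 12 by simp),
      Memory.write_of_ne _ _ _ (show (6 : ℕ) ≠ 5 by simp),
      Memory.write_of_ne _ _ _ (show (10 : ℕ) ≠ 12 by simp),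
      Memory.write_of_ne _ _ _ (show (10 : ℕ) ≠ 5 by simp), h10,
      hframe 6 (by simp) (by simp), h.positions] at this
    simpa [returnOutputs] using this

end Rounds

/-! ### The complete program and its running time -/

section Main

variable {L : FirstOrder.Language.{u, v}} {r : ℕ}

/-- The `j`-fold repetition of a program. -/
def Prog.repeat : ℕ → Prog L → Prog L
  | 0, _ => .skip
  | j + 1, p => .seq (Prog.repeat j p) p

theorem Runs.repeat {M : Type w} [L.Structure M] {n : ℕ} {enum : Fin n ≃ M} {p : Prog L}
    {inp wk : Memory} (Inv : ℕ → Memory → Prop) (N Tb : ℕ) (h0 : Inv 0 wk)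
    (h : ∀ j < N, ∀ wk, Inv j wk → Runs enum p inp wk Tb (Inv (j + 1))) :
    Runs enum (Prog.repeat N p) inp wk (N * Tb + 1) (Inv N) := by
  induction N with
  | zero => exact Runs.skip (by omega) h0
  | succ N ih =>
    refine ((ih fun j hj => h j (by omega)).seq fun wk' h' => h N (by omega) wk' h').mono
      ?_ fun _ h => h
    rw [Nat.succ_mul N]
    omega

/-- The program that computes the truth table and a first indiscernible subsequence. -/
def Prog.prepare (r : ℕ) {k : ℕ} (P : Prog (L[[Fin k]])) (p : Prog L) : Prog L :=
  .seq (.call p.tabulate [Sum.inl 0] [3, 4])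
    (.seq (.store 5 (.const 0) (.input 0 (.const 0)))
      (.seq (.store 8 (.const 0) (.input 0 (.const 0)))
        (.seq (.store 8 (.const 1) (.sub (.input 0 (.const 1)) (.const 3)))
          (.seq (.call P.eliminateConstants
              (Sum.inr 2 :: Sum.inr 8 :: (List.range r).map fun c => Sum.inl (c + 1)) [9, 1])
            (.store 5 (.const 2) (.var 9))))))

theorem IsExtractor.runs_prepare [L.IsRelational] {C : Set (Bundled.{w} L.Structure)}
    {φ : L.Formula (Fin 2)} {α : L.Formula (Fin r ⊕ Unit)} {k : ℕ} {f : ℕ → ℕ} {T : ℕ → ℕ → ℕ}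
    {P : Prog (L[[Fin k]])} (hP : IsExtractor (withConstantSymbols C k) f T
      (patternFormulas k (eqConstFormulas φ α k)) P) {A : Bundled.{w} L.Structure} (hA : A ∈ C)
    {n : ℕ} (enum : Fin n ≃ A) {p : Prog L} {F : ℕ}
    (hp : ∀ (a b : A) (inp : Memory), inp 0 0 = n → inp 1 0 = enum.symm a →
      inp 1 1 = enum.symm b → HaltsWithin enum p inp F fun res =>
        (b ∈ nbhd φ a → res 0 0 = 1) ∧ (b ∉ nbhd φ a → res 0 0 = 0))
    {m N : ℕ} (hN : N = f m + 3) {J : Fin N → Fin r → A} (hJ : Function.Injective J)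
    {inp : Memory} (hinp : EncodesSequence enum J inp) {a : A} (ha : (enum.symm a : ℕ) = 0) :
    Runs enum (Prog.prepare r P p) inp (fun _ _ => 0)
      (n * (n * (F + 36) + 30) + 3 * T (f m) n + r + 36) fun wk => wk 5 2 = m ∧
        ∃ e : Fin m ↪o Fin N, IsEqIndiscernible φ α (fun _ : Fin k => a) (J ∘ e) ∧
          DescribesRound enum φ (fun _ : Fin k => a) 0 e wk 1 := by
  have hle : f m ≤ N := by omega
  refine (Runs.seq (T := n * (n * (F + 36) + 30) + 13) (Q := fun wk =>
    (∀ d, d ≠ 3 → d ≠ 4 → wk d = fun _ => 0) ∧ IsTableOf enum φ (wk 3) (wk 4))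
    (Runs.call (haltsWithin_tabulate enum hp (inp := passInputs inp (fun _ _ => 0) [Sum.inl 0])
      hinp.1 le_rfl) (fun res hres => ⟨fun d h3 h4 => by simp [returnOutputs, h3, h4], by
        simpa [returnOutputs, List.idxOf_cons] using hres⟩) (by simp; omega)) (T' := 3 * T (f m) n + r + 23) fun wk1 h1 => ?_).mono (by omega) fun _ h => h
  obtain ⟨hzero, htab⟩ := h1
  refine (Runs.seq (T := 4) (Q := fun wk' => wk' = wk1.write 5 0 n)
    (Runs.store (by simp [Expr.cost]) (by simp [Expr.eval, hinp.1]))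
    (T' := 3 * T (f m) n + r + 19) fun wk2 h2 => ?_).mono (by omega) fun _ h => h
  subst h2
  refine (Runs.seq (T := 4) (Q := fun wk' => wk' = (wk1.write 5 0 n).write 8 0 n)
    (Runs.store (by simp [Expr.cost]) (by simp [Expr.eval, hinp.1]))
    (T' := 3 * T (f m) n + r + 15) fun wk3 h3 => ?_).mono (by omega) fun _ h => h
  subst h3
  refine (Runs.seq (T := 6)
    (Q := fun wk' => wk' = ((wk1.write 5 0 n).write 8 0 n).write 8 1 (f m))
    (Runs.store (by simp [Expr.cost]) (by simp [Expr.eval, hinp.2.1, hN]))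
    (T' := 3 * T (f m) n + r + 9) fun wk4 h4 => ?_).mono (by omega) fun _ h => h
  subst h4
  have hins : EncodesSequence enum (J ∘ Fin.castLE hle)
      (passInputs inp (((wk1.write 5 0 n).write 8 0 n).write 8 1 (f m))
        (Sum.inr 8 :: (List.range r).map fun c => Sum.inl (c + 1))) :=
    encodesSequence_passInputs (g := fun c => Sum.inl (c + 1)) (by simp) (by simp)
      fun c i => hinp.2.2 (Fin.castLE hle i) c
  -- Array `2` has not been written yet, so every constant is read as the element with number `0`,
  -- which is `a`.
  refine ((hP.runs_call hA enum (hJ.comp (Fin.castLE_injective _)) (σ := fun _ => a) (fun i => ?_)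
    hins (a := 9) (b := 1) (by simp)).seq (T' := 4) fun wk5 h5 => ?_).mono (by simp; omega) fun _ h => h
  · simp [hzero, ha]
  · obtain ⟨hframe, I, h9, hI, hind⟩ := h5
    refine Runs.store (by simp [Expr.cost]) ⟨by simp [Expr.eval, h9],
      I.trans (Fin.castLEOrderEmb hle), hind, ⟨?_, ?_, ?_, ?_, ?_, ?_⟩⟩
    · simpa [hframe] using htab
    · simp [Expr.eval, hframe]
    · simp [hframe]
    · simp [Expr.eval, hframe, hzero]
    · simp [hframe, hzero, ha]
    · simpa using hI

/-- The program for the whole construction. -/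
def Prog.sample (r : ℕ) {k : ℕ} (P : Prog (L[[Fin k]])) (p : Prog L) : Prog L :=
  .seq (Prog.prepare r P p)
    (.seq (Prog.repeat (k - 1) (.seq (Prog.refine r k) (Prog.extract r P)))
      (.seq (.store 0 (.const 0) (.work 5 (.const 2))) (.store 0 (.const 1) (.const k))))

/-- Here `X` is the extraction time at the full length. It bounds all extractions, and `X + 1`
bounds the sequence lengths in the rounds. Each round contributes order `X + k * n ^ 2`, and the
tabulation contributes order `F * n ^ 2`. -/
theorem sampleTime_le {r n k X F : ℕ} (hn : 1 ≤ n) (hk : 1 ≤ k) (hX : 1 ≤ X) (hF : 1 ≤ F) :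
    (n * (n * (F + 36) + 30) + 3 * X + r + 36) +
        (((k - 1) * (refineTime r n k (X + 1) + 22 * X + r + 46) + 1) + 7) ≤
      (1000 + 100 * r) * (k * X + k ^ 2 * F * n ^ 2) := by
  have hround : refineTime r n k (X + 1) + 22 * X + r + 46 ≤
      (700 + 60 * r) * (X + k * n ^ 2) := by
    have h1 : n ≤ k * n ^ 2 := by nlinarith [Nat.mul_le_mul hk hn, Nat.mul_le_mul hn hn]
    have h2 : k ≤ k * n ^ 2 := Nat.le_mul_of_pos_right _ (by positivity)
    have h3 : n ≤ k * n := Nat.le_mul_of_pos_left _ hk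
    have h4 : k ≤ k * n := Nat.le_mul_of_pos_right _ hn
    have h5 : (n + 1) * measureTime n k ≤ 346 * (k * n ^ 2) :=
      calc (n + 1) * measureTime n k ≤ (2 * n) * (173 * (k * n)) := by
            refine Nat.mul_le_mul (by omega) ?_
            simp only [measureTime]
            rw [Nat.mul_add, show k * (70 * n) = 70 * (k * n) by ring]
            omega
        _ = 346 * (k * n ^ 2) := by ring
    have h6 : r * (19 * (X + 1) + 14) ≤ r * (52 * X) := Nat.mul_le_mul_left _ (by omega)
    have h7 : r ≤ r * X := Nat.le_mul_of_pos_right _ hX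
    have h8 : r * (52 * X) = 52 * (r * X) := by ring
    have h9 : (700 + 60 * r) * (X + k * n ^ 2) =
        700 * X + 700 * (k * n ^ 2) + 60 * (r * X) + 60 * (r * (k * n ^ 2)) := by ring
    simp only [refineTime, selectTime]
    omega
  have h1 : (k - 1) * (refineTime r n k (X + 1) + 22 * X + r + 46) ≤
      (700 + 60 * r) * (k * X + k ^ 2 * F * n ^ 2) :=
    calc _ ≤ k * ((700 + 60 * r) * (X + k * n ^ 2)) := Nat.mul_le_mul (by omega) hround
      _ = (700 + 60 * r) * (k * X + k ^ 2 * 1 * n ^ 2) := by ring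
      _ ≤ _ := by gcongr
  have h2 : n * (n * (F + 36) + 30) ≤ 67 * (k ^ 2 * F * n ^ 2) :=
    calc n * (n * (F + 36) + 30) ≤ n * (n * (37 * F) + 30 * (n * F)) := by
          have : 1 ≤ n * F := Nat.mul_pos hn hF
          gcongr <;> omega
      _ = 67 * (1 ^ 2 * F * n ^ 2) := by ring
      _ ≤ _ := by gcongr
  have h3 : X ≤ k * X := Nat.le_mul_of_pos_left _ hk
  have h4 : r ≤ r * (k * X) := Nat.le_mul_of_pos_right _ (by omega)
  have h5 : (1000 + 100 * r) * (k * X + k ^ 2 * F * n ^ 2) =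
      (700 + 60 * r) * (k * X + k ^ 2 * F * n ^ 2) + 300 * (k * X) +
        300 * (k ^ 2 * F * n ^ 2) + 40 * (r * (k * X)) + 40 * (r * (k ^ 2 * F * n ^ 2)) := by ring
  omega

/-- The program follows the same rounds as the existence proof, with `StageInvariant` for the
mathematics and `DescribesRound` for the memory. Monotonicity of `T` replaces the time of every
extraction by that at the full length. -/
theorem haltsWithin_sample [L.IsRelational] {C : Set (Bundled.{w} L.Structure)}
    (hne : ∀ A ∈ C, Nonempty A) (hfin : ∀ A ∈ C, Finite A)
    {φ : L.Formula (Fin 2)} {α : L.Formula (Fin r ⊕ Unit)}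
    {l₀ B : ℕ} (hl₀ : 1 ≤ l₀) {k : ℕ}
    (hstage : ∀ A ∈ C, ∀ (j n n' n'' : ℕ) (σ : Fin k → A) (l : ℕ)
      (I : Fin n → Fin r → A) (σ' : Fin k → A) (l' : ℕ) (e : Fin n' ↪o Fin n)
      (e' : Fin n'' ↪o Fin n'), IsEqIndiscernible φ α σ I →
      StageInvariant φ α (IsMonadicallyStable C) l₀ j σ l I → j < k → n = n' + 3 → 0 < n'' →
      (j < l₀ → B ≤ n'') → IsStep φ α σ l I σ' l' e →
      StageInvariant φ α (IsMonadicallyStable C) l₀ (j + 1) σ' l' (I ∘ e ∘ e'))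
    (hk : B + l₀ + 1 ≤ k) {f : ℕ → ℕ} {T : ℕ → ℕ → ℕ} (hT : ∀ n, Monotone fun l => T l n)
    {P : Prog (L[[Fin k]])} (hP : IsExtractor (withConstantSymbols C k) f T
      (patternFormulas k (eqConstFormulas φ α k)) P) {A : Bundled.{w} L.Structure} (hA : A ∈ C)
    {n : ℕ} (enum : Fin n ≃ A) {p : Prog L} {F : ℕ}
    (hp : ∀ (a b : A) (inp : Memory), inp 0 0 = n → inp 1 0 = enum.symm a →
      inp 1 1 = enum.symm b → HaltsWithin enum p inp F fun res =>
        (b ∈ nbhd φ a → res 0 0 = 1) ∧ (b ∉ nbhd φ a → res 0 0 = 0))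
    {m N : ℕ} (hm : 1 ≤ m) (hN : N = (fun x => f x + 3)^[k] m) {J : Fin N → Fin r → A}
    (hJ : Function.Injective J) (hdis : HasDisjointNbhds α J) {inp : Memory}
    (hinp : EncodesSequence enum J inp) (hown : EncodesNbhds enum α J inp) :
    HaltsWithin enum (Prog.sample r P p) inp
      ((1000 + 100 * r) * (k * T N n + k ^ 2 * F * n ^ 2)) fun res =>
        ∃ (I : Fin m ↪o Fin N) (σ : Fin k → A),
          ReturnsSubsequence I res ∧ ReturnsElements enum σ res ∧
          IsSampledBy φ α (IsMonadicallyStable C) (J ∘ I) (Set.range σ) := by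
  obtain ⟨a₀⟩ := hne A hA
  have hn : 0 < n := (Nat.zero_le _).trans_lt (enum.symm a₀).2
  have hlen := iterate_lengths (f := f) (k := k) (m := m)
    fun x hx => AdmitsExtraction.le hfin ⟨P, hP⟩ hA a₀ J hJ x (by omega)
  rw [← hN] at hlen
  have hstep : ∀ i, (fun x => f x + 3)^[i + 1] m = f ((fun x => f x + 3)^[i] m) + 3 := fun i =>
    Function.iterate_succ_apply' _ _ _
  have htime : ∀ i < k, T (f ((fun x => f x + 3)^[i] m)) n ≤ T N n ∧ 1 ≤ T N n ∧
      (fun x => f x + 3)^[i] m ≤ T N n + 1 := by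
    intro i hi
    have hle : f ((fun x => f x + 3)^[i] m) ≤ N := by
      have := (hlen (i + 1) hi).1
      rw [hstep] at this
      omega
    have h1 : T (f ((fun x => f x + 3)^[i] m)) n ≤ T N n := hT n hle
    have := hP.le_time hA enum a₀ (hJ.comp (Fin.castLE_injective hle))
    omega
  have hX : 1 ≤ T N n := (htime 0 (by omega)).2.1
  -- Any halting program takes at least one step, so the factor `F` can absorb the overhead of
  -- tabulation.
  have hF : 1 ≤ F := by
    obtain ⟨t, res, he, ht, -⟩ := hp a₀ a₀
      (fun a i => if a = 0 then n else (enum.symm a₀ : ℕ)) (by simp) (by simp) (by simp)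
    exact he.one_le.trans ht
  let Inv' : ℕ → ℕ → Memory → Prop := fun m j wk => wk 5 2 = m ∧
    ∃ (σ : Fin k → A) (l : ℕ) (e : Fin m ↪o Fin N), IsEqIndiscernible φ α σ (J ∘ e) ∧
      StageInvariant φ α (IsMonadicallyStable C) l₀ j σ l (J ∘ e) ∧
        DescribesRound enum φ σ l e wk 1
  let Inv : ℕ → Memory → Prop := fun j => Inv' ((fun x => f x + 3)^[k - 1 - j] m) j
  have hinit : Runs enum (Prog.prepare r P p) inp (fun _ _ => 0)
      (n * (n * (F + 36) + 30) + 3 * T N n + r + 36) (Inv 0) := by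
    have hN' : N = f ((fun x => f x + 3)^[k - 1 - 0] m) + 3 := by
      rw [← hstep, hN, show k - 1 - 0 + 1 = k by omega]
    refine (hP.runs_prepare hA enum hp hN' hJ hinp (a := enum ⟨0, hn⟩) (by simp)).mono ?_ ?_
    · have := (htime (k - 1 - 0) (by omega)).1
      omega
    · rintro wk ⟨h5, e, hind, hd⟩
      exact ⟨h5, _, 0, e, hind, StageInvariant.zero hl₀ (hdis.comp _) _, hd⟩
  have hround : ∀ j < k - 1, ∀ wk, Inv j wk →
      Runs enum (.seq (Prog.refine r k) (Prog.extract r P)) inp wk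
        (refineTime r n k (T N n + 1) + 22 * T N n + r + 46) (Inv (j + 1)) := by
    rintro j hj wk ⟨h5, σ, l, e, hind, hinv, hd⟩
    obtain ⟨i, hi⟩ : ∃ i, k - 1 - j = i + 1 := ⟨k - 1 - j - 1, by omega⟩
    have hi' : k - 1 - (j + 1) = i := by omega
    change Runs enum _ inp wk _ (Inv' _ _)
    rw [hi']
    have hm' : (fun x => f x + 3)^[k - 1 - j] m = f ((fun x => f x + 3)^[i] m) + 3 := by
      rw [hi, hstep]
    have ht := htime i (by omega)
    have ht' := htime (k - 1 - j) (by omega)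
    refine ((runs_refine enum hn (hinv.le.trans (by omega)) hm' hinp hown hd h5).seq
      (T' := 22 * T N n + r + 46) fun wk1 h1 => ?_).mono ?_ fun _ h => h
    · obtain ⟨h81, σ', l', e', hst, hd', hcol⟩ := h1
      refine (hP.runs_extract hA enum hJ hd' h81 hcol).mono (by omega) ?_
      rintro wk2 ⟨h52, I, hind', hd2⟩
      refine ⟨h52, σ', l', I.trans (e'.trans e), hind', ?_, hd2⟩
      have := (hlen i (by omega)).2
      exact hstage A hA j _ _ _ σ l _ σ' l' e' I hind hinv (by omega) hm' (by omega) (by omega) hst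
    · have : refineTime r n k ((fun x => f x + 3)^[k - 1 - j] m) ≤
          refineTime r n k (T N n + 1) := by
        have := ht'.2.2
        simp only [refineTime, selectTime]
        gcongr
      omega
  refine (hinit.seq fun wk h => (Runs.repeat Inv (k - 1) _ h hround).seq fun wk' h' => ?_).mono
    (sampleTime_le (r := r) hn (by omega) hX hF) fun _ h => h
  have h'' : Inv' ((fun x => f x + 3)^[k - 1 - (k - 1)] m) (k - 1) wk' := h'
  rw [Nat.sub_self] at h''
  change Inv' m (k - 1) wk' at h''
  obtain ⟨h5, σ, l, e, -, hinv, hd⟩ := h''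
  refine Runs.seq (T := 4) (T' := 3) (Q := fun wk'' => wk'' = wk'.write 0 0 m)
    (Runs.store (by simp [Expr.cost]) (by simp [Expr.eval, h5])) fun wk'' h'' => ?_
  subst h''
  refine Runs.store (by simp [Expr.cost]) ⟨e, σ, ⟨?_, fun i => ?_⟩, ⟨?_, fun i => ?_⟩, ?_⟩
  · simp [Expr.eval]
  · simpa using hd.positions i
  · simp [Expr.eval]
  · simpa using hd.samples i
  · rcases hinv.fresh_or_sampled with ⟨-, h, -⟩ | ⟨-, h⟩
    · omega
    · exact h

end Main

end DisjointFamilies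

theorem mainTheorem10 {L : FirstOrder.Language.{u, v}} [L.IsRelational]
    (C : Set (Bundled.{w} L.Structure)) (hfin : ∀ A ∈ C, Finite A) (hne : ∀ A ∈ C, Nonempty A)
    (hC : IsMonadicallyNIP C) {r : ℕ} (φ : L.Formula (Fin 2)) (α : L.Formula (Fin r ⊕ Unit)) :
    ∃ c k₀ : ℕ, ∀ k ≥ k₀, ∀ (f : ℕ → ℕ) (T : ℕ → ℕ → ℕ),
      AdmitsExtraction (withConstantSymbols C k) f T (patternFormulas k (eqConstFormulas φ α k)) →
      (∀ A ∈ C, ∀ m ≥ 1, ∀ J : Fin ((fun x => f x + 3)^[k] m) → Fin r → A,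
        Function.Injective J → HasDisjointNbhds α J →
          ∃ (I : Fin m ↪o Fin ((fun x => f x + 3)^[k] m)) (S : Finset A),
            S.card ≤ k ∧ IsSampledBy φ α (IsMonadicallyStable C) (J ∘ I) S) ∧
      ((∀ n, Monotone fun l => T l n) → ∀ F : ℕ → ℕ, IsCheckableInTime C φ F →
        ∃ P : Prog L, ∀ A ∈ C, ∀ (n : ℕ) (enum : Fin n ≃ A), ∀ m ≥ 1,
          ∀ J : Fin ((fun x => f x + 3)^[k] m) → Fin r → A,
          Function.Injective J → HasDisjointNbhds α J →
          ∀ inp : Memory, EncodesSequence enum J inp → EncodesNbhds enum α J inp →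
            HaltsWithin enum P inp
              (c * (k * T ((fun x => f x + 3)^[k] m) n + k ^ 2 * F n * n ^ 2)) fun res =>
              ∃ (I : Fin m ↪o Fin ((fun x => f x + 3)^[k] m)) (p : ℕ) (s : Fin p → A),
                p ≤ k ∧ ReturnsSubsequence I res ∧ ReturnsElements enum s res ∧
                IsSampledBy φ α (IsMonadicallyStable C) (J ∘ I) (Set.range s)) := by
  obtain ⟨l₀, B, hl₀, -, hstage⟩ := exists_bound_stage hC φ α
  -- Taking `k` at least `B + l₀ + 1` leaves sequences of length at least `B` after each of the
  -- first `l₀` rounds. The dependence of `c` on `r` comes from copying the components of the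
  -- tuples.
  refine ⟨1000 + 100 * r, B + l₀ + 1, fun k hk f T hext => ⟨fun A hA m hm J hJ hdis => ?_,
    fun hT F hF => ?_⟩⟩
  · classical
    obtain ⟨I, σ, h⟩ := exists_sampled hfin hne hl₀ (hstage k (by omega)) hk hext hA hm J hJ hdis
    refine ⟨I, Finset.univ.image σ, ?_, by simpa using h⟩
    simpa using Finset.card_image_le (s := Finset.univ) (f := σ)
  · obtain ⟨P, hP⟩ := hext
    obtain ⟨p, hp⟩ := hF
    refine ⟨Prog.sample r P p, fun A hA n enum m hm J hJ hdis inp hinp hown => ?_⟩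
    obtain ⟨t, res, he, ht, I, σ, h1, h2, h3⟩ := haltsWithin_sample hne hfin hl₀
      (hstage k (by omega)) hk hT hP hA enum (hp A hA n enum) hm rfl hJ hdis hinp hown
    exact ⟨t, res, he, ht, I, k, σ, le_rfl, h1, h2, h3⟩
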